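/- **Setting.** Let $1\le k_1<k_2$ and $D\ge 3$ be integers, $\frac1\kappa=\frac1{k_1}-\frac1{k_2}$, $q>1$, $\alpha\in\mathbb R$. For $1\le \ell\le D-1$ let $I_\ell$ be a finite nonempty set of nonnegative integers, and let $d_D\ge1$, $\delta_\ell\ge 1$, $d_{\lambda,\ell}\ge1$, $\Delta_{\lambda,\ell}\ge0$ ($\lambda\in I_\ell$) be integers with $\delta_1=1$, $\delta_\ell<\delta_{\ell+1}$ ($1\le\ell\le D-2$) and $$\Delta_{\lambda,\ell}\ge d_{\lambda,\ell},\qquad \tfrac{d_{\lambda,\ell}}{k_2}+1\ge\delta_\ell,\qquad \tfrac{d_D-1}{k_2}+1\ge\delta_\ell .$$ Let $\beta>0$, $\epsilon_0>0$, $\varpi>0$, and $Q,R_1,\dots,R_D\in\mathbb C[X]$ with $\deg Q\ge\deg R_D\ge\deg R_\ell$, $Q(im)\ne0$, $R_D(im)\neq0$ for $m\in\mathbb R$, and $\mu>\deg R_D+1$. A sector with bisecting direction $d$ is a set $\{\tau\ne0:|\arg(\tau e^{-id})|<\theta\}$ (infinite sector) or its intersection with a disc $D(0,r)$ (finite sector).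 Let $U_d$ be an infinite sector of bisecting direction $d\in\mathbb{R}$ and $\rho,\delta>0$ with $\operatorname{dist}(U_d\cup D(0,\rho),-\delta)>0$. Let $S_d$ be an infinite and $\mathcal R_d^b$ a finite sector of bisecting direction $d$, both of half-opening less than $\pi$, with $\mathcal R^b_d\subseteq\overline D(0,\rho_1)$; assume that there is $M_1>0$ with $|\tau-z|\ge M_1(1+|\tau|)$ for all $\tau\in S_d\cup\overline D(0,\rho_1)$, all $m\in\mathbb R$ and all roots $z$ of $$P_m(\tau)=\frac{Q(im)}{(q^{1/k_2})^{k_2(k_2-1)/2}}-\frac{R_D(im)}{(q^{1/k_2})^{(d_D+k_2)(d_D+k_2-1)/2}}\tau^{d_D}.$$ *Spaces.* $E_{(\beta,\mu)}$ is the space of continuous $h:\mathbb R\to\mathbb C$ with $\|h\|_{(\beta,\mu)}=\sup_m(1+|m|)^\mu e^{\beta|m|}|h(m)|<\infty$. $\mathrm{Exp}^d_{(k,\beta,\mu,\alpha,\rho)}$ is the space of continuous functions on $(U_d\cup\overline D(0,\rho))\times\mathbb R$, holomorphic in $\tau\in U_d\cup D(0,\rho)$, with $$\sup_{\tau,m}(1+|m|)^\mu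 e^{\beta|m|}\exp\Big(-\tfrac{k\log^2|\tau+\delta|}{2\log q}-\alpha\log|\tau+\delta|\Big)|h(\tau,m)|<\infty .$$ $\mathrm{Exp}^d_{(k,\beta,\mu,\nu)}$ is the space of continuous functions on $(S_d\cup(\overline{\mathcal R_d^b}\setminus\{0\}))\times\mathbb R$, holomorphic in $\tau\in S_d\cup\mathcal R^b_d$, with $$\sup_{\tau,m}(1+|m|)^\mu e^{\beta|m|}\exp\Big(-\tfrac{k\log^2|\tau|}{2\log q}-\nu\log|\tau|\Big)|h(\tau,m)|<\infty .$$ These suprema are the norms. *Transforms.* $\sigma_q^\gamma w(\tau)=w(q^\gamma\tau)$; $(h_1\ast^{R}h_2)(m)=\int_{\mathbb R}h_1(m-m_1)R(im_1)h_2(m_1)\,dm_1$; $$\Theta_{q^{1/\kappa}}(x)=\sum_{n\in\mathbb Z}q^{-\frac{n(n-1)}{2\kappa}}x^n,\qquad \pi_{q^{1/\kappa}}=\frac{\log q}{\kappa}\prod_{n\ge0}\big(1-q^{-\frac{n+1}{\kappa}}\big)^{-1},$$ $$\mathcal L^d_{q;1/\kappa}(f)(\tau)=\frac1{\pi_{q^{1/\kappa}}}\int_{\mathbb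 R_+e^{id}}\frac{f(u)}{\Theta_{q^{1/\kappa}}(u/\tau)}\frac{du}u,\qquad \mathcal R_{d,\tilde\delta}=\Big\{T\in\mathbb C^\star:\Big|1+\frac{e^{id}r}{T}\Big|>\tilde\delta\ \ \forall r\ge0\Big\}.$$ *Data.* For $1\le\ell\le D-1$, $\lambda\in I_\ell$, let $C_{\lambda,\ell}(\cdot,\epsilon)\in E_{(\beta,\mu)}$ depend holomorphically on $\epsilon\in D(0,\epsilon_0)$, with $\|C_{\lambda,\ell}(\cdot,\epsilon)\|_{(\beta,\mu)}\le\tilde C_{\lambda,\ell}$. Let $F_n(\cdot,\epsilon)\in E_{(\beta,\mu)}$, $n\ge0$, depend holomorphically on $\epsilon\in D(0,\epsilon_0)$, with $\|F_n(\cdot,\epsilon)\|_{(\beta,\mu)}\le C_F\rho^{-n}q^{\frac{n(n-1)}{2k_1}}$, and assume that $\sum_n F_n(m,\epsilon)\tau^n/(q^{1/k_1})^{n(n-1)/2}$, $|\tau|<\rho$, extends to a function $\psi_{k_1}(\cdot,\cdot,\epsilon)\in\mathrm{Exp}^d_{(k_1,\beta,\mu,\alpha,\rho)}$ of norm at most $C_{\psi_{k_1}}$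 for all $\epsilon\in D(0,\epsilon_0)$, holomorphic in $\epsilon$. Put $\psi_{k_2}=\mathcal L^d_{q;1/\kappa}(\psi_{k_1})$. For $(j,\psi)\in\{(1,\psi_{k_1}),(2,\psi_{k_2})\}$ consider $$\begin{aligned}Q(im)\tfrac{\tau^{k_j}}{(q^{1/k_j})^{k_j(k_j-1)/2}}\,w&=\tfrac{\tau^{d_D+k_j}}{(q^{1/k_j})^{(d_D+k_j)(d_D+k_j-1)/2}}R_D(im)\,\sigma_q^{\frac{d_D}{k_2}-\frac{d_D}{k_j}}w\\&+\sum_{\ell=1}^{D-1}\sum_{\lambda\in I_\ell}\tfrac{\epsilon^{\Delta_{\lambda,\ell}-d_{\lambda,\ell}}\tau^{d_{\lambda,\ell}+k_j}}{(q^{1/k_j})^{(d_{\lambda,\ell}+k_j)(d_{\lambda,\ell}+k_j-1)/2}}\sigma_q^{\delta_\ell-\frac{d_{\lambda,\ell}}{k_j}-1}\tfrac1{\sqrt{2\pi}}\big(C_{\lambda,\ell}\ast^{R_\ell}w\big)+\tfrac{\tau^{k_j}}{(q^{1/k_j})^{k_j(k_j-1)/2}}\psi .\end{aligned}\tag{$*_j$}$$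 **Statement.** There is $\nu\in\mathbb R$, depending only on $\alpha$, $q$ and the integers above, such that the following holds if $\sup_m|R_D(im)|/|Q(im)|$ is small enough (in terms of $\alpha,q,\rho,\delta,U_d$ and the integers above) and the constants $\tilde C_{\lambda,\ell}$ and $C_{\psi_{k_1}}$ are small enough (in terms of everything except the functions $C_{\lambda,\ell},F_n,\psi_{k_1}$). 0. For every $\tilde\delta>0$ the integral defining $\psi_{k_2}$ converges for $\tau\in\mathcal R_{d,\tilde\delta}$ and $|\psi_{k_2}(\tau,m,\epsilon)|\le C_{\psi_{k_2}}(1+|m|)^{-\mu}e^{-\beta|m|}\exp\big(\frac{k_2\log^2|\tau|}{2\log q}+\nu\log|\tau|\big)$ there, with $C_{\psi_{k_2}}$ independent of $\tau,m,\epsilon$. For every $\epsilon\in D(0,\epsilon_0)$, $(*_1)$ has a unique solution $w^d_{k_1}(\cdot,\cdot,\epsilon)$ in $\mathrm{Exp}^d_{(\kappa,\beta,\mu,\alpha,\rho)}$ of norm at most $\varpi$, and $(*_2)$ has a unique solution $w^d_{k_2}(\cdot,\cdot,\epsilon)$ in $\mathrm{Exp}^d_{(k_2,\beta,\mu,\nu)}$,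 whose norm is at most $\varpi$; both are holomorphic in $\epsilon$. Moreover, for every $\tilde\delta>0$ and every $0<r_1\le q^{(\frac12-\alpha)/\kappa}/2$: 1. For all $m\in\mathbb{R}$ and $\epsilon\in D(0,\epsilon_0)$, the function $\tau\mapsto\mathcal L^d_{q;1/\kappa}(w^d_{k_1})(\tau,m,\epsilon)$ is well defined, bounded and holomorphic on $\mathcal R_{d,\tilde\delta}\cap D(0,r_1)$; in fact it is bounded by $B(1+|m|)^{-\mu}e^{-\beta|m|}$ with $B$ independent of $\tau,m,\epsilon$. 2. $\mathcal L^d_{q;1/\kappa}(w^d_{k_1})(\tau,m,\epsilon)=w^d_{k_2}(\tau,m,\epsilon)$ for all $\tau\in(S_d\cup\mathcal R_d^b)\cap\mathcal R_{d,\tilde\delta}\cap D(0,r_1)$, $m\in\mathbb R$, $\epsilon\in D(0,\epsilon_0)$; if $\tilde\delta<1$, the set $S_d\cap\mathcal R_{d,\tilde\delta}\cap D(0,r_1)$ contains a finite sector of bisecting direction $d$. 3. Consequently $\tau\mapsto\mathcal L^d_{q;1/\kappa}(w^d_{k_1})(\tau,m,\epsilon)$ extends holomorphically to $(\mathcal R_{d,\tilde\delta}\cap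 D(0,r_1))\cup S_d$; there is $C_{w_{k_2}}>0$, independent of $\tau,m,\epsilon$, such that the extension is bounded on $S_d$ by $$C_{w_{k_2}}(1+|m|)^{-\mu}e^{-\beta|m|}\exp\Big(\frac{k_2\log^2|\tau|}{2\log q}+\nu\log|\tau|\Big);$$ and the extension is continuous in $(\tau,m,\epsilon)$ and holomorphic in $\epsilon\in D(0,\epsilon_0)$. -/

import Mathlib

open Polynomial

noncomputable section

namespace QG

/-- The open infinite sector with vertex `0`, bisecting direction `d` and half-opening `θ`. -/
def sector (d θ : ℝ) : Set ℂ :=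
  {τ | τ ≠ 0 ∧ |Complex.arg (τ * Complex.exp (-(d * Complex.I)))| < θ}

/-- The open bounded sector with vertex `0`, bisecting direction `d`, half-opening `θ`
and radius `r`. -/
def finiteSector (d θ r : ℝ) : Set ℂ :=
  sector d θ ∩ Metric.ball 0 r

/-- The closure of the bounded sector, its vertex removed. -/
def closedFiniteSector (d θ r : ℝ) : Set ℂ :=
  closure (finiteSector d θ r) \ {0}

/-- The domain `ℛ_{γ,δ'} = {T ≠ 0 : |1 + e^{iγ} r / T| > δ' for all r ≥ 0}`. -/
def lapDomain (γ δ' : ℝ) : Set ℂ :=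
  {T | T ≠ 0 ∧ ∀ r : ℝ, 0 ≤ r → δ' < ‖1 + Complex.exp (γ * Complex.I) * r / T‖}

/-- The number `(q^{1/k})^{n(n-1)/2}`. -/
def qfac (q k : ℝ) (n : ℕ) : ℝ := (q ^ (1 / k)) ^ (n * (n - 1) / 2)

/-- Jacobi's theta function of order `k`. -/
def theta (q k : ℝ) (x : ℂ) : ℂ :=
  ∑' n : ℤ, ((q ^ (-((n : ℝ) * ((n : ℝ) - 1)) / (2 * k)) : ℝ) : ℂ) * x ^ n

/-- The constant `π_{q^{1/k}}`. -/
def piq (q k : ℝ) : ℝ :=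
  Real.log q / k * ∏' n : ℕ, (1 - 1 / q ^ (((n : ℝ) + 1) / k))⁻¹

/-- The integrand of the `q`-Laplace transform, on the ray `u = r e^{iγ}`, for which
`du / u = dr / r`. -/
def lapIntegrand (q k γ : ℝ) (f : ℂ → ℂ) (T : ℂ) (r : ℝ) : ℂ :=
  f (r * Complex.exp (γ * Complex.I)) /
    theta q k (r * Complex.exp (γ * Complex.I) / T) / (r : ℂ)

/-- The `q`-Laplace transform of order `k` of `f` in direction `γ`. -/
def qLaplace (q k γ : ℝ) (f : ℂ → ℂ) (T : ℂ) : ℂ :=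
  1 / (piq q k : ℂ) * ∫ r in Set.Ioi (0 : ℝ), lapIntegrand q k γ f T r

/-- The decay factor `(1 + |m|)^{-μ} e^{-β|m|}`. -/
def decay (β μ m : ℝ) : ℝ := (1 + |m|) ^ (-μ) * Real.exp (-(β * |m|))

/-- The `q`-exponential growth factor `exp (k log² x / (2 log q) + a log x)`. -/
def growth (q k a x : ℝ) : ℝ :=
  Real.exp (k * Real.log x ^ 2 / (2 * Real.log q) + a * Real.log x)

/-- `f` belongs to the space `E_{(β,μ)}` and its norm is at most `B`. -/
def InE (β μ B : ℝ) (f : ℝ → ℂ) : Prop :=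
  Continuous f ∧ ∀ m, ‖f m‖ ≤ B * decay β μ m

/-- `h` belongs to the space `Exp^d_{(k,β,μ,α,ρ)}` attached to the sector `U` and the shift `δ`,
and its norm is at most `B`. -/
def InExpShift (U : Set ℂ) (ρ δ q k β μ α B : ℝ) (h : ℂ → ℝ → ℂ) : Prop :=
  ContinuousOn (fun p : ℂ × ℝ => h p.1 p.2) ((U ∪ Metric.closedBall 0 ρ) ×ˢ Set.univ) ∧
  (∀ m, DifferentiableOn ℂ (fun τ => h τ m) (U ∪ Metric.ball 0 ρ)) ∧
  ∀ τ ∈ U ∪ Metric.closedBall 0 ρ, ∀ m,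
    ‖h τ m‖ ≤ B * (decay β μ m * growth q k α ‖τ + (δ : ℂ)‖)

/-- `h` belongs to the space `Exp^d_{(k,β,μ,ν)}` attached to the infinite sector `S`, the bounded
sector `Rb` and its closure `Rc` (without the vertex), and its norm is at most `B`. -/
def InExp (S Rb Rc : Set ℂ) (q k β μ ν B : ℝ) (h : ℂ → ℝ → ℂ) : Prop :=
  ContinuousOn (fun p : ℂ × ℝ => h p.1 p.2) ((S ∪ Rc) ×ˢ Set.univ) ∧
  (∀ m, DifferentiableOn ℂ (fun τ => h τ m) (S ∪ Rb)) ∧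
  ∀ τ ∈ S ∪ Rc, ∀ m, ‖h τ m‖ ≤ B * (decay β μ m * growth q k ν ‖τ‖)

/-- The value `P(im)`. -/
def evI (P : ℂ[X]) (m : ℝ) : ℂ := P.eval (Complex.I * m)

/-- The convolution product `h₁ ∗^P h₂`. -/
def conv (P : ℂ[X]) (h₁ h₂ : ℝ → ℂ) (m : ℝ) : ℂ :=
  ∫ m₁ : ℝ, h₁ (m - m₁) * evI P m₁ * h₂ m₁

/-- The dilation factor `q^γ`. -/
def dil (q γ : ℝ) : ℂ := ((q ^ γ : ℝ) : ℂ)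

/-- The numbers entering the equations. The index `ℓ` runs through `1, …, D - 1` and `j` through
the finite set `Idx ℓ`; `dl ℓ j` and `Dl ℓ j` are the exponents usually written
`d_{j,ℓ}` and `Δ_{j,ℓ}`. -/
structure Exponents where
  k₁ : ℕ
  k₂ : ℕ
  D : ℕ
  dD : ℕ
  del : ℕ → ℕ
  Idx : ℕ → Finset ℕ
  dl : ℕ → ℕ → ℕ
  Dl : ℕ → ℕ → ℕ
  q : ℝ

/-- The real number `κ` with `1/κ = 1/k₁ - 1/k₂`. -/
def Exponents.kap (E : Exponents) : ℝ := (1 / (E.k₁ : ℝ) - 1 / (E.k₂ : ℝ))⁻¹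

/-- The standing assumptions on the numbers entering the equations. -/
structure Exponents.Admissible (E : Exponents) : Prop where
  one_le_k₁ : 1 ≤ E.k₁
  k₁_lt_k₂ : E.k₁ < E.k₂
  three_le_D : 3 ≤ E.D
  one_lt_q : 1 < E.q
  one_le_dD : 1 ≤ E.dD
  idx_nonempty : ∀ ℓ ∈ Finset.Icc 1 (E.D - 1), (E.Idx ℓ).Nonempty
  del_one : E.del 1 = 1
  del_lt : ∀ ℓ, 1 ≤ ℓ → ℓ + 1 ≤ E.D - 1 → E.del ℓ < E.del (ℓ + 1)
  one_le_dl : ∀ ℓ ∈ Finset.Icc 1 (E.D - 1), ∀ j ∈ E.Idx ℓ, 1 ≤ E.dl ℓ j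
  dl_le_Dl : ∀ ℓ ∈ Finset.Icc 1 (E.D - 1), ∀ j ∈ E.Idx ℓ, E.dl ℓ j ≤ E.Dl ℓ j
  del_le_dl : ∀ ℓ ∈ Finset.Icc 1 (E.D - 1), ∀ j ∈ E.Idx ℓ,
    (E.del ℓ : ℝ) ≤ (E.dl ℓ j : ℝ) / E.k₂ + 1
  del_le_dD : ∀ ℓ ∈ Finset.Icc 1 (E.D - 1), (E.del ℓ : ℝ) ≤ ((E.dD : ℝ) - 1) / E.k₂ + 1

/-- The polynomial `P_m(τ)`. -/
def Exponents.P (E : Exponents) (Q RD : ℂ[X]) (m : ℝ) (τ : ℂ) : ℂ :=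
  evI Q m / (qfac E.q E.k₂ E.k₂ : ℂ) - evI RD m / (qfac E.q E.k₂ (E.dD + E.k₂) : ℂ) * τ ^ E.dD

/-- The Borel-plane equation of order `k₁`, at the value `ε` of the parameter, for `τ ∈ V` and
`m ∈ ℝ`. Here `C ℓ j` is the function `C_{j,ℓ}(·, ε)`. -/
def Exponents.Eq₁ (E : Exponents) (Q : ℂ[X]) (R : ℕ → ℂ[X]) (C : ℕ → ℕ → ℝ → ℂ)
    (ψ : ℂ → ℝ → ℂ) (ε : ℂ) (V : Set ℂ) (w : ℂ → ℝ → ℂ) : Prop :=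
  ∀ τ ∈ V, ∀ m : ℝ,
    evI Q m * (τ ^ E.k₁ / (qfac E.q E.k₁ E.k₁ : ℂ)) * w τ m =
      τ ^ (E.dD + E.k₁) / (qfac E.q E.k₁ (E.dD + E.k₁) : ℂ) * evI (R E.D) m *
          w (dil E.q (-(E.dD : ℝ) / E.kap) * τ) m
      + ∑ ℓ ∈ Finset.Icc 1 (E.D - 1), ∑ j ∈ E.Idx ℓ,
          ε ^ (E.Dl ℓ j - E.dl ℓ j) * τ ^ (E.dl ℓ j + E.k₁) /
            (qfac E.q E.k₁ (E.dl ℓ j + E.k₁) : ℂ) * (1 / (Real.sqrt (2 * Real.pi) : ℂ)) *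
            conv (R ℓ) (C ℓ j)
              (w (dil E.q ((E.del ℓ : ℝ) - (E.dl ℓ j : ℝ) / E.k₁ - 1) * τ)) m
      + τ ^ E.k₁ / (qfac E.q E.k₁ E.k₁ : ℂ) * ψ τ m

/-- The Borel-plane equation of order `k₂`, at the value `ε` of the parameter, for `τ ∈ V` and
`m ∈ ℝ`. -/
def Exponents.Eq₂ (E : Exponents) (Q : ℂ[X]) (R : ℕ → ℂ[X]) (C : ℕ → ℕ → ℝ → ℂ)
    (ψ : ℂ → ℝ → ℂ) (ε : ℂ) (V : Set ℂ) (w : ℂ → ℝ → ℂ) : Prop :=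
  ∀ τ ∈ V, ∀ m : ℝ,
    evI Q m * (τ ^ E.k₂ / (qfac E.q E.k₂ E.k₂ : ℂ)) * w τ m =
      evI (R E.D) m * (τ ^ (E.dD + E.k₂) / (qfac E.q E.k₂ (E.dD + E.k₂) : ℂ)) * w τ m
      + ∑ ℓ ∈ Finset.Icc 1 (E.D - 1), ∑ j ∈ E.Idx ℓ,
          ε ^ (E.Dl ℓ j - E.dl ℓ j) * τ ^ (E.dl ℓ j + E.k₂) /
            (qfac E.q E.k₂ (E.dl ℓ j + E.k₂) : ℂ) * (1 / (Real.sqrt (2 * Real.pi) : ℂ)) *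
            conv (R ℓ) (C ℓ j)
              (w (dil E.q ((E.del ℓ : ℝ) - (E.dl ℓ j : ℝ) / E.k₂ - 1) * τ)) m
      + τ ^ E.k₂ / (qfac E.q E.k₂ E.k₂ : ℂ) * ψ τ m

/-- The standing assumptions on the polynomials `Q, R_1, …, R_D`. -/
structure Exponents.PolyOK (E : Exponents) (μ : ℝ) (Q : ℂ[X]) (R : ℕ → ℂ[X]) : Prop where
  deg_RD_le : (R E.D).natDegree ≤ Q.natDegree
  deg_R_le : ∀ ℓ ∈ Finset.Icc 1 (E.D - 1), (R ℓ).natDegree ≤ (R E.D).natDegree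
  Q_ne : ∀ m, evI Q m ≠ 0
  RD_ne : ∀ m, evI (R E.D) m ≠ 0
  deg_lt_mu : ((R E.D).natDegree : ℝ) + 1 < μ

/-- The assumptions on the coefficients `C_{j,ℓ}(m, ε)`, whose norms in `E_{(β,μ)}` are bounded
by `ζ ℓ j`, uniformly for `|ε| < ε₀`. -/
def Exponents.CoeffOK (E : Exponents) (β μ ε₀ : ℝ) (ζ : ℕ → ℕ → ℝ)
    (C : ℕ → ℕ → ℝ → ℂ → ℂ) : Prop :=
  ∀ ℓ ∈ Finset.Icc 1 (E.D - 1), ∀ j ∈ E.Idx ℓ,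
    (∀ ε ∈ Metric.ball (0 : ℂ) ε₀, InE β μ (ζ ℓ j) (fun m => C ℓ j m ε)) ∧
    ∀ m, DifferentiableOn ℂ (fun ε => C ℓ j m ε) (Metric.ball 0 ε₀)

/-- The assumptions on the formal series `F = ∑ F_n(m, ε) T^n` and on the function `ψ` which
extends its formal `q`-Borel transform of order `k₁` to `U ∪ D̄(0,ρ)`, with norm at most `ζψ` for
every `ε`. -/
structure Exponents.ForcingOK (E : Exponents) (U : Set ℂ) (ρ δ β μ α ε₀ ζψ : ℝ)
    (F : ℕ → ℝ → ℂ → ℂ) (ψ : ℂ → ℝ → ℂ → ℂ) : Prop where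
  F_bound : ∃ CF : ℝ, 0 < CF ∧ ∀ n, ∀ ε ∈ Metric.ball (0 : ℂ) ε₀,
    InE β μ (CF * ρ⁻¹ ^ n * qfac E.q E.k₁ n) (fun m => F n m ε)
  F_hol : ∀ n m, DifferentiableOn ℂ (fun ε => F n m ε) (Metric.ball 0 ε₀)
  borel : ∀ ε ∈ Metric.ball (0 : ℂ) ε₀, ∀ m, ∀ τ ∈ Metric.ball (0 : ℂ) ρ,
    HasSum (fun n : ℕ => F n m ε * (τ ^ n / (qfac E.q E.k₁ n : ℂ))) (ψ τ m ε)
  psi_mem : ∀ ε ∈ Metric.ball (0 : ℂ) ε₀,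
    InExpShift U ρ δ E.q E.k₁ β μ α ζψ (fun τ m => ψ τ m ε)
  psi_hol : ∀ τ ∈ U ∪ Metric.closedBall 0 ρ, ∀ m,
    DifferentiableOn ℂ (fun ε => ψ τ m ε) (Metric.ball 0 ε₀)

/-- The acceleration `ψ_{k₂}` of `ψ`: its `q`-Laplace transform of order `κ` in direction `d`.
The same operator is applied to the solution of the first equation. -/
def Exponents.accel (E : Exponents) (d : ℝ) (ψ : ℂ → ℝ → ℂ → ℂ) (τ : ℂ) (m : ℝ) (ε : ℂ) : ℂ :=
  qLaplace E.q E.kap d (fun h => ψ h m ε) τ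

/-- `w` is, for every `|ε| < ε₀`, the unique solution of the first equation in the closed ball of
radius `ϖ` of `Exp^d_{(κ,β,μ,α,ρ)}`, and it is holomorphic in `ε`. -/
structure Exponents.IsSol₁ (E : Exponents) (Q : ℂ[X]) (R : ℕ → ℂ[X])
    (C : ℕ → ℕ → ℝ → ℂ → ℂ) (ψ : ℂ → ℝ → ℂ → ℂ) (U : Set ℂ) (ρ δ β μ α ε₀ ϖ : ℝ)
    (w : ℂ → ℝ → ℂ → ℂ) : Prop where
  mem : ∀ ε ∈ Metric.ball (0 : ℂ) ε₀,
    InExpShift U ρ δ E.q E.kap β μ α ϖ (fun τ m => w τ m ε)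
  sol : ∀ ε ∈ Metric.ball (0 : ℂ) ε₀,
    E.Eq₁ Q R (fun ℓ j m => C ℓ j m ε) (fun τ m => ψ τ m ε) ε (U ∪ Metric.closedBall 0 ρ)
      (fun τ m => w τ m ε)
  unique : ∀ ε ∈ Metric.ball (0 : ℂ) ε₀, ∀ v : ℂ → ℝ → ℂ,
    InExpShift U ρ δ E.q E.kap β μ α ϖ v →
    E.Eq₁ Q R (fun ℓ j m => C ℓ j m ε) (fun τ m => ψ τ m ε) ε (U ∪ Metric.closedBall 0 ρ) v →
    ∀ τ ∈ U ∪ Metric.closedBall 0 ρ, ∀ m, v τ m = w τ m ε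
  hol : ∀ τ ∈ U ∪ Metric.closedBall 0 ρ, ∀ m,
    DifferentiableOn ℂ (fun ε => w τ m ε) (Metric.ball 0 ε₀)

/-- `w` is, for every `|ε| < ε₀`, the unique solution of the second equation (with forcing term
`ψ₂`) in `Exp^d_{(k₂,β,μ,ν)}`, its norm is at most `ϖ`, and it is holomorphic in `ε`. -/
structure Exponents.IsSol₂ (E : Exponents) (Q : ℂ[X]) (R : ℕ → ℂ[X])
    (C : ℕ → ℕ → ℝ → ℂ → ℂ) (ψ₂ : ℂ → ℝ → ℂ → ℂ) (S Rb Rc : Set ℂ) (β μ ν ε₀ ϖ : ℝ)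
    (w : ℂ → ℝ → ℂ → ℂ) : Prop where
  mem : ∀ ε ∈ Metric.ball (0 : ℂ) ε₀,
    InExp S Rb Rc E.q E.k₂ β μ ν ϖ (fun τ m => w τ m ε)
  sol : ∀ ε ∈ Metric.ball (0 : ℂ) ε₀,
    E.Eq₂ Q R (fun ℓ j m => C ℓ j m ε) (fun τ m => ψ₂ τ m ε) ε (S ∪ Rc) (fun τ m => w τ m ε)
  unique : ∀ ε ∈ Metric.ball (0 : ℂ) ε₀, ∀ (B : ℝ) (v : ℂ → ℝ → ℂ),
    InExp S Rb Rc E.q E.k₂ β μ ν B v →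
    E.Eq₂ Q R (fun ℓ j m => C ℓ j m ε) (fun τ m => ψ₂ τ m ε) ε (S ∪ Rc) v →
    ∀ τ ∈ S ∪ Rc, ∀ m, v τ m = w τ m ε
  hol : ∀ τ ∈ S ∪ Rc, ∀ m, DifferentiableOn ℂ (fun ε => w τ m ε) (Metric.ball 0 ε₀)

end QG

end

/-!
Divided by the coefficient of the unknown, each of the two equations becomes a fixed point
equation `w = g + T w`, where `T` is the sum of a dilation term and of finitely many convolution
terms composed with dilations `τ ↦ c τ`, `c ≤ 1` (`dilConvOp`). On the weighted spaces `T` is a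
contraction of ratio `1/2`:

* for the first equation, a power `τ ^ n` is absorbed by the dilation of ratio `q ^ (-γ)` in the
  growth factor of order `κ` as soon as `n ≤ κ γ` (`growth_shift_dilate`); for the dilation term
  this is an equality, and the smallness of `R_D / Q` supplies the ratio (`contraction₁`);
* for the second equation, the dilation term has no dilation and is moved to the left hand side,
  where it produces `P_m(τ)`; the distance to the roots of `P_m` bounds it from below by
  `(1 + |m|) ^ deg R_D * (1 + |τ|) ^ d_D` (`le_norm_P`), which is enough for the remaining terms
  (`contraction₂`).

Successive approximation gives solutions which are holomorphic in `τ` and in `ε`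
(`ContractionData.exists_fixedPoint`). Uniqueness holds on any subset of the domain that is stable
under the dilations of ratio at most one (`ContractionData.unique`).

The `q`-Laplace kernel is estimated by Jacobi's theta function. The triple product shows that
`Θ` vanishes on the negative real axis only; compactness of an annulus and the functional equation
then give `|Θ(x)| ≥ c exp (k log² |x| / (2 log q)) |x| ^ (1/2)` away from that axis
(`theta_lower_bound`). In the variable `log r`, the transform of order `κ` of a growth factor of
order `k₁ < κ` and exponent `α` is a Gaussian integral; its value has order
`k₁ κ / (κ - k₁) = k₂` and exponent `ν = κ (α - 1/2) / (κ - k₁) + 1/2`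
(`growth_mul_lapKer`, `Exponents.nu`). For order `κ` the Gaussian degenerates and the transform
still converges, and is bounded, for `|τ| ≤ q ^ ((1/2 - α) / κ) / 2` (`integral_mul_lapKer_le`).

By the functional equation of `Θ` the transform maps `τ ^ n • σ_q ^ γ` to
`q ^ (n (n - 1) / (2 κ)) τ ^ n • σ_q ^ (γ + n / κ)` (`laplace_shift`), and by Fubini it commutes
with the convolution in `m` (`laplace_conv`). These are exactly the changes that lead from the
first equation to the second (`Exponents.accel_solves`), so the transform of `w₁` and the function
`w₂` are bounded solutions of the same fixed point equation on the intersection of their domains,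
which is stable under the dilations; they coincide there (`Exponents.accel_eq`). Gluing them gives
the extension (`Exponents.continuation_regular`).
-/


noncomputable section

namespace QG

/-! ### Jacobi's theta function -/

section

open Filter Topology Finset

/-- The finite `q`-Pochhammer product `(p; p)_n`. -/
def poch (p : ℝ) (n : ℕ) : ℝ := ∏ k ∈ range n, (1 - p ^ (k + 1))

/-- The Gaussian binomial coefficient with base `p`, extended by `0` for `j > n`. -/
def gaussBinom (p : ℝ) (n j : ℕ) : ℝ :=
  if j ≤ n then poch p n / (poch p j * poch p (n - j)) else 0

lemma poch_succ (p : ℝ) (n : ℕ) : poch p (n + 1) = poch p n * (1 - p ^ (n + 1)) :=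
  prod_range_succ _ _

lemma one_sub_pow_pos {p : ℝ} (h0 : 0 < p) (h1 : p < 1) (k : ℕ) : 0 < 1 - p ^ (k + 1) :=
  sub_pos.2 (pow_lt_one₀ h0.le h1 k.succ_ne_zero)

lemma poch_pos {p : ℝ} (h0 : 0 < p) (h1 : p < 1) (n : ℕ) : 0 < poch p n :=
  prod_pos fun k _ => one_sub_pow_pos h0 h1 k

lemma gaussBinom_zero {p : ℝ} (h0 : 0 < p) (h1 : p < 1) (n : ℕ) : gaussBinom p n 0 = 1 := by
  have h := (poch_pos h0 h1 n).ne'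
  have h' : poch p 0 = 1 := by simp [poch]
  simp [gaussBinom, h, h']

lemma gaussBinom_self_succ (p : ℝ) (n : ℕ) : gaussBinom p n (n + 1) = 0 := by
  simp [gaussBinom]

/-- The `q`-Pascal rule with the power of `p` on the term of lower index, which matches
multiplication of the product by a factor `1 + x p^a`. -/
lemma gaussBinom_pascal {p : ℝ} (h0 : 0 < p) (h1 : p < 1) {n j : ℕ} (hj : j ≤ n) :
    gaussBinom p (n + 1) (j + 1) = gaussBinom p n (j + 1) + p ^ (n - j) * gaussBinom p n j := by
  obtain ⟨d, rfl⟩ := Nat.exists_eq_add_of_le hj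
  have hp := fun m => (poch_pos h0 h1 m).ne'
  have hq := fun m => (one_sub_pow_pos h0 h1 m).ne'
  rcases d with _ | d
  · simp [gaussBinom, poch]
    have := hp j; have := hp (j + 1)
    simp only [poch] at *
    field_simp
  · have e1 : j + (d + 1) + 1 - (j + 1) = d + 1 := by omega
    have e2 : j + (d + 1) - (j + 1) = d := by omega
    have e3 : j + (d + 1) - j = d + 1 := by omega
    simp only [gaussBinom, e1, e2, e3, if_pos (show j + 1 ≤ j + (d + 1) + 1 by omega),
      if_pos (show j + 1 ≤ j + (d + 1) by omega), if_pos (show j ≤ j + (d + 1) by omega)]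
    rw [poch_succ p (j + (d + 1)), poch_succ p j, poch_succ p d]
    have := hp j; have := hp d; have := hq j; have := hq d
    field_simp
    ring

/-- The `q`-Pascal rule with the power of `p` on the term of higher index, which matches
multiplication of the product by a factor `1 + p^{b+1} / x`. -/
lemma gaussBinom_pascal' {p : ℝ} (h0 : 0 < p) (h1 : p < 1) {n j : ℕ} (hj : j ≤ n) :
    gaussBinom p (n + 1) (j + 1) = gaussBinom p n j + p ^ (j + 1) * gaussBinom p n (j + 1) := by
  obtain ⟨d, rfl⟩ := Nat.exists_eq_add_of_le hj
  have hp := fun m => (poch_pos h0 h1 m).ne'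
  have hq := fun m => (one_sub_pow_pos h0 h1 m).ne'
  rcases d with _ | d
  · simp [gaussBinom, poch]
    have := hp j; have := hp (j + 1)
    simp only [poch] at *
    field_simp
  · have e1 : j + (d + 1) + 1 - (j + 1) = d + 1 := by omega
    have e2 : j + (d + 1) - (j + 1) = d := by omega
    have e3 : j + (d + 1) - j = d + 1 := by omega
    simp only [gaussBinom, e1, e2, e3, if_pos (show j + 1 ≤ j + (d + 1) + 1 by omega),
      if_pos (show j + 1 ≤ j + (d + 1) by omega), if_pos (show j ≤ j + (d + 1) by omega)]
    rw [poch_succ p (j + (d + 1)), poch_succ p j, poch_succ p d]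
    have := hp j; have := hp d; have := hq j; have := hq d
    field_simp
    ring

lemma exp_intCast_mul (n : ℤ) (x : ℝ) : Real.exp (n * x) = Real.exp x ^ n := by
  rw [mul_comm, Real.exp_mul, Real.rpow_intCast]

/-- The weight `p^{i(i-1)/2}` with `p = e^{-g}`. -/
def thetaWt (g : ℝ) (i : ℤ) : ℝ := Real.exp (-(g * ((i : ℝ) * (i - 1) / 2)))

lemma thetaWt_succ (g : ℝ) (i : ℤ) :
    thetaWt g (i + 1) = thetaWt g i * Real.exp (-g) ^ i := by
  rw [thetaWt, thetaWt, ← exp_intCast_mul, ← Real.exp_add]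
  congr 1; push_cast; ring

lemma thetaWt_zero (g : ℝ) : thetaWt g 0 = 1 := by simp [thetaWt]

/-- The finite form of Jacobi's triple product identity. -/
lemma finite_triple_product {g : ℝ} (hg : 0 < g) {x : ℂ} (hx : x ≠ 0) (a b : ℕ) :
    (∏ k ∈ range a, (1 + x * (Real.exp (-g) : ℂ) ^ k)) *
      ∏ k ∈ range b, (1 + (Real.exp (-g) : ℂ) ^ (k + 1) / x) =
    ∑ j ∈ range (a + b + 1), (gaussBinom (Real.exp (-g)) (a + b) j : ℂ) *
      ((thetaWt g ((j : ℤ) - b) : ℂ) * x ^ ((j : ℤ) - b)) := by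
  have h0 : 0 < Real.exp (-g) := Real.exp_pos _
  have h1 : Real.exp (-g) < 1 := by simpa using hg
  have hpC : (Real.exp (-g) : ℂ) ≠ 0 := by exact_mod_cast h0.ne'
  -- the case `a = 0` is an induction on `b`; each step is one of the two Pascal rules
  induction a with
  | zero =>
    induction b with
    | zero => simp [thetaWt_zero, gaussBinom_zero h0 h1]
    | succ b ih =>
      simp only [range_zero, prod_empty, one_mul, zero_add] at ih ⊢
      rw [prod_range_succ, ih, mul_add, mul_one]
      set p := Real.exp (-g) with hp
      have hT : ∀ j : ℕ, (thetaWt g ((j : ℤ) - b) : ℂ) * x ^ ((j : ℤ) - b) =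
          (thetaWt g (((j + 1 : ℕ) : ℤ) - (b + 1 : ℕ)) : ℂ) *
            x ^ (((j + 1 : ℕ) : ℤ) - (b + 1 : ℕ)) := by
        intro j
        rw [show ((j + 1 : ℕ) : ℤ) - (b + 1 : ℕ) = (j : ℤ) - b by push_cast; ring]
      have hS : ∀ j : ℕ, ((thetaWt g ((j : ℤ) - b) : ℂ) * x ^ ((j : ℤ) - b)) *
          ((p : ℂ) ^ (b + 1) / x) = (p : ℂ) ^ j *
          ((thetaWt g ((j : ℤ) - (b + 1 : ℕ)) : ℂ) * x ^ ((j : ℤ) - (b + 1 : ℕ))) := by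
        intro j
        have e : ((j : ℤ) - b) = ((j : ℤ) - (b + 1 : ℕ)) + 1 := by push_cast; ring
        rw [e, thetaWt_succ, zpow_add_one₀ hx, ← hp]
        have : (p : ℂ) ^ j = (p : ℂ) ^ ((j : ℤ) - (b + 1 : ℕ)) * (p : ℂ) ^ (b + 1) := by
          rw [zpow_sub₀ hpC, zpow_natCast, zpow_natCast]; field_simp
        rw [this, Complex.ofReal_mul, Complex.ofReal_zpow]; field_simp
      rw [sum_range_succ' _ (b + 1), sum_mul]
      have hlast : ∑ j ∈ range (b + 1), (gaussBinom p b j : ℂ) *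
            ((thetaWt g ((j : ℤ) - b) : ℂ) * x ^ ((j : ℤ) - b)) * ((p : ℂ) ^ (b + 1) / x) =
          ∑ j ∈ range (b + 1 + 1), (gaussBinom p b j : ℂ) * ((p : ℂ) ^ j *
            ((thetaWt g ((j : ℤ) - (b + 1 : ℕ)) : ℂ) * x ^ ((j : ℤ) - (b + 1 : ℕ)))) := by
        rw [sum_range_succ _ (b + 1), gaussBinom_self_succ, Complex.ofReal_zero, zero_mul, add_zero]
        exact sum_congr rfl fun j _ => by rw [mul_assoc, hS j]
      rw [hlast, sum_range_succ' _ (b + 1), ← add_assoc, ← sum_add_distrib,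
        gaussBinom_zero h0 h1, gaussBinom_zero h0 h1, pow_zero, one_mul]
      congr 1
      refine sum_congr rfl fun j hj => ?_
      rw [gaussBinom_pascal' h0 h1 (by simpa [Nat.lt_succ_iff] using hj), hT]
      push_cast; ring
  | succ a ih =>
    rw [prod_range_succ, mul_right_comm, ih, mul_add, mul_one]
    have hN : a + 1 + b = a + b + 1 := by ring
    rw [hN]
    set p := Real.exp (-g) with hp
    have hS : ∀ j ∈ range (a + b + 1), ((thetaWt g ((j : ℤ) - b) : ℂ) * x ^ ((j : ℤ) - b)) *
        (x * (p : ℂ) ^ a) = (p : ℂ) ^ (a + b - j) *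
        ((thetaWt g (((j + 1 : ℕ) : ℤ) - b) : ℂ) * x ^ (((j + 1 : ℕ) : ℤ) - b)) := by
      intro j hj
      have hj' : j ≤ a + b := by simpa [Nat.lt_succ_iff] using hj
      have e : (((j + 1 : ℕ) : ℤ) - b) = ((j : ℤ) - b) + 1 := by push_cast; ring
      rw [e, thetaWt_succ, zpow_add_one₀ hx, ← hp]
      have : (p : ℂ) ^ (a + b - j) * (p : ℂ) ^ ((j : ℤ) - b) = (p : ℂ) ^ a := by
        rw [← zpow_natCast, ← zpow_natCast, ← zpow_add₀ hpC]
        congr 1; push_cast [hj']; ring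
      rw [← this, Complex.ofReal_mul, Complex.ofReal_zpow]; ring
    rw [sum_mul]
    have hlast : ∑ j ∈ range (a + b + 1), (gaussBinom p (a + b) j : ℂ) *
          ((thetaWt g ((j : ℤ) - b) : ℂ) * x ^ ((j : ℤ) - b)) =
        ∑ j ∈ range (a + b + 1 + 1), (gaussBinom p (a + b) j : ℂ) *
          ((thetaWt g ((j : ℤ) - b) : ℂ) * x ^ ((j : ℤ) - b)) := by
      rw [sum_range_succ _ (a + b + 1), gaussBinom_self_succ]; simp
    rw [hlast, sum_range_succ' _ (a + b + 1), sum_range_succ' _ (a + b + 1), add_right_comm,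
      ← sum_add_distrib, gaussBinom_zero h0 h1, gaussBinom_zero h0 h1]
    congr 1
    refine sum_congr rfl fun j hj => ?_
    rw [mul_assoc, hS j hj,
      gaussBinom_pascal h0 h1 (show j ≤ a + b by simpa [Nat.lt_succ_iff] using hj)]
    push_cast; ring

lemma poch_antitone {p : ℝ} (h0 : 0 < p) (h1 : p < 1) : Antitone (poch p) := by
  refine antitone_nat_of_succ_le fun n => ?_
  rw [poch_succ]
  have := poch_pos h0 h1 n
  have : 0 < p ^ (n + 1) := by positivity
  nlinarith

lemma summable_pow_succ {p : ℝ} (h0 : 0 < p) (h1 : p < 1) :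
    Summable fun k : ℕ => p ^ (k + 1) :=
  (summable_nat_add_iff 1).2 (summable_geometric_of_lt_one h0.le h1)

/-- The infinite product `(p; p)_∞` is positive and bounds the finite products from below. -/
lemma exists_tendsto_poch {p : ℝ} (h0 : 0 < p) (h1 : p < 1) :
    ∃ L : ℝ, 0 < L ∧ Tendsto (poch p) atTop (𝓝 L) ∧ ∀ n, L ≤ poch p n := by
  have hs : Summable fun k : ℕ => ‖-p ^ (k + 1)‖ := by
    simpa [abs_of_pos h0] using summable_pow_succ h0 h1
  have hm := multipliable_one_add_of_summable hs
  have ht : Tendsto (poch p) atTop (𝓝 (∏' k : ℕ, (1 + -p ^ (k + 1)))) := by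
    unfold poch
    simpa only [sub_eq_add_neg] using hm.hasProd.tendsto_prod_nat
  have hne : ∏' k : ℕ, (1 + -p ^ (k + 1)) ≠ 0 :=
    tprod_one_add_ne_zero_of_summable
      (fun k => by have := one_sub_pow_pos h0 h1 k; rw [← sub_eq_add_neg]; exact this.ne') hs
  have h0' : 0 ≤ ∏' k : ℕ, (1 + -p ^ (k + 1)) :=
    ge_of_tendsto' ht fun n => (poch_pos h0 h1 n).le
  exact ⟨_, lt_of_le_of_ne h0' hne.symm, ht, (poch_antitone h0 h1).le_of_tendsto ht⟩

/-- A bound of the terms of the theta series which is uniform on annuli, written in the form used in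
Mathlib for the terms of the Jacobi theta function. -/
lemma norm_thetaWt_mul_zpow_le {g L : ℝ} (hg : 0 < g) {x : ℂ} (hx : x ≠ 0)
    (hL : |Real.log ‖x‖| ≤ L) (n : ℤ) :
    ‖(thetaWt g n : ℂ) * x ^ n‖ ≤ Real.exp (-Real.pi * (g / (2 * Real.pi) * (n : ℝ) ^ 2 -
      2 * ((g / 2 + L) / (2 * Real.pi)) * |(n : ℝ)|)) := by
  have hx' : 0 < ‖x‖ := norm_pos_iff.2 hx
  rw [norm_mul, norm_zpow, thetaWt, Complex.norm_real, Real.norm_eq_abs, Real.abs_exp]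
  have : ‖x‖ ^ n = Real.exp (n * Real.log ‖x‖) := by
    rw [exp_intCast_mul, Real.exp_log hx']
  rw [this, ← Real.exp_add, Real.exp_le_exp]
  have h1 : (n : ℝ) * Real.log ‖x‖ ≤ |(n : ℝ)| * L :=
    (le_abs_self _).trans (by rw [abs_mul]; gcongr)
  have h2 : g * (n : ℝ) ≤ g * |(n : ℝ)| := by gcongr; exact le_abs_self _
  have hpi := Real.pi_pos
  have e : -Real.pi * (g / (2 * Real.pi) * (n : ℝ) ^ 2 -
      2 * ((g / 2 + L) / (2 * Real.pi)) * |(n : ℝ)|) =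
      -(g * (n : ℝ) ^ 2 / 2) + (g / 2 + L) * |(n : ℝ)| := by field_simp; ring
  rw [e]; nlinarith

lemma summable_theta_bound {g : ℝ} (hg : 0 < g) (L : ℝ) :
    Summable fun n : ℤ => Real.exp (-Real.pi * (g / (2 * Real.pi) * (n : ℝ) ^ 2 -
      2 * ((g / 2 + L) / (2 * Real.pi)) * |(n : ℝ)|)) := by
  have := summable_pow_mul_jacobiTheta₂_term_bound ((g / 2 + L) / (2 * Real.pi))
    (T := g / (2 * Real.pi)) (by positivity) 0
  simpa using this

lemma theta_eq {q k : ℝ} (hq : 1 < q) (x : ℂ) :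
    theta q k x = ∑' n : ℤ, (thetaWt (Real.log q / k) n : ℂ) * x ^ n := by
  unfold theta thetaWt
  congr 1; ext n; congr 2
  rw [Real.rpow_def_of_pos (by linarith)]
  congr 1; ring

/-- Jacobi's triple product, read as a statement on zeros: the theta series is a limit of finite
products, and the limit product vanishes only where one of its factors does. -/
lemma tsum_thetaWt_ne_zero {g : ℝ} (hg : 0 < g) {x : ℂ} (hx : x ≠ 0)
    (hneg : ∀ s : ℝ, 0 < s → 1 + s * x ≠ 0) :
    ∑' n : ℤ, (thetaWt g n : ℂ) * x ^ n ≠ 0 := by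
  have h0 : 0 < Real.exp (-g) := Real.exp_pos _
  have h1 : Real.exp (-g) < 1 := by simpa using hg
  have hfin := finite_triple_product hg hx
  set p := Real.exp (-g) with hp
  obtain ⟨L, hL, hlim, hle⟩ := exists_tendsto_poch h0 h1
  have hpoch1 : ∀ n, poch p n ≤ 1 := fun n => by
    simpa [poch] using poch_antitone h0 h1 (Nat.zero_le n)
  -- the products converge to a nonzero limit
  have hsA : Summable fun k : ℕ => ‖x * (p : ℂ) ^ k‖ := by
    simp only [norm_mul, norm_pow, Complex.norm_real, Real.norm_eq_abs, abs_of_pos h0]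
    exact (summable_geometric_of_lt_one h0.le h1).mul_left _
  have hsB : Summable fun k : ℕ => ‖(p : ℂ) ^ (k + 1) / x‖ := by
    simp only [norm_div, norm_pow, Complex.norm_real, Real.norm_eq_abs, abs_of_pos h0]
    exact (summable_pow_succ h0 h1).div_const _
  have hA := (multipliable_one_add_of_summable hsA).hasProd.tendsto_prod_nat
  have hB := (multipliable_one_add_of_summable hsB).hasProd.tendsto_prod_nat
  have hA0 : ∏' k : ℕ, (1 + x * (p : ℂ) ^ k) ≠ 0 := by
    refine tprod_one_add_ne_zero_of_summable (fun k => ?_) hsA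
    have := hneg (p ^ k) (by positivity)
    rwa [mul_comm, Complex.ofReal_pow] at this
  have hB0 : ∏' k : ℕ, (1 + (p : ℂ) ^ (k + 1) / x) ≠ 0 := by
    refine tprod_one_add_ne_zero_of_summable (fun k => ?_) hsB
    have hpk : (p : ℂ) ^ (k + 1) ≠ 0 := pow_ne_zero _ (by exact_mod_cast h0.ne')
    have := hneg ((p ^ (k + 1))⁻¹) (by positivity)
    intro h
    apply this
    push_cast
    field_simp at h ⊢
    linear_combination h
  have hprod := hA.mul hB
  -- the sums converge to a multiple of the theta series
  let f : ℕ → ℤ → ℂ := fun n i =>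
    if i ∈ Icc (-(n : ℤ)) n then
      (gaussBinom p (n + n) (n + i).toNat : ℂ) * ((thetaWt g i : ℂ) * x ^ i) else 0
  have hf : ∀ n : ℕ, ∑' i, f n i = (∏ k ∈ range n, (1 + x * (p : ℂ) ^ k)) *
      ∏ k ∈ range n, (1 + (p : ℂ) ^ (k + 1) / x) := by
    intro n
    rw [hfin n n, tsum_eq_sum (s := Icc (-(n : ℤ)) n) (fun i hi => if_neg hi),
      sum_congr rfl fun i hi => if_pos hi]
    refine sum_nbij' (fun i => (n + i).toNat) (fun j => (j : ℤ) - n) ?_ ?_ ?_ ?_ ?_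
    · intro i hi; simp only [mem_Icc, mem_range] at *; omega
    · intro i hi; simp only [mem_Icc, mem_range] at *; omega
    · intro i hi; simp only [mem_Icc] at *; omega
    · intro i hi; simp only [mem_range] at *; omega
    · intro i hi
      simp only [mem_Icc] at hi
      have : (((n + i).toNat : ℕ) : ℤ) - n = i := by omega
      rw [this]
  have hbound : ∀ n i, ‖f n i‖ ≤ (L * L)⁻¹ * Real.exp (-Real.pi * (g / (2 * Real.pi) *
      (i : ℝ) ^ 2 - 2 * ((g / 2 + |Real.log ‖x‖|) / (2 * Real.pi)) * |(i : ℝ)|)) := by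
    intro n i
    simp only [f]
    split_ifs with hi
    · rw [norm_mul]
      refine mul_le_mul ?_ (norm_thetaWt_mul_zpow_le hg hx le_rfl i) (norm_nonneg _)
        (by positivity)
      simp only [mem_Icc] at hi
      rw [Complex.norm_real, gaussBinom, if_pos (by omega), Real.norm_eq_abs, abs_of_pos
        (div_pos (poch_pos h0 h1 _) (mul_pos (poch_pos h0 h1 _) (poch_pos h0 h1 _))),
        ← one_div]
      exact div_le_div₀ zero_le_one (hpoch1 _) (by positivity)
        (mul_le_mul (hle _) (hle _) hL.le (poch_pos h0 h1 _).le)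
    · simp only [norm_zero]; positivity
  have hptw : ∀ i, Tendsto (fun n => f n i) atTop
      (𝓝 ((L / (L * L) : ℝ) * ((thetaWt g i : ℂ) * x ^ i))) := by
    intro i
    have ev : ∀ᶠ n : ℕ in atTop, ((poch p (n + n) /
        (poch p (n + i).toNat * poch p (n + n - (n + i).toNat)) : ℝ) : ℂ) *
        ((thetaWt g i : ℂ) * x ^ i) = f n i := by
      filter_upwards [eventually_ge_atTop i.natAbs] with n hn
      have : i ∈ Icc (-(n : ℤ)) n := by simp only [mem_Icc]; omega
      simp only [f, if_pos this, gaussBinom, if_pos (show (n + i).toNat ≤ n + n by omega)]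
    refine Tendsto.congr' ev (Tendsto.mul_const _ ?_)
    refine (Complex.continuous_ofReal.tendsto _).comp ?_
    refine Tendsto.div (hlim.comp ?_) ((hlim.comp ?_).mul (hlim.comp ?_)) (by positivity)
    · exact tendsto_atTop_mono (fun n => Nat.le_add_left n n) tendsto_id
    · exact tendsto_atTop_atTop.2 fun b => ⟨b + i.natAbs, fun n hn => by omega⟩
    · exact tendsto_atTop_atTop.2 fun b => ⟨b + i.natAbs, fun n hn => by omega⟩
  have hsum := tendsto_tsum_of_dominated_convergence
    ((summable_theta_bound hg |Real.log ‖x‖|).mul_left (L * L)⁻¹) hptw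
    (Eventually.of_forall fun n => hbound n)
  simp only [hf] at hsum
  have := tendsto_nhds_unique hsum hprod
  rw [tsum_mul_left] at this
  intro h
  rw [h, mul_zero] at this
  exact mul_ne_zero hA0 hB0 this.symm

lemma theta_ne_zero {q k : ℝ} (hq : 1 < q) (hk : 0 < k) {x : ℂ} (hx : x ≠ 0)
    (hneg : ∀ s : ℝ, 0 < s → 1 + s * x ≠ 0) : theta q k x ≠ 0 := by
  rw [theta_eq hq]
  exact tsum_thetaWt_ne_zero (div_pos (Real.log_pos hq) hk) hx hneg

lemma differentiableOn_theta {q k : ℝ} (hq : 1 < q) (hk : 0 < k) :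
    DifferentiableOn ℂ (theta q k) {0}ᶜ := by
  intro x hx
  have hg : 0 < Real.log q / k := div_pos (Real.log_pos hq) hk
  have hx0 : x ≠ 0 := hx
  have hcont : ContinuousAt (fun y : ℂ => |Real.log ‖y‖|) x :=
    ((Real.continuousAt_log (norm_ne_zero_iff.2 hx0)).comp continuous_norm.continuousAt).abs
  have hev : ∀ᶠ y in 𝓝 x, y ≠ 0 ∧ |Real.log ‖y‖| < |Real.log ‖x‖| + 1 :=
    Filter.Eventually.and (eventually_ne_nhds hx0) (hcont.eventually_lt_const (by linarith))
  obtain ⟨V, hV, hVo, hxV⟩ := eventually_nhds_iff.1 hev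
  have : DifferentiableOn ℂ (fun y => ∑' n : ℤ, (thetaWt (Real.log q / k) n : ℂ) * y ^ n) V := by
    refine Complex.differentiableOn_tsum_of_summable_norm
      (summable_theta_bound hg (|Real.log ‖x‖| + 1)) (fun n y hy => ?_) hVo (fun n y hy => ?_)
    · exact ((differentiableAt_zpow.2 (Or.inl (hV y hy).1)).const_mul _).differentiableWithinAt
    · exact norm_thetaWt_mul_zpow_le hg (hV y hy).1 (hV y hy).2.le n
  refine DifferentiableAt.differentiableWithinAt
    ((this.differentiableAt (hVo.mem_nhds hxV)).congr_of_eventuallyEq ?_)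
  exact Eventually.of_forall fun y => theta_eq hq y

/-- The functional equation `Θ(q^{m/k} x) = q^{m(m+1)/(2k)} x^m Θ(x)`. -/
lemma theta_dilate {q k : ℝ} (hq : 1 < q) {x : ℂ} (hx : x ≠ 0) (m : ℤ) :
    theta q k ((Real.exp (m * (Real.log q / k)) : ℝ) * x) =
      (Real.exp (Real.log q / k * (m * (m + 1) / 2)) : ℝ) * x ^ m * theta q k x := by
  rw [theta_eq hq, theta_eq hq, ← tsum_mul_left, ← (Equiv.addRight m).tsum_eq]
  congr 1; ext n
  simp only [Equiv.coe_addRight, thetaWt]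
  have : ((Real.exp (m * (Real.log q / k)) : ℝ) : ℂ) ^ (n + m) =
      (Real.exp ((n + m : ℤ) * (m * (Real.log q / k))) : ℝ) := by
    rw [exp_intCast_mul (n + m), Complex.ofReal_zpow]
  rw [mul_zpow, this, zpow_add₀ hx]
  have e : Real.exp (-(Real.log q / k * (((n + m : ℤ) : ℝ) * ((n + m : ℤ) - 1) / 2))) *
      Real.exp ((n + m : ℤ) * (m * (Real.log q / k))) =
      Real.exp (Real.log q / k * (m * (m + 1) / 2)) *
        Real.exp (-(Real.log q / k * ((n : ℝ) * (n - 1) / 2))) := by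
    rw [← Real.exp_add, ← Real.exp_add]; congr 1; push_cast; ring
  have e' : ((Real.exp (-(Real.log q / k * (((n + m : ℤ) : ℝ) * ((n + m : ℤ) - 1) / 2))) : ℝ) : ℂ) *
      (Real.exp ((n + m : ℤ) * (m * (Real.log q / k))) : ℝ) =
      (Real.exp (Real.log q / k * (m * (m + 1) / 2)) : ℝ) *
        (Real.exp (-(Real.log q / k * ((n : ℝ) * (n - 1) / 2))) : ℝ) := by exact_mod_cast e
  linear_combination (x ^ n * x ^ m) * e'

/-- The lower bound `|Θ(x)| ≥ c exp (k log²|x| / (2 log q)) |x|^{1/2}` away from the negative real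
axis. The functional equation reduces it to an annulus, where compactness applies. -/
lemma theta_lower_bound {q k δt : ℝ} (hq : 1 < q) (hk : 0 < k) (hδ : 0 < δt) :
    ∃ c : ℝ, 0 < c ∧ ∀ x : ℂ, x ≠ 0 → (∀ s : ℝ, 0 ≤ s → δt ≤ ‖1 + s * x‖) →
      c * growth q k (1 / 2) ‖x‖ ≤ ‖theta q k x‖ := by
  have hlq := Real.log_pos hq
  set g := Real.log q / k with hgdef
  have hg : 0 < g := div_pos hlq hk
  -- a fundamental annulus for the dilation `x ↦ q^{1/k} x`
  let K : Set ℂ := {x | ‖x‖ ∈ Set.Icc 1 (Real.exp g) ∧ ∀ s : ℝ, 0 ≤ s → δt ≤ ‖1 + s * x‖}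
  have hKne : ∀ x ∈ K, x ≠ 0 := fun x hx => by
    have := hx.1.1
    rintro rfl; simp at this; linarith
  have hKc : IsCompact K := by
    refine Metric.isCompact_of_isClosed_isBounded ?_ ?_
    · refine IsClosed.inter (isClosed_Icc.preimage continuous_norm) ?_
      have : {x : ℂ | ∀ s : ℝ, 0 ≤ s → δt ≤ ‖1 + s * x‖} =
          ⋂ s : ℝ, ⋂ _ : 0 ≤ s, {x : ℂ | δt ≤ ‖1 + s * x‖} := by ext; simp
      change IsClosed {x : ℂ | ∀ s : ℝ, 0 ≤ s → δt ≤ ‖1 + s * x‖}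
      exact this ▸ isClosed_iInter fun s => isClosed_iInter fun _ =>
        isClosed_le continuous_const (by fun_prop)
    · refine (Metric.isBounded_closedBall (x := (0 : ℂ)) (r := Real.exp g)).subset ?_
      intro x hx; simpa using hx.1.2
  obtain ⟨c₁, hc₁, hmin⟩ : ∃ c₁ : ℝ, 0 < c₁ ∧ ∀ x ∈ K, c₁ ≤ ‖theta q k x‖ := by
    rcases K.eq_empty_or_nonempty with h | h
    · exact ⟨1, one_pos, by simp [h]⟩
    · obtain ⟨x₀, hx₀, hx₀'⟩ := hKc.exists_isMinOn h
        (((differentiableOn_theta hq hk).continuousOn.mono fun x hx => hKne x hx).norm)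
      refine ⟨_, norm_pos_iff.2 (theta_ne_zero hq hk (hKne _ hx₀) fun s hs h => ?_), hx₀'⟩
      have := hx₀.2 s hs.le
      rw [h, norm_zero] at this; linarith
  refine ⟨c₁ * Real.exp (-g), by positivity, fun x hx hxs => ?_⟩
  have hxp : 0 < ‖x‖ := norm_pos_iff.2 hx
  -- `x = q^{n/k} x₀` with `x₀` in the annulus
  let n : ℤ := ⌊Real.log ‖x‖ / g⌋
  have hn1 : n * g ≤ Real.log ‖x‖ := (le_div_iff₀ hg).1 (Int.floor_le _)
  have hn2 : Real.log ‖x‖ < (n + 1) * g := (div_lt_iff₀ hg).1 (Int.lt_floor_add_one _)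
  set L := Real.log ‖x‖ - n * g with hL
  let x₀ : ℂ := (Real.exp (-(n * g)) : ℝ) * x
  have hx₀ : ‖x₀‖ = Real.exp L := by
    simp only [x₀, norm_mul, Complex.norm_real, Real.norm_eq_abs, Real.abs_exp]
    conv_lhs => rw [← Real.exp_log hxp, ← Real.exp_add]
    congr 1; ring
  have hx₀K : x₀ ∈ K := by
    refine ⟨⟨?_, ?_⟩, fun s hs => ?_⟩
    · rw [hx₀]; exact Real.one_le_exp (by linarith)
    · rw [hx₀]; exact Real.exp_le_exp.2 (by linarith)
    · have := hxs (s * Real.exp (-(n * g))) (by positivity)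
      simpa [x₀, mul_assoc] using this
  have hxx : x = (Real.exp (n * (Real.log q / k)) : ℝ) * x₀ := by
    simp only [x₀, ← mul_assoc, ← hgdef]
    rw [← Complex.ofReal_mul, ← Real.exp_add]; simp
  have key := theta_dilate (k := k) hq (hKne _ hx₀K) n
  rw [← hxx] at key
  have hz : ‖x₀ ^ n‖ = Real.exp (n * L) := by rw [norm_zpow, hx₀, exp_intCast_mul]
  rw [key, norm_mul, norm_mul, hz, Complex.norm_real, Real.norm_eq_abs, Real.abs_exp,
    ← Real.exp_add]
  have hgr : growth q k (1 / 2) ‖x‖ =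
      Real.exp (g * (n * (n + 1) / 2) + n * L + (L ^ 2 / (2 * g) + L / 2)) := by
    rw [growth]; congr 1
    have : Real.log ‖x‖ = L + n * g := by rw [hL]; ring
    rw [this]
    have hk' : k = Real.log q / g := by rw [hgdef]; field_simp
    rw [hk']; field_simp; ring
  have hL0 : 0 ≤ L := by linarith
  have hL1 : L ≤ g := by linarith
  have hsmall : L ^ 2 / (2 * g) + L / 2 ≤ g := by
    have : L ^ 2 / (2 * g) ≤ g / 2 := by
      rw [div_le_iff₀ (by positivity)]; nlinarith
    linarith
  calc c₁ * Real.exp (-g) * growth q k (1 / 2) ‖x‖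
      = Real.exp (g * (n * (n + 1) / 2) + n * L) *
          (c₁ * Real.exp (-g + (L ^ 2 / (2 * g) + L / 2))) := by
        rw [hgr, Real.exp_add (g * (n * (n + 1) / 2) + n * L), Real.exp_add (-g)]; ring
    _ ≤ Real.exp (g * (n * (n + 1) / 2) + n * L) * (c₁ * 1) := by
        gcongr; exact Real.exp_le_one_iff.2 (by linarith)
    _ ≤ _ := by rw [mul_one]; gcongr; exact hmin _ hx₀K

end

/-! ### The growth factor -/

section

open Filter Topology MeasureTheory

lemma growth_pos (q k a x : ℝ) : 0 < growth q k a x := Real.exp_pos _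

lemma growth_mono {q k k' a x : ℝ} (hq : 1 < q) (hk : k ≤ k') :
    growth q k a x ≤ growth q k' a x := by
  have := Real.log_pos hq
  unfold growth
  gcongr

lemma continuousOn_growth (q k a : ℝ) : ContinuousOn (growth q k a) {0}ᶜ := by
  unfold growth
  have := Real.continuousOn_log
  fun_prop

/-- On the unshifted weight, a dilation acts as multiplication by a power of `s`. -/
lemma growth_dilate {q k a γ s : ℝ} (hq : 1 < q) (hs : 0 < s) :
    growth q k a (q ^ (-γ) * s) =
      Real.exp (k * γ ^ 2 * Real.log q / 2 - a * γ * Real.log q) * s ^ (-(k * γ)) *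
        growth q k a s := by
  have hq0 : 0 < q := by linarith
  have hlq := Real.log_pos hq
  rw [growth, growth, Real.log_mul (by positivity) hs.ne', Real.log_rpow hq0,
    Real.rpow_def_of_pos hs, ← Real.exp_add, ← Real.exp_add]
  congr 1
  field_simp
  ring

lemma growth_le_of_mem_Icc {q k a c₀ c₁ : ℝ} (hq : 1 < q) (hk : 0 ≤ k) (hc₀ : 0 < c₀) :
    ∃ K : ℝ, 0 < K ∧ ∀ y, c₀ ≤ y → y ≤ c₁ → growth q k a y ≤ K := by
  have hlq := Real.log_pos hq
  set M := |Real.log c₀| + |Real.log c₁| with hM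
  refine ⟨Real.exp (k * M ^ 2 / (2 * Real.log q) + |a| * M), Real.exp_pos _, fun y h0 h1 => ?_⟩
  have hl0 := Real.log_le_log hc₀ h0
  have hl1 := Real.log_le_log (hc₀.trans_le h0) h1
  have hy : |Real.log y| ≤ M := by
    rw [abs_le]
    constructor
    · have := neg_abs_le (Real.log c₀); have := abs_nonneg (Real.log c₁); linarith
    · have := le_abs_self (Real.log c₁); have := abs_nonneg (Real.log c₀); linarith
  have h2 : Real.log y ^ 2 ≤ M ^ 2 := sq_le_sq' (by linarith [(abs_le.1 hy).1]) (abs_le.1 hy).2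
  have h3 : a * Real.log y ≤ |a| * M :=
    (le_abs_self _).trans (by rw [abs_mul]; gcongr)
  unfold growth
  gcongr

/-- If `y` differs from `c x` by a bounded amount, then `log y - log (c x) = O(1/x)`, so that even
its product with `log x` is bounded. -/
lemma log_near_dilate {c δ c₀ : ℝ} (hc : 0 < c) (hδ : 0 ≤ δ) (hc₀ : 0 < c₀) :
    ∃ M : ℝ, 0 ≤ M ∧ ∀ x y : ℝ, c₀ ≤ x → c₀ ≤ y → |y - c * x| ≤ δ →
      |Real.log y - Real.log c - Real.log x| ≤ M ∧
      |(Real.log y - Real.log c - Real.log x) * Real.log x| ≤ M := by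
  set K := δ * (1 + δ / c₀) / c with hK
  have hK0 : 0 ≤ K := by positivity
  refine ⟨K / c₀ + K * (1 + 1 / c₀ ^ 2), by positivity, fun x y hx hy hxy => ?_⟩
  have hx0 : 0 < x := hc₀.trans_le hx
  have hy0 : 0 < y := hc₀.trans_le hy
  have hab := abs_le.1 hxy
  set t := Real.log y - Real.log c - Real.log x with ht
  have hcx : 0 < c * x := by positivity
  have ht1 : t = Real.log (y / (c * x)) := by
    rw [Real.log_div hy0.ne' hcx.ne', Real.log_mul hc.ne' hx0.ne', ht]; ring
  have ht2 : -t = Real.log (c * x / y) := by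
    rw [Real.log_div hcx.ne' hy0.ne', Real.log_mul hc.ne' hx0.ne', ht]; ring
  have up : t ≤ K / x := by
    have h1 := Real.log_le_sub_one_of_pos (div_pos hy0 hcx)
    rw [← ht1] at h1
    refine h1.trans ?_
    have : y / (c * x) - 1 = (y - c * x) / c / x := by field_simp
    rw [this, hK]
    gcongr
    have : 0 ≤ δ * (δ / c₀) := by positivity
    linarith
  have lo : -t ≤ K / x := by
    have h1 := Real.log_le_sub_one_of_pos (div_pos hcx hy0)
    rw [← ht2] at h1
    refine h1.trans ?_
    have hxle : c * x ≤ y * (1 + δ / c₀) := by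
      have : δ ≤ y * (δ / c₀) := by
        rw [mul_div_assoc', le_div_iff₀ hc₀]; nlinarith
      linarith
    rw [div_sub_one hy0.ne', div_le_div_iff₀ hy0 hx0]
    calc (c * x - y) * x ≤ δ * x := by gcongr; linarith
      _ = δ * (c * x) / c := by field_simp
      _ ≤ δ * (y * (1 + δ / c₀)) / c := by gcongr
      _ = K * y := by rw [hK]; ring
  have habs : |t| ≤ K / x := abs_le.2 ⟨by linarith, up⟩
  have hKx : K / x ≤ K / c₀ := by gcongr
  refine ⟨habs.trans (hKx.trans (le_add_of_nonneg_right (by positivity))), ?_⟩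
  have hlog : |Real.log x| ≤ x * (1 + 1 / c₀ ^ 2) := by
    have hx2 : 1 ≤ x * (x * (1 / c₀ ^ 2)) := by
      rw [mul_one_div, mul_div_assoc', le_div_iff₀ (by positivity)]; nlinarith
    have h1 := Real.log_le_sub_one_of_pos hx0
    have h2 := Real.log_le_sub_one_of_pos (inv_pos.2 hx0)
    rw [Real.log_inv] at h2
    have h3 : x⁻¹ ≤ x * (1 / c₀ ^ 2) := by
      rw [inv_eq_one_div, div_le_iff₀ hx0]; linarith
    have h4 : 0 ≤ x * (1 / c₀ ^ 2) := by positivity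
    rw [abs_le]; constructor <;> linarith
  calc |t * Real.log x| = |t| * |Real.log x| := abs_mul _ _
    _ ≤ K / x * (x * (1 + 1 / c₀ ^ 2)) := by gcongr
    _ = K * (1 + 1 / c₀ ^ 2) := by field_simp
    _ ≤ _ := le_add_of_nonneg_left (by positivity)

/-- The gain `x ^ (-k γ)` of the dilation `x ↦ q^{-γ} x` in the growth factor survives a bounded
perturbation of the dilated point, and it absorbs `x ^ n` when `n ≤ k γ`. -/
lemma growth_near_dilate {q k a γ δ c₀ : ℝ} {n : ℕ} (hq : 1 < q) (hk : 0 < k) (hγ : 0 ≤ γ)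
    (hn : (n : ℝ) ≤ k * γ) (hδ : 0 ≤ δ) (hc₀ : 0 < c₀) :
    ∃ K : ℝ, 0 < K ∧ ∀ x y : ℝ, c₀ ≤ x → c₀ ≤ y → |y - q ^ (-γ) * x| ≤ δ →
      x ^ n * growth q k a y ≤ K * growth q k a x := by
  have hlq := Real.log_pos hq
  have hq0 : 0 < q := by linarith
  obtain ⟨M, hM, hlog⟩ := log_near_dilate (c := q ^ (-γ)) (Real.rpow_pos_of_pos hq0 _) hδ hc₀
  set G := γ * Real.log q with hG
  have hG0 : 0 ≤ G := by positivity
  set B := (k * γ - n) * |Real.log c₀| + k / Real.log q * M +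
    k * (M + G) ^ 2 / (2 * Real.log q) + |a| * (M + G) with hB
  refine ⟨Real.exp B, Real.exp_pos _, fun x y hx hy hxy => ?_⟩
  obtain ⟨h1, h2⟩ := hlog x y hx hy hxy
  have hx0 : 0 < x := hc₀.trans_le hx
  rw [Real.log_rpow hq0] at h1 h2
  set t := Real.log y - -γ * Real.log q - Real.log x with ht
  have hly : Real.log y = Real.log x - G + t := by rw [ht, hG]; ring
  have hxn : x ^ n = Real.exp (n * Real.log x) := by
    rw [← Real.rpow_natCast, Real.rpow_def_of_pos hx0, mul_comm]
  rw [growth, growth, hxn, ← Real.exp_add, ← Real.exp_add, Real.exp_le_exp, hly]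
  have hlx : -Real.log x ≤ |Real.log c₀| := by
    have := Real.log_le_log hc₀ hx; have := neg_abs_le (Real.log c₀); linarith
  have e1 : (k * γ - n) * (-Real.log x) ≤ (k * γ - n) * |Real.log c₀| :=
    mul_le_mul_of_nonneg_left hlx (by linarith)
  have e2 : k / Real.log q * (t * Real.log x) ≤ k / Real.log q * M := by
    gcongr; exact (le_abs_self _).trans h2
  have htG : |t - G| ≤ M + G := by
    have := abs_sub t G; rw [abs_of_nonneg hG0] at this; linarith
  have e3 : k * (t - G) ^ 2 / (2 * Real.log q) ≤ k * (M + G) ^ 2 / (2 * Real.log q) := by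
    have : (t - G) ^ 2 ≤ (M + G) ^ 2 := sq_le_sq' (by linarith [(abs_le.1 htG).1]) (abs_le.1 htG).2
    gcongr
  have e4 : a * (t - G) ≤ |a| * (M + G) :=
    (le_abs_self _).trans (by rw [abs_mul]; gcongr)
  -- apart from the product `t * log x`, the unbounded `log x` enters linearly only, with the
  -- coefficient `n - k γ ≤ 0`, and it is bounded from below
  have key : n * Real.log x + (k * (Real.log x - G + t) ^ 2 / (2 * Real.log q) +
      a * (Real.log x - G + t)) = (k * γ - n) * (-Real.log x) +
      k / Real.log q * (t * Real.log x) + k * (t - G) ^ 2 / (2 * Real.log q) + a * (t - G) +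
      (k * Real.log x ^ 2 / (2 * Real.log q) + a * Real.log x) := by
    rw [hG]; field_simp; ring
  rw [key]
  linarith

/-- Multiplication by `τ^n` is absorbed by the dilation `τ ↦ q^{-γ} τ` in the shifted growth
factor as soon as `n ≤ k γ`. -/
lemma growth_shift_dilate {q k a γ δ c₀ : ℝ} {n : ℕ} (hq : 1 < q) (hk : 0 < k) (hγ : 0 ≤ γ)
    (hn : (n : ℝ) ≤ k * γ) (hδ : 0 ≤ δ) (hc₀ : 0 < c₀) :
    ∃ K : ℝ, 0 < K ∧ ∀ τ : ℂ, c₀ ≤ ‖τ + (δ : ℂ)‖ → c₀ ≤ ‖dil q (-γ) * τ + (δ : ℂ)‖ →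
      ‖τ‖ ^ n * growth q k a ‖dil q (-γ) * τ + (δ : ℂ)‖ ≤ K * growth q k a ‖τ + (δ : ℂ)‖ := by
  have hq0 : 0 < q := by linarith
  obtain ⟨K, hK, h⟩ := growth_near_dilate (a := a) hq hk hγ hn hδ hc₀
  refine ⟨(1 + δ / c₀) ^ n * K, by positivity, fun τ hx hy => ?_⟩
  set x := ‖τ + (δ : ℂ)‖
  set y := ‖dil q (-γ) * τ + (δ : ℂ)‖
  have hcp : 0 < q ^ (-γ) := Real.rpow_pos_of_pos hq0 _
  have hc1 : q ^ (-γ) ≤ 1 := Real.rpow_le_one_of_one_le_of_nonpos hq.le (by linarith)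
  have hxy : |y - q ^ (-γ) * x| ≤ δ := by
    have e : q ^ (-γ) * x = ‖dil q (-γ) * (τ + (δ : ℂ))‖ := by
      rw [norm_mul, dil, Complex.norm_real, Real.norm_eq_abs, abs_of_pos hcp]
    rw [e]
    refine (abs_norm_sub_norm_le _ _).trans ?_
    have : dil q (-γ) * τ + (δ : ℂ) - dil q (-γ) * (τ + δ) = (((1 - q ^ (-γ)) * δ : ℝ) : ℂ) := by
      rw [dil]; push_cast; ring
    rw [this, Complex.norm_real, Real.norm_eq_abs, abs_of_nonneg (mul_nonneg (by linarith) hδ)]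
    nlinarith
  have hτ : ‖τ‖ ≤ (1 + δ / c₀) * x := by
    have : ‖τ‖ ≤ x + δ := by
      have := norm_sub_le (τ + (δ : ℂ)) δ
      rwa [add_sub_cancel_right, Complex.norm_real, Real.norm_eq_abs, abs_of_nonneg hδ] at this
    have : δ ≤ δ / c₀ * x := by rw [div_mul_eq_mul_div, le_div_iff₀ hc₀]; nlinarith
    linarith
  calc ‖τ‖ ^ n * growth q k a y ≤ ((1 + δ / c₀) * x) ^ n * growth q k a y := by
        have := growth_pos q k a y
        gcongr
    _ = (1 + δ / c₀) ^ n * (x ^ n * growth q k a y) := by rw [mul_pow]; ring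
    _ ≤ (1 + δ / c₀) ^ n * (K * growth q k a x) :=
        mul_le_mul_of_nonneg_left (h x y hx hy hxy) (by positivity)
    _ = _ := by ring

/-- The shifted weight is dominated by the unshifted one, and it stays bounded near `0`, where the
unshifted one blows up. -/
lemma growth_shift_le {q k a δ c₀ : ℝ} (hq : 1 < q) (hk : 0 < k) (hδ : 0 ≤ δ) (hc₀ : 0 < c₀) :
    ∃ K : ℝ, 0 < K ∧ ∀ u : ℂ, 0 < ‖u‖ → c₀ ≤ ‖u + (δ : ℂ)‖ →
      growth q k a ‖u + (δ : ℂ)‖ ≤ K * growth q k a ‖u‖ ∧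
      (‖u‖ ≤ 1 → growth q k a ‖u + (δ : ℂ)‖ ≤ K) := by
  have hlq := Real.log_pos hq
  obtain ⟨K₁, hK₁, h₁⟩ := growth_near_dilate (a := a) (n := 0) (γ := 0) hq hk le_rfl (by simp) hδ
    (show 0 < min 1 c₀ by positivity)
  obtain ⟨K₂, hK₂, h₂⟩ := growth_le_of_mem_Icc (a := a) (c₁ := 1 + δ) hq hk.le hc₀
  set l := Real.exp (a ^ 2 * Real.log q / (2 * k)) with hl
  have hl1 : 1 ≤ l := Real.one_le_exp (by positivity)
  refine ⟨K₁ + K₂ * l, by positivity, fun u hu huδ => ⟨?_, fun h => ?_⟩⟩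
  · have htri : |‖u + (δ : ℂ)‖ - ‖u‖| ≤ δ := by
      refine (abs_norm_sub_norm_le _ _).trans ?_
      simp [abs_of_nonneg hδ]
    rcases le_total 1 ‖u‖ with h | h
    · have := h₁ ‖u‖ ‖u + (δ : ℂ)‖ ((min_le_left _ _).trans h) ((min_le_right _ _).trans huδ)
        (by simpa using htri)
      rw [pow_zero, one_mul] at this
      refine this.trans ?_
      have := growth_pos q k a ‖u‖
      gcongr
      have : 0 < K₂ * l := by positivity
      linarith
    · have h3 : 1 ≤ l * growth q k a ‖u‖ := by
        rw [hl, growth, ← Real.exp_add]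
        refine Real.one_le_exp ?_
        have : a ^ 2 * Real.log q / (2 * k) + (k * Real.log ‖u‖ ^ 2 / (2 * Real.log q) +
            a * Real.log ‖u‖) = (k * Real.log ‖u‖ + a * Real.log q) ^ 2 /
              (2 * k * Real.log q) := by field_simp; ring
        rw [this]; positivity
      have h4 := h₂ ‖u + (δ : ℂ)‖ huδ (by linarith [(abs_le.1 htri).2])
      have := growth_pos q k a ‖u‖
      calc growth q k a ‖u + (δ : ℂ)‖ ≤ K₂ * 1 := by linarith
        _ ≤ K₂ * (l * growth q k a ‖u‖) := by gcongr
        _ ≤ _ := by nlinarith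
  · refine (h₂ _ huδ ((norm_add_le _ _).trans ?_)).trans ?_
    · simp [abs_of_nonneg hδ, h]
    · nlinarith

/-! ### The decay factor and the convolution -/

lemma decay_pos (β μ m : ℝ) : 0 < decay β μ m := by unfold decay; positivity

lemma continuous_decay (β μ : ℝ) : Continuous (decay β μ) := by
  unfold decay
  refine Continuous.mul (Continuous.rpow_const (by fun_prop) fun m => Or.inl ?_) (by fun_prop)
  positivity

lemma decay_le_rpow {β μ s : ℝ} (hβ : 0 ≤ β) (hs : s ≤ μ) (m : ℝ) :
    decay β μ m ≤ (1 + |m|) ^ (-s) := by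
  unfold decay
  have h1 : (1 + |m|) ^ (-μ) ≤ (1 + |m|) ^ (-s) :=
    Real.rpow_le_rpow_of_exponent_le (by linarith [abs_nonneg m]) (by linarith)
  have h2 : Real.exp (-(β * |m|)) ≤ 1 := Real.exp_le_one_iff.2 (by simp; positivity)
  calc _ ≤ (1 + |m|) ^ (-s) * 1 := by gcongr
    _ = _ := mul_one _

lemma decay_le_one {β μ : ℝ} (hβ : 0 ≤ β) (hμ : 0 ≤ μ) (m : ℝ) : decay β μ m ≤ 1 := by
  simpa using decay_le_rpow hβ hμ m

lemma continuous_evI (P : ℂ[X]) : Continuous (evI P) := by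
  unfold evI; fun_prop

lemma exists_norm_evI_le (P : ℂ[X]) {N : ℕ} (hN : P.natDegree ≤ N) :
    ∃ K : ℝ, 0 < K ∧ ∀ m : ℝ, ‖evI P m‖ ≤ K * (1 + |m|) ^ N := by
  refine ⟨∑ i ∈ Finset.range (P.natDegree + 1), ‖P.coeff i‖ + 1, by positivity, fun m => ?_⟩
  have h1 : 1 ≤ 1 + |m| := by linarith [abs_nonneg m]
  rw [evI, eval_eq_sum_range]
  refine (norm_sum_le _ _).trans ?_
  rw [add_mul, Finset.sum_mul]
  refine le_add_of_le_of_nonneg (Finset.sum_le_sum fun i hi => ?_) (by positivity)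
  rw [norm_mul, norm_pow, norm_mul, Complex.norm_I, one_mul, Complex.norm_real, Real.norm_eq_abs]
  gcongr
  calc |m| ^ i ≤ (1 + |m|) ^ i := by gcongr; linarith
    _ ≤ _ := pow_le_pow_right₀ h1 (by have := Finset.mem_range.1 hi; omega)

/-- Lower bounds for the distances of `x` to the roots of `P` give a lower bound for `|P(x)|`. -/
lemma prod_le_norm_eval (P : ℂ[X]) (x : ℂ) (b : ℂ → ℝ)
    (hb : ∀ r ∈ P.roots, 0 ≤ b r ∧ b r ≤ ‖x - r‖) :
    ‖P.leadingCoeff‖ * (P.roots.map b).prod ≤ ‖P.eval x‖ := by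
  rw [(IsAlgClosed.splits P).eval_eq_prod_roots, norm_mul]
  gcongr
  have : ‖(P.roots.map (x - ·)).prod‖ = (P.roots.map (fun r => ‖x - r‖)).prod := by
    simpa using map_multiset_prod (normHom : ℂ →*₀ ℝ) (P.roots.map (x - ·))
  rw [this]
  exact Multiset.prod_map_le_prod_map₀ _ _ (fun r hr => (hb r hr).1) (fun r hr => (hb r hr).2)

/-- A polynomial without zeros on the imaginary axis has there its full order of growth. -/
lemma exists_le_norm_evI {P : ℂ[X]} (hP : ∀ m, evI P m ≠ 0) :
    ∃ c : ℝ, 0 < c ∧ ∀ m : ℝ, c * (1 + |m|) ^ P.natDegree ≤ ‖evI P m‖ := by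
  have hP0 : P ≠ 0 := by rintro rfl; exact hP 0 (by simp [evI])
  -- `e z` balances the bounds `|Re z|` and `|m| - |z|` for `|im - z|`
  let e : ℂ → ℝ := fun z => |z.re| / (1 + ‖z‖ + |z.re|)
  have he : ∀ z ∈ P.roots, 0 < e z := by
    intro z hz
    have : z.re ≠ 0 := by
      intro h
      refine hP z.im ?_
      have hz' : Complex.I * z.im = z := by
        apply Complex.ext <;> simp [h]
      rw [evI, hz']; exact (mem_roots hP0).1 hz
    have := abs_pos.2 this
    positivity
  refine ⟨‖P.leadingCoeff‖ * (P.roots.map e).prod, ?_, fun m => ?_⟩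
  · refine mul_pos (norm_pos_iff.2 (leadingCoeff_ne_zero.2 hP0)) ?_
    refine Multiset.prod_induction (0 < ·) _ (fun a b => mul_pos) one_pos fun a ha => ?_
    obtain ⟨z, hz, rfl⟩ := Multiset.mem_map.1 ha
    exact he z hz
  · have := prod_le_norm_eval P (Complex.I * m) (fun z => e z * (1 + |m|)) (fun z hz => ?_)
    · refine le_trans (le_of_eq ?_) this
      rw [Multiset.prod_map_mul, Multiset.map_const', Multiset.prod_replicate,
        splits_iff_card_roots.1 (IsAlgClosed.splits P)]
      ring
    · have hez := he z hz
      refine ⟨by positivity, ?_⟩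
      simp only [e]
      have h1 : |z.re| ≤ ‖Complex.I * m - z‖ := by
        have := Complex.abs_re_le_norm (Complex.I * m - z); simpa using this
      have h2 : |m| - ‖z‖ ≤ ‖Complex.I * m - z‖ := by
        have := norm_sub_norm_le (Complex.I * m) z; simpa using this
      have h3 := abs_nonneg z.re
      have h4 := norm_nonneg z
      rw [div_mul_eq_mul_div, div_le_iff₀ (by positivity)]
      nlinarith

/-- One of two summands is at least half of a lower bound for their sum: this is what makes
`(1 + |·|)^{-s}` stable under convolution. -/
lemma rpow_neg_mul_rpow_neg_le {a b t s : ℝ} (ha : 0 < a) (hb : 0 < b) (ht : 0 < t)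
    (h : t ≤ a + b) (hs : 0 ≤ s) :
    a ^ (-s) * b ^ (-s) ≤ 2 ^ s * t ^ (-s) * (a ^ (-s) + b ^ (-s)) := by
  have key : ∀ {x : ℝ}, t / 2 ≤ x → x ^ (-s) ≤ 2 ^ s * t ^ (-s) := by
    intro x hx
    calc x ^ (-s) ≤ (t / 2) ^ (-s) :=
          Real.rpow_le_rpow_of_nonpos (by positivity) hx (by linarith)
      _ = 2 ^ s * t ^ (-s) := by
          rw [Real.div_rpow ht.le (by norm_num), Real.rpow_neg (by norm_num : (0 : ℝ) ≤ 2)]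
          field_simp
  have ha' : 0 < a ^ (-s) := Real.rpow_pos_of_pos ha _
  have hb' : 0 < b ^ (-s) := Real.rpow_pos_of_pos hb _
  have hc : 0 < 2 ^ s * t ^ (-s) := by positivity
  rcases le_total a b with hab | hab
  · have := key (x := b) (by linarith); nlinarith
  · have := key (x := a) (by linarith); nlinarith

lemma integrable_one_add_abs_rpow {s : ℝ} (hs : 1 < s) :
    Integrable fun m : ℝ => (1 + |m|) ^ (-s) := by
  simpa using integrable_one_add_norm (E := ℝ) (μ := volume) (r := s) (by simpa using hs)

lemma integrable_evI_mul_decay {P : ℂ[X]} {N : ℕ} {β μ : ℝ} (hP : P.natDegree ≤ N) (hβ : 0 ≤ β)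
    (hμ : (N : ℝ) + 1 < μ) : Integrable fun m : ℝ => ‖evI P m‖ * decay β μ m := by
  obtain ⟨K, hK, hb⟩ := exists_norm_evI_le P hP
  refine ((integrable_one_add_abs_rpow (s := μ - N) (by linarith)).const_mul K).mono'
    (((continuous_evI P).norm.mul (continuous_decay β μ)).aestronglyMeasurable)
    (Eventually.of_forall fun m => ?_)
  have h1 : 0 < 1 + |m| := by positivity
  have := decay_pos β μ m
  rw [Real.norm_eq_abs, abs_of_nonneg (by positivity)]
  calc _ ≤ (K * (1 + |m|) ^ N) * (1 + |m|) ^ (-μ) :=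
        mul_le_mul (hb m) (decay_le_rpow hβ le_rfl m) this.le (by positivity)
    _ = K * (1 + |m|) ^ (-(μ - N)) := by
        rw [mul_assoc, ← Real.rpow_natCast, ← Real.rpow_add h1]; congr 2; ring

lemma norm_conv_integrand_le {P : ℂ[X]} {β μ ζ B : ℝ} {h₁ h₂ : ℝ → ℂ} (hβ : 0 ≤ β) (hμ : 0 ≤ μ)
    (hζ : 0 ≤ ζ) (b₁ : ∀ m, ‖h₁ m‖ ≤ ζ * decay β μ m)
    (b₂ : ∀ m, ‖h₂ m‖ ≤ B * decay β μ m) (m m₁ : ℝ) :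
    ‖h₁ (m - m₁) * evI P m₁ * h₂ m₁‖ ≤ ζ * B * (‖evI P m₁‖ * decay β μ m₁) := by
  rw [norm_mul, norm_mul]
  have h1 : ‖h₁ (m - m₁)‖ ≤ ζ :=
    (b₁ _).trans (mul_le_of_le_one_right hζ (decay_le_one hβ hμ _))
  calc _ ≤ ζ * ‖evI P m₁‖ * (B * decay β μ m₁) := by gcongr; exact b₂ m₁
    _ = _ := by ring

lemma integrable_conv_integrand {P : ℂ[X]} {N : ℕ} {β μ ζ B : ℝ} {h₁ h₂ : ℝ → ℂ}
    (hP : P.natDegree ≤ N) (hβ : 0 ≤ β) (hμ : (N : ℝ) + 1 < μ) (hζ : 0 ≤ ζ)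
    (c₁ : Continuous h₁) (c₂ : Continuous h₂)
    (b₁ : ∀ m, ‖h₁ m‖ ≤ ζ * decay β μ m) (b₂ : ∀ m, ‖h₂ m‖ ≤ B * decay β μ m) (m : ℝ) :
    Integrable fun m₁ : ℝ => h₁ (m - m₁) * evI P m₁ * h₂ m₁ := by
  have hμ0 : 0 ≤ μ := by have : (0 : ℝ) ≤ N := N.cast_nonneg; linarith
  have := continuous_evI P
  exact ((integrable_evI_mul_decay hP hβ hμ).const_mul (ζ * B)).mono'
    (by fun_prop : Continuous _).aestronglyMeasurable
    (Eventually.of_forall fun m₁ => norm_conv_integrand_le hβ hμ0 hζ b₁ b₂ m m₁)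

/-- The convolution `∗^P` maps `E_{(β,μ)} × E_{(β,μ)}` to `E_{(β,μ)}`, up to the factor
`(1 + |m|)^N`, `N ≥ deg P`. -/
lemma exists_norm_conv_le (P : ℂ[X]) {N : ℕ} {β μ : ℝ} (hP : P.natDegree ≤ N) (hβ : 0 ≤ β)
    (hμ : (N : ℝ) + 1 < μ) :
    ∃ M : ℝ, 0 < M ∧ ∀ (ζ B : ℝ) (h₁ h₂ : ℝ → ℂ), 0 ≤ ζ → 0 ≤ B →
      (∀ m, ‖h₁ m‖ ≤ ζ * decay β μ m) → (∀ m, ‖h₂ m‖ ≤ B * decay β μ m) →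
      ∀ m, ‖conv P h₁ h₂ m‖ ≤ M * ζ * B * ((1 + |m|) ^ N * decay β μ m) := by
  obtain ⟨K, hK, hb⟩ := exists_norm_evI_le P hP
  set s := μ - N with hs
  have hs1 : 1 < s := by linarith
  have hN : (0 : ℝ) ≤ N := N.cast_nonneg
  have hJ := integrable_one_add_abs_rpow hs1
  set J := ∫ m : ℝ, (1 + |m|) ^ (-s) with hJdef
  have hJ0 : 0 ≤ J := integral_nonneg fun m => by positivity
  refine ⟨K * 2 ^ s * (J + J) + 1, by positivity, fun ζ B h₁ h₂ hζ hB b₁ b₂ m => ?_⟩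
  have hm : 0 < 1 + |m| := by positivity
  set A := K * ζ * B * (2 ^ s * (1 + |m|) ^ (-s)) * Real.exp (-(β * |m|)) with hA
  have hA0 : 0 ≤ A := by positivity
  have hint : Integrable fun m₁ : ℝ => A * ((1 + |m - m₁|) ^ (-s) + (1 + |m₁|) ^ (-s)) :=
    ((hJ.comp_sub_left m).add hJ).const_mul A
  have hle : ‖conv P h₁ h₂ m‖ ≤ ∫ m₁ : ℝ, A * ((1 + |m - m₁|) ^ (-s) + (1 + |m₁|) ^ (-s)) := by
    refine norm_integral_le_of_norm_le hint (Eventually.of_forall fun m₁ => ?_)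
    have ha : 0 < 1 + |m - m₁| := by positivity
    have hb' : 0 < 1 + |m₁| := by positivity
    have htri : |m| ≤ |m - m₁| + |m₁| := by simpa using abs_add_le (m - m₁) m₁
    have hrp := rpow_neg_mul_rpow_neg_le ha hb' hm (by linarith) (by linarith : 0 ≤ s)
    have h1 : ‖h₁ (m - m₁)‖ ≤ ζ * ((1 + |m - m₁|) ^ (-s) * Real.exp (-(β * |m - m₁|))) := by
      refine (b₁ _).trans ?_
      unfold decay
      have : (1 + |m - m₁|) ^ (-μ) ≤ (1 + |m - m₁|) ^ (-s) :=
        Real.rpow_le_rpow_of_exponent_le (by linarith [abs_nonneg (m - m₁)]) (by linarith)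
      gcongr
    have h2 : ‖evI P m₁‖ * ‖h₂ m₁‖ ≤ K * B * ((1 + |m₁|) ^ (-s) * Real.exp (-(β * |m₁|))) := by
      calc _ ≤ (K * (1 + |m₁|) ^ N) * (B * decay β μ m₁) :=
            mul_le_mul (hb _) (b₂ _) (norm_nonneg _) (by positivity)
        _ = K * B * ((((1 + |m₁|) ^ N) * (1 + |m₁|) ^ (-μ)) * Real.exp (-(β * |m₁|))) := by
            unfold decay; ring
        _ = _ := by
            rw [← Real.rpow_natCast, ← Real.rpow_add hb', hs]; congr 4; ring
    have h3 : Real.exp (-(β * |m - m₁|)) * Real.exp (-(β * |m₁|)) ≤ Real.exp (-(β * |m|)) := by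
      rw [← Real.exp_add, Real.exp_le_exp]; nlinarith
    rw [norm_mul, norm_mul, mul_assoc]
    calc _ ≤ ζ * ((1 + |m - m₁|) ^ (-s) * Real.exp (-(β * |m - m₁|))) *
          (K * B * ((1 + |m₁|) ^ (-s) * Real.exp (-(β * |m₁|)))) :=
          mul_le_mul h1 h2 (by positivity) (by positivity)
      _ = K * ζ * B * ((1 + |m - m₁|) ^ (-s) * (1 + |m₁|) ^ (-s)) *
          (Real.exp (-(β * |m - m₁|)) * Real.exp (-(β * |m₁|))) := by ring
      _ ≤ K * ζ * B * (2 ^ s * (1 + |m|) ^ (-s) * ((1 + |m - m₁|) ^ (-s) + (1 + |m₁|) ^ (-s))) *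
          Real.exp (-(β * |m|)) := by gcongr
      _ = _ := by rw [hA]; ring
  refine hle.trans ?_
  have hJ' : ∫ m₁ : ℝ, (1 + |m - m₁|) ^ (-s) = J :=
    integral_sub_left_eq_self (fun x : ℝ => (1 + |x|) ^ (-s)) volume m
  rw [integral_const_mul, integral_add (hJ.comp_sub_left m) hJ, hJ', ← hJdef]
  have hdec : (1 + |m|) ^ (-s) * Real.exp (-(β * |m|)) = (1 + |m|) ^ N * decay β μ m := by
    unfold decay
    rw [← mul_assoc, ← Real.rpow_natCast, ← Real.rpow_add hm, hs]; congr 2; ring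
  have := decay_pos β μ m
  calc A * (J + J) = K * 2 ^ s * (J + J) * ζ * B * ((1 + |m|) ^ (-s) * Real.exp (-(β * |m|))) := by
        rw [hA]; ring
    _ = K * 2 ^ s * (J + J) * ζ * B * ((1 + |m|) ^ N * decay β μ m) := by rw [hdec]
    _ ≤ _ := by gcongr; linarith

end

/-! ### Holomorphic families and successive approximation -/

section

open Filter Topology MeasureTheory Metric

/-- A dominated integral of holomorphic functions is holomorphic; Cauchy's estimate supplies the
domination of the derivative. -/
theorem differentiableOn_integral_of_dominated {X : Type*} [MeasurableSpace X] {ν : Measure X}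
    {O : Set ℂ} {F : ℂ → X → ℂ}
    (hm : ∀ z ∈ O, AEStronglyMeasurable (F z) ν)
    (hd : ∀ᵐ x ∂ν, DifferentiableOn ℂ (fun z => F z x) O)
    (hb : ∀ z₀ ∈ O, ∃ r > 0, ∃ bound : X → ℝ, Integrable bound ν ∧ ball z₀ r ⊆ O ∧
      ∀ᵐ x ∂ν, ∀ z ∈ ball z₀ r, ‖F z x‖ ≤ bound x) :
    DifferentiableOn ℂ (fun z => ∫ x, F z x ∂ν) O := by
  intro z₀ hz₀
  obtain ⟨r, hr, bound, hbi, hrO, hbd⟩ := hb z₀ hz₀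
  have hnhds : ∀ z ∈ ball z₀ r, O ∈ 𝓝 z := fun z hz =>
    mem_of_superset (isOpen_ball.mem_nhds hz) hrO
  have hderiv : ∀ᵐ x ∂ν, ∀ z ∈ ball z₀ (r / 2),
      HasDerivAt (fun z => F z x) (deriv (fun z => F z x) z) z := by
    filter_upwards [hd] with x hx z hz
    exact (hx.differentiableAt (hnhds z (ball_subset_ball (by linarith) hz))).hasDerivAt
  refine (hasDerivAt_integral_of_dominated_loc_of_deriv_le (ball_mem_nhds z₀ (half_pos hr))
    (bound := fun x => bound x / (r / 4)) ?_ ?_ (F' := fun z x => deriv (fun z => F z x) z) ?_ ?_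
    (hbi.div_const _) hderiv).2.differentiableAt.differentiableWithinAt
  · filter_upwards [isOpen_ball.mem_nhds (mem_ball_self hr)] with z hz using hm z (hrO hz)
  · exact hbi.mono' (hm z₀ hz₀) (hbd.mono fun x hx => hx z₀ (mem_ball_self hr))
  · -- the derivative is a limit of difference quotients along a sequence
    have hseq : Tendsto (fun n : ℕ => (((r / 2) * (1 / ((n : ℝ) + 1)) : ℝ) : ℂ)) atTop
        (𝓝[≠] 0) := by
      refine tendsto_nhdsWithin_iff.2 ⟨?_, Eventually.of_forall fun n => ?_⟩
      · have := (tendsto_one_div_add_atTop_nhds_zero_nat (𝕜 := ℝ)).const_mul (r / 2)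
        rw [mul_zero] at this
        exact (Complex.continuous_ofReal.tendsto 0).comp this
      · have : 0 < (r / 2) * (1 / ((n : ℝ) + 1)) := by positivity
        exact Complex.ofReal_ne_zero.2 this.ne'
    refine aestronglyMeasurable_of_tendsto_ae atTop (f := fun (n : ℕ) x =>
      (((r / 2) * (1 / ((n : ℝ) + 1)) : ℝ) : ℂ)⁻¹ •
        (F (z₀ + (((r / 2) * (1 / ((n : ℝ) + 1)) : ℝ) : ℂ)) x - F z₀ x)) (fun n => ?_) ?_
    · refine ((hm _ (hrO ?_)).sub (hm _ hz₀)).const_smul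
        ((((r / 2) * (1 / ((n : ℝ) + 1)) : ℝ) : ℂ)⁻¹)
      have h1 : 1 / ((n : ℝ) + 1) ≤ 1 := by
        rw [div_le_one (by positivity)]; linarith [n.cast_nonneg (α := ℝ)]
      have h0 : 0 < 1 / ((n : ℝ) + 1) := by positivity
      rw [mem_ball, dist_self_add_left, Complex.norm_real, Real.norm_eq_abs,
        abs_of_pos (by positivity)]
      nlinarith
    · filter_upwards [hderiv] with x hx
      exact (hasDerivAt_iff_tendsto_slope_zero.1 (hx z₀ (mem_ball_self (half_pos hr)))).comp hseq
  · filter_upwards [hbd, hd] with x hx hdx z hz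
    have hsub : closedBall z (r / 4) ⊆ ball z₀ r := fun y hy => by
      have h1 := mem_closedBall.1 hy
      have h2 := mem_ball.1 hz
      have h3 := dist_triangle y z z₀
      rw [mem_ball]; linarith
    refine Complex.norm_deriv_le_of_forall_mem_sphere_norm_le (by positivity) ?_ fun y hy =>
      hx y (hsub (sphere_subset_closedBall hy))
    exact (hdx.mono (hsub.trans hrO)).diffContOnCl_ball subset_rfl

/-- A locally bounded function which is continuous in `x` and holomorphic in a parameter is
jointly continuous. -/
theorem continuousOn_prod_of_differentiableOn {X : Type*} [TopologicalSpace X] {A : Set X}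
    {ε₀ : ℝ} {f : X → ℂ → ℂ}
    (hc : ∀ ε ∈ ball (0 : ℂ) ε₀, ContinuousOn (fun x => f x ε) A)
    (hd : ∀ x ∈ A, DifferentiableOn ℂ (f x) (ball 0 ε₀))
    (hb : ∀ x₀ ∈ A, ∃ M : ℝ, ∀ᶠ x in 𝓝[A] x₀, ∀ ε ∈ ball (0 : ℂ) ε₀, ‖f x ε‖ ≤ M) :
    ContinuousOn (fun p : X × ℂ => f p.1 p.2) (A ×ˢ ball 0 ε₀) := by
  rintro ⟨x₀, e₀⟩ ⟨hx₀, he₀⟩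
  obtain ⟨M, hM⟩ := hb x₀ hx₀
  obtain ⟨r, hr, hrb⟩ := Metric.isOpen_iff.1 isOpen_ball e₀ he₀
  rw [ContinuousWithinAt, nhdsWithin_prod_eq, tendsto_iff_dist_tendsto_zero]
  have hlim : Tendsto (fun p : X × ℂ => (2 * M) / r * dist p.2 e₀ + dist (f p.1 e₀) (f x₀ e₀))
      (𝓝[A] x₀ ×ˢ 𝓝[ball 0 ε₀] e₀) (𝓝 0) := by
    have h1 : Tendsto (fun p : X × ℂ => dist p.2 e₀) (𝓝[A] x₀ ×ˢ 𝓝[ball 0 ε₀] e₀) (𝓝 0) :=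
      (tendsto_iff_dist_tendsto_zero.1 (tendsto_id.mono_left nhdsWithin_le_nhds)).comp tendsto_snd
    have h2 : Tendsto (fun p : X × ℂ => dist (f p.1 e₀) (f x₀ e₀))
        (𝓝[A] x₀ ×ˢ 𝓝[ball 0 ε₀] e₀) (𝓝 0) :=
      (tendsto_iff_dist_tendsto_zero.1 (hc e₀ he₀ x₀ hx₀)).comp tendsto_fst
    simpa using (h1.const_mul ((2 * M) / r)).add h2
  refine squeeze_zero' (Eventually.of_forall fun _ => dist_nonneg) ?_ hlim
  have hball : ∀ᶠ e in 𝓝[ball 0 ε₀] e₀, e ∈ ball e₀ r :=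
    nhdsWithin_le_nhds (ball_mem_nhds e₀ hr)
  filter_upwards [(hM.and self_mem_nhdsWithin).prod_mk hball] with p hp
  obtain ⟨⟨hp1, hpA⟩, hp2⟩ := hp
  have hmaps : Set.MapsTo (f p.1) (ball e₀ r) (closedBall (f p.1 e₀) (2 * M)) := fun e he => by
    rw [mem_closedBall, dist_eq_norm]
    have := norm_sub_le (f p.1 e) (f p.1 e₀)
    have := hp1 e (hrb he)
    have := hp1 e₀ he₀
    linarith
  have := Complex.dist_le_div_mul_dist_of_mapsTo_ball ((hd p.1 hpA).mono hrb) hmaps hp2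
  calc dist (f p.1 p.2) (f x₀ e₀) ≤ _ := dist_triangle _ (f p.1 e₀) _
    _ ≤ _ := by gcongr

/-- Uniform convergence for a continuous weight is locally uniform. -/
lemma tendstoLocallyUniformlyOn_of_norm_le {X : Type*} [TopologicalSpace X] {s : Set X}
    {F : ℕ → X → ℂ} {f : X → ℂ} {b : X → ℝ} {δ : ℕ → ℝ} (hb : ContinuousOn b s)
    (hδ : Tendsto δ atTop (𝓝 0)) (hδ0 : ∀ n, 0 ≤ δ n)
    (h : ∀ n, ∀ x ∈ s, ‖F n x - f x‖ ≤ δ n * b x) :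
    TendstoLocallyUniformlyOn F f atTop s := by
  rw [Metric.tendstoLocallyUniformlyOn_iff]
  intro ε hε x hx
  refine ⟨s ∩ {y | b y < |b x| + 1}, inter_mem self_mem_nhdsWithin
    ((hb x hx).eventually_lt_const (by linarith [le_abs_self (b x)])), ?_⟩
  have hlim : Tendsto (fun n => δ n * (|b x| + 1)) atTop (𝓝 0) := by
    simpa using hδ.mul_const (|b x| + 1)
  filter_upwards [hlim.eventually_lt_const hε] with n hn y hy
  rw [dist_comm, dist_eq_norm]
  exact (h n y hy.1).trans_lt ((mul_le_mul_of_nonneg_left hy.2.le (hδ0 n)).trans_lt hn)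

/-- A set `V`, an open set `O ⊆ V` and a positive weight `Φ` on `V`, with `V` and `O` stable under
the dilations of ratio at most one. -/
structure WeightedDomain (V O : Set ℂ) (Φ : ℂ → ℝ) : Prop where
  isOpen : IsOpen O
  subset : O ⊆ V
  pos : ∀ τ ∈ V, 0 < Φ τ
  cont : ContinuousOn Φ V
  dilV : ∀ c : ℝ, 0 < c → c ≤ 1 → ∀ τ ∈ V, (c : ℂ) * τ ∈ V
  dilO : ∀ c : ℝ, 0 < c → c ≤ 1 → ∀ τ ∈ O, (c : ℂ) * τ ∈ O

/-- `w(·, ·, ε)`, `|ε| < ε₀`, is a family of functions, continuous on `V × ℝ`, holomorphic in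
`τ ∈ O` and in `ε`, and bounded by `B` for the weight `decay · Φ`. -/
structure InFamily (V O : Set ℂ) (Φ : ℂ → ℝ) (β μ ε₀ B : ℝ) (w : ℂ → ℝ → ℂ → ℂ) : Prop where
  cont : ∀ ε ∈ ball (0 : ℂ) ε₀, ContinuousOn (fun p : ℂ × ℝ => w p.1 p.2 ε) (V ×ˢ Set.univ)
  holτ : ∀ ε ∈ ball (0 : ℂ) ε₀, ∀ m, DifferentiableOn ℂ (fun τ => w τ m ε) O
  holε : ∀ τ ∈ V, ∀ m, DifferentiableOn ℂ (fun ε => w τ m ε) (ball 0 ε₀)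
  bound : ∀ ε ∈ ball (0 : ℂ) ε₀, ∀ τ ∈ V, ∀ m, ‖w τ m ε‖ ≤ B * (decay β μ m * Φ τ)

lemma continuous_slice {V : Set ℂ} {v : ℂ → ℝ → ℂ}
    (h : ContinuousOn (fun p : ℂ × ℝ => v p.1 p.2) (V ×ˢ Set.univ)) {τ : ℂ} (hτ : τ ∈ V) :
    Continuous (v τ) := by
  refine continuousOn_univ.1 ?_
  exact h.comp (f := fun m : ℝ => (τ, m)) (by fun_prop) fun m _ => ⟨hτ, trivial⟩

variable {V O : Set ℂ} {Φ : ℂ → ℝ} {β μ ε₀ B : ℝ}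

lemma InFamily.zero (hV : WeightedDomain V O Φ) (hB : 0 ≤ B) :
    InFamily V O Φ β μ ε₀ B (fun _ _ _ => 0) where
  cont _ _ := continuousOn_const
  holτ _ _ _ := differentiableOn_const _
  holε _ _ _ := differentiableOn_const _
  bound _ _ τ hτ m := by
    have := hV.pos τ hτ; have := decay_pos β μ m
    simp only [norm_zero]; positivity

lemma InFamily.add {B' : ℝ} {u v : ℂ → ℝ → ℂ → ℂ} (hu : InFamily V O Φ β μ ε₀ B u)
    (hv : InFamily V O Φ β μ ε₀ B' v) :
    InFamily V O Φ β μ ε₀ (B + B') (fun τ m ε => u τ m ε + v τ m ε) where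
  cont ε hε := (hu.cont ε hε).add (hv.cont ε hε)
  holτ ε hε m := (hu.holτ ε hε m).add (hv.holτ ε hε m)
  holε τ hτ m := (hu.holε τ hτ m).add (hv.holε τ hτ m)
  bound ε hε τ hτ m := by
    rw [add_mul]
    exact (norm_add_le _ _).trans (add_le_add (hu.bound ε hε τ hτ m) (hv.bound ε hε τ hτ m))

/-- Rescaling the bound of a family by multiplication with a coefficient that turns the weight
`Φ` into the weight `Ψ`. -/
lemma InFamily.mul {Ψ : ℂ → ℝ} {A : ℝ} {V' O' : Set ℂ} {w : ℂ → ℝ → ℂ → ℂ} {a : ℂ → ℝ → ℂ}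
    (hw : InFamily V O Φ β μ ε₀ B w) (hB : 0 ≤ B) (hVV : V' ⊆ V) (hOO : O' ⊆ O)
    (ha : ContinuousOn (fun p : ℂ × ℝ => a p.1 p.2) (V' ×ˢ Set.univ))
    (ha' : ∀ m, DifferentiableOn ℂ (fun τ => a τ m) O')
    (hA : ∀ τ ∈ V', ∀ m, ‖a τ m‖ * Φ τ ≤ A * Ψ τ) :
    InFamily V' O' Ψ β μ ε₀ (A * B) (fun τ m ε => a τ m * w τ m ε) where
  cont ε hε := ha.mul ((hw.cont ε hε).mono (Set.prod_mono hVV subset_rfl))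
  holτ ε hε m := (ha' m).mul ((hw.holτ ε hε m).mono hOO)
  holε τ hτ m := (hw.holε τ (hVV hτ) m).const_mul _
  bound ε hε τ hτ m := by
    have := decay_pos β μ m
    rw [norm_mul]
    calc _ ≤ ‖a τ m‖ * (B * (decay β μ m * Φ τ)) := by gcongr; exact hw.bound ε hε τ (hVV hτ) m
      _ = B * decay β μ m * (‖a τ m‖ * Φ τ) := by ring
      _ ≤ B * decay β μ m * (A * Ψ τ) :=
        mul_le_mul_of_nonneg_left (hA τ hτ m) (by positivity)
      _ = _ := by ring

/-- The linear operator `v ↦ a · v(c₀ ·) + ∑ᵢ bᵢ eᵢ Cᵢ ∗^{Pᵢ} v(cᵢ ·)`, the common form of the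
two Borel-plane equations after division by the coefficient of the unknown. -/
def dilConvOp {ι : Type*} (s : Finset ι) (a : ℂ → ℝ → ℂ) (c₀ : ℝ) (b : ι → ℂ → ℝ → ℂ) (c : ι → ℝ)
    (P : ι → ℂ[X]) (e : ι → ℂ) (C : ι → ℝ → ℂ) (v : ℂ → ℝ → ℂ) (τ : ℂ) (m : ℝ) : ℂ :=
  a τ m * v (c₀ * τ) m + ∑ i ∈ s, b i τ m * e i * conv (P i) (C i) (v (c i * τ)) m

/-- Conditions under which `dilConvOp` is a contraction of ratio `1/2` on the weighted space, for
each value of the parameter. -/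
structure ContractionData {ι : Type*} (V O : Set ℂ) (Φ : ℂ → ℝ) (β μ ε₀ ζ : ℝ) (N : ℕ)
    (s : Finset ι) (a : ℂ → ℝ → ℂ) (c₀ : ℝ) (b : ι → ℂ → ℝ → ℂ) (c : ι → ℝ) (P : ι → ℂ[X])
    (n : ι → ℕ) (C : ι → ℝ → ℂ → ℂ) (A M E : ι → ℝ) : Prop where
  dom : WeightedDomain V O Φ
  β_nonneg : 0 ≤ β
  lt_μ : (N : ℝ) + 1 < μ
  ζ_nonneg : 0 ≤ ζ
  c₀_pos : 0 < c₀
  c₀_le : c₀ ≤ 1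
  c_pos : ∀ i ∈ s, 0 < c i
  c_le : ∀ i ∈ s, c i ≤ 1
  a_cont : ContinuousOn (fun p : ℂ × ℝ => a p.1 p.2) (V ×ˢ Set.univ)
  a_hol : ∀ m, DifferentiableOn ℂ (fun τ => a τ m) O
  a_le : ∀ τ ∈ V, ∀ m, ‖a τ m‖ * Φ (c₀ * τ) ≤ 1 / 4 * Φ τ
  b_cont : ∀ i ∈ s, ContinuousOn (fun p : ℂ × ℝ => b i p.1 p.2) (V ×ˢ Set.univ)
  b_hol : ∀ i ∈ s, ∀ m, DifferentiableOn ℂ (fun τ => b i τ m) O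
  b_le : ∀ i ∈ s, ∀ τ ∈ V, ∀ m, ‖b i τ m‖ * (1 + |m|) ^ N * Φ (c i * τ) ≤ A i * Φ τ
  deg_le : ∀ i ∈ s, (P i).natDegree ≤ N
  M_nonneg : ∀ i ∈ s, 0 ≤ M i
  conv_le : ∀ i ∈ s, ∀ (ζ B : ℝ) (h₁ h₂ : ℝ → ℂ), 0 ≤ ζ → 0 ≤ B →
    (∀ m, ‖h₁ m‖ ≤ ζ * decay β μ m) → (∀ m, ‖h₂ m‖ ≤ B * decay β μ m) →
    ∀ m, ‖conv (P i) h₁ h₂ m‖ ≤ M i * ζ * B * ((1 + |m|) ^ N * decay β μ m)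
  C_cont : ∀ i ∈ s, ∀ ε ∈ ball (0 : ℂ) ε₀, Continuous fun m => C i m ε
  C_le : ∀ i ∈ s, ∀ ε ∈ ball (0 : ℂ) ε₀, ∀ m, ‖C i m ε‖ ≤ ζ * decay β μ m
  C_hol : ∀ i ∈ s, ∀ m, DifferentiableOn ℂ (fun ε => C i m ε) (ball 0 ε₀)
  E_le : ∀ i ∈ s, ∀ ε ∈ ball (0 : ℂ) ε₀, ‖ε ^ n i‖ ≤ E i
  small : ∑ i ∈ s, A i * E i * M i * ζ ≤ 1 / 4

namespace ContractionData

variable {ι : Type*} {ζ : ℝ} {N : ℕ} {s : Finset ι} {a : ℂ → ℝ → ℂ} {c₀ : ℝ}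
  {b : ι → ℂ → ℝ → ℂ} {c : ι → ℝ} {P : ι → ℂ[X]} {n : ι → ℕ} {C : ι → ℝ → ℂ → ℂ}
  {A M E : ι → ℝ}

/-- The convolution terms are small operators: the loss `(1 + |m|)^N` in the convolution estimate is
compensated by the coefficient `b i`. -/
lemma norm_conv_term_le (h : ContractionData V O Φ β μ ε₀ ζ N s a c₀ b c P n C A M E)
    {ε : ℂ} (hε : ε ∈ ball (0 : ℂ) ε₀) (hB : 0 ≤ B) {i : ι} (hi : i ∈ s) {τ : ℂ} (hτ : τ ∈ V)
    {f : ℝ → ℂ} (hf : ∀ m, ‖f m‖ ≤ B * (decay β μ m * Φ (c i * τ))) (m : ℝ) :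
    ‖b i τ m * ε ^ n i * conv (P i) (fun m => C i m ε) f m‖ ≤
      (A i * E i * M i * ζ) * (B * (decay β μ m * Φ τ)) := by
  have hdec := decay_pos β μ m
  have hΦi := h.dom.pos _ (h.dom.dilV _ (h.c_pos i hi) (h.c_le i hi) τ hτ)
  have hcv := h.conv_le i hi ζ (B * Φ (c i * τ)) _ _ h.ζ_nonneg (by positivity)
    (h.C_le i hi ε hε) (fun m => (hf m).trans (le_of_eq (by ring))) m
  have hM := h.M_nonneg i hi
  have hζ := h.ζ_nonneg
  have hE : 0 ≤ E i := (norm_nonneg _).trans (h.E_le i hi ε hε)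
  rw [norm_mul, norm_mul]
  calc _ ≤ ‖b i τ m‖ * E i * (M i * ζ * (B * Φ (c i * τ)) * ((1 + |m|) ^ N * decay β μ m)) := by
        gcongr
        exact h.E_le i hi ε hε
    _ = E i * M i * ζ * B * decay β μ m * (‖b i τ m‖ * (1 + |m|) ^ N * Φ (c i * τ)) := by ring
    _ ≤ E i * M i * ζ * B * decay β μ m * (A i * Φ τ) :=
        mul_le_mul_of_nonneg_left (h.b_le i hi τ hτ m) (by positivity)
    _ = _ := by ring

/-- The operator is a contraction of ratio `1/2` on any subset of `V` which is stable under the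
dilations: the dilation term and the sum of the convolution terms contribute `1/4` each. -/
lemma contract (h : ContractionData V O Φ β μ ε₀ ζ N s a c₀ b c P n C A M E)
    {V' : Set ℂ} (hV' : V' ⊆ V) (hdil : ∀ c : ℝ, 0 < c → c ≤ 1 → ∀ τ ∈ V', (c : ℂ) * τ ∈ V')
    {ε : ℂ} (hε : ε ∈ ball (0 : ℂ) ε₀) {B₁ B₂ : ℝ} (hB : 0 ≤ B) {v₁ v₂ : ℂ → ℝ → ℂ}
    (c₁ : ∀ τ ∈ V', Continuous (v₁ τ)) (c₂ : ∀ τ ∈ V', Continuous (v₂ τ))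
    (b₁ : ∀ τ ∈ V', ∀ m, ‖v₁ τ m‖ ≤ B₁ * (decay β μ m * Φ τ))
    (b₂ : ∀ τ ∈ V', ∀ m, ‖v₂ τ m‖ ≤ B₂ * (decay β μ m * Φ τ))
    (hd : ∀ τ ∈ V', ∀ m, ‖v₁ τ m - v₂ τ m‖ ≤ B * (decay β μ m * Φ τ)) :
    ∀ τ ∈ V', ∀ m,
      ‖dilConvOp s a c₀ b c P (fun i => ε ^ n i) (fun i m => C i m ε) v₁ τ m -
        dilConvOp s a c₀ b c P (fun i => ε ^ n i) (fun i m => C i m ε) v₂ τ m‖ ≤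
      B / 2 * (decay β μ m * Φ τ) := by
  intro τ hτ m
  have hdec := decay_pos β μ m
  have hΦ := h.dom.pos τ (hV' hτ)
  have hterm : ∀ i ∈ s, conv (P i) (fun m => C i m ε) (v₁ (c i * τ)) m -
      conv (P i) (fun m => C i m ε) (v₂ (c i * τ)) m =
      conv (P i) (fun m => C i m ε) (fun m => v₁ (c i * τ) m - v₂ (c i * τ) m) m := by
    intro i hi
    have hci := hdil _ (h.c_pos i hi) (h.c_le i hi) τ hτ
    have hI : ∀ {v : ℂ → ℝ → ℂ} {B : ℝ}, Continuous (v (c i * τ)) →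
        (∀ m, ‖v (c i * τ) m‖ ≤ B * (decay β μ m * Φ (c i * τ))) →
        Integrable fun m₁ : ℝ => C i (m - m₁) ε * evI (P i) m₁ * v (c i * τ) m₁ := by
      intro v B hc hv
      exact integrable_conv_integrand (B := B * Φ (c i * τ)) (h.deg_le i hi) h.β_nonneg h.lt_μ
        h.ζ_nonneg (h.C_cont i hi ε hε) hc (h.C_le i hi ε hε)
        (fun m => (hv m).trans (le_of_eq (by ring))) m
    rw [conv, conv, conv, ← integral_sub (hI (c₁ _ hci) (b₁ _ hci)) (hI (c₂ _ hci) (b₂ _ hci))]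
    simp_rw [mul_sub]
  have hdiff : dilConvOp s a c₀ b c P (fun i => ε ^ n i) (fun i m => C i m ε) v₁ τ m -
        dilConvOp s a c₀ b c P (fun i => ε ^ n i) (fun i m => C i m ε) v₂ τ m =
      a τ m * (v₁ (c₀ * τ) m - v₂ (c₀ * τ) m) + ∑ i ∈ s, b i τ m * ε ^ n i *
        conv (P i) (fun m => C i m ε) (fun m => v₁ (c i * τ) m - v₂ (c i * τ) m) m := by
    rw [dilConvOp, dilConvOp, add_sub_add_comm, ← Finset.sum_sub_distrib, ← mul_sub]
    congr 1
    exact Finset.sum_congr rfl fun i hi => by rw [← hterm i hi]; ring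
  rw [hdiff]
  have h1 : ‖a τ m * (v₁ (c₀ * τ) m - v₂ (c₀ * τ) m)‖ ≤ B / 4 * (decay β μ m * Φ τ) := by
    rw [norm_mul]
    calc _ ≤ ‖a τ m‖ * (B * (decay β μ m * Φ (c₀ * τ))) := by
          gcongr; exact hd _ (hdil _ h.c₀_pos h.c₀_le τ hτ) m
      _ = B * decay β μ m * (‖a τ m‖ * Φ (c₀ * τ)) := by ring
      _ ≤ B * decay β μ m * (1 / 4 * Φ τ) :=
          mul_le_mul_of_nonneg_left (h.a_le τ (hV' hτ) m) (by positivity)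
      _ = _ := by ring
  have h2 : ∀ i ∈ s, ‖b i τ m * ε ^ n i * conv (P i) (fun m => C i m ε)
      (fun m => v₁ (c i * τ) m - v₂ (c i * τ) m) m‖ ≤
      (A i * E i * M i * ζ) * (B * (decay β μ m * Φ τ)) := fun i hi =>
    h.norm_conv_term_le hε hB hi (hV' hτ) (hd _ (hdil _ (h.c_pos i hi) (h.c_le i hi) τ hτ)) m
  calc _ ≤ B / 4 * (decay β μ m * Φ τ) +
        ∑ i ∈ s, (A i * E i * M i * ζ) * (B * (decay β μ m * Φ τ)) :=
        (norm_add_le _ _).trans (add_le_add h1 (norm_sum_le_of_le _ h2))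
    _ = B / 4 * (decay β μ m * Φ τ) +
        (∑ i ∈ s, (A i * E i * M i * ζ)) * (B * (decay β μ m * Φ τ)) := by rw [Finset.sum_mul]
    _ ≤ B / 4 * (decay β μ m * Φ τ) + 1 / 4 * (B * (decay β μ m * Φ τ)) := by
        gcongr; exact h.small
    _ = _ := by ring

/-- A dilated family is a family for the dilated weight. -/
lemma mem_dilate (hV : WeightedDomain V O Φ) {w : ℂ → ℝ → ℂ → ℂ}
    (hw : InFamily V O Φ β μ ε₀ B w) {r : ℝ} (hr : 0 < r) (hr1 : r ≤ 1) :
    InFamily V O (fun τ => Φ (r * τ)) β μ ε₀ B (fun τ => w (r * τ)) where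
  cont ε hε := (hw.cont ε hε).comp (f := fun p : ℂ × ℝ => ((r : ℂ) * p.1, p.2)) (by fun_prop)
    fun p hp => ⟨hV.dilV r hr hr1 _ hp.1, trivial⟩
  holτ ε hε m := (hw.holτ ε hε m).comp (f := fun τ : ℂ => (r : ℂ) * τ) (by fun_prop)
    fun τ hτ => hV.dilO r hr hr1 τ hτ
  holε τ hτ m := hw.holε _ (hV.dilV r hr hr1 τ hτ) m
  bound ε hε τ hτ m := hw.bound ε hε _ (hV.dilV r hr hr1 τ hτ) m

/-- Regularity of the convolution with a coefficient depending on the parameter. -/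
lemma conv_regular {P : ℂ[X]} {C : ℝ → ℂ → ℂ} {w : ℂ → ℝ → ℂ → ℂ} (hO : IsOpen O) (hOV : O ⊆ V)
    (hΦ : ContinuousOn Φ V)
    (hβ : 0 ≤ β) (hμ : (N : ℝ) + 1 < μ) (hζ : 0 ≤ ζ) (hP : P.natDegree ≤ N) (hB : 0 ≤ B)
    (hCc : ∀ ε ∈ ball (0 : ℂ) ε₀, Continuous fun m => C m ε)
    (hCb : ∀ ε ∈ ball (0 : ℂ) ε₀, ∀ m, ‖C m ε‖ ≤ ζ * decay β μ m)
    (hCh : ∀ m, DifferentiableOn ℂ (fun ε => C m ε) (ball 0 ε₀))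
    (hw : InFamily V O Φ β μ ε₀ B w) :
    (∀ ε ∈ ball (0 : ℂ) ε₀, ContinuousOn
      (fun p : ℂ × ℝ => conv P (fun m => C m ε) (fun m => w p.1 m ε) p.2) (V ×ˢ Set.univ)) ∧
    (∀ ε ∈ ball (0 : ℂ) ε₀, ∀ m, DifferentiableOn ℂ
      (fun τ => conv P (fun m => C m ε) (fun m => w τ m ε) m) O) ∧
    ∀ τ ∈ V, ∀ m, DifferentiableOn ℂ
      (fun ε => conv P (fun m => C m ε) (fun m => w τ m ε) m) (ball 0 ε₀) := by
  have hμ0 : 0 ≤ μ := by have : (0 : ℝ) ≤ N := N.cast_nonneg; linarith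
  have hint := integrable_evI_mul_decay hP hβ hμ
  have hevc := continuous_evI P
  have hmeas : ∀ ε ∈ ball (0 : ℂ) ε₀, ∀ τ ∈ V, ∀ m : ℝ,
      AEStronglyMeasurable (fun m₁ : ℝ => C (m - m₁) ε * evI P m₁ * w τ m₁ ε) := by
    intro ε hε τ hτ m
    have h1 := hCc ε hε
    have h2 := continuous_slice (v := fun τ m => w τ m ε) (hw.cont ε hε) hτ
    exact (((h1.comp (by fun_prop : Continuous fun m₁ : ℝ => m - m₁)).mul hevc).mul
      h2).aestronglyMeasurable
  have hbd : ∀ ε ∈ ball (0 : ℂ) ε₀, ∀ τ ∈ V, ∀ m m₁ : ℝ,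
      ‖C (m - m₁) ε * evI P m₁ * w τ m₁ ε‖ ≤
        ζ * (B * Φ τ) * (‖evI P m₁‖ * decay β μ m₁) := fun ε hε τ hτ m m₁ =>
    norm_conv_integrand_le hβ hμ0 hζ (hCb ε hε)
      (fun m => (hw.bound ε hε τ hτ m).trans (le_of_eq (by ring))) m m₁
  have hloc : ∀ τ₀ ∈ V, ∀ᶠ τ in 𝓝[V] τ₀, τ ∈ V ∧ Φ τ < Φ τ₀ + 1 := fun τ₀ hτ₀ =>
    Filter.Eventually.and (self_mem_nhdsWithin)
      ((hΦ τ₀ hτ₀).eventually_lt_const (by linarith))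
  refine ⟨fun ε hε => ?_, fun ε hε m => ?_, fun τ hτ m => ?_⟩
  · rintro ⟨τ₀, m₀⟩ ⟨hτ₀, -⟩
    have hev : ∀ᶠ p : ℂ × ℝ in 𝓝[V ×ˢ Set.univ] (τ₀, m₀), p.1 ∈ V ∧ Φ p.1 < Φ τ₀ + 1 := by
      rw [nhdsWithin_prod_eq]
      exact tendsto_fst.eventually (hloc τ₀ hτ₀)
    refine continuousWithinAt_of_dominated (hev.mono fun p hp => hmeas ε hε p.1 hp.1 p.2)
      (bound := fun m₁ => ζ * (B * (Φ τ₀ + 1)) * (‖evI P m₁‖ * decay β μ m₁))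
      (hev.mono fun p hp => Eventually.of_forall fun m₁ => (hbd ε hε p.1 hp.1 p.2 m₁).trans ?_)
      (hint.const_mul _) (Eventually.of_forall fun m₁ => ?_)
    · have := decay_pos β μ m₁
      gcongr; exact hp.2.le
    · have h1 : ContinuousWithinAt (fun p : ℂ × ℝ => w p.1 m₁ ε) (V ×ˢ Set.univ) (τ₀, m₀) :=
        ContinuousWithinAt.comp (f := fun p : ℂ × ℝ => (p.1, m₁))
          (g := fun p : ℂ × ℝ => w p.1 p.2 ε) (t := V ×ˢ Set.univ)
          (hw.cont ε hε (τ₀, m₁) ⟨hτ₀, trivial⟩)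
          (by fun_prop) (fun p hp => ⟨hp.1, trivial⟩)
      have h2 := hCc ε hε
      have h3 : Continuous fun p : ℂ × ℝ => C (p.2 - m₁) ε * evI P m₁ :=
        (h2.comp (by fun_prop : Continuous fun p : ℂ × ℝ => p.2 - m₁)).mul continuous_const
      exact h3.continuousWithinAt.mul h1
  · refine differentiableOn_integral_of_dominated (fun τ hτ => hmeas ε hε τ (hOV hτ) m)
      (Eventually.of_forall fun m₁ => (hw.holτ ε hε m₁).const_mul _) fun τ₀ hτ₀ => ?_
    have hev : ∀ᶠ τ in 𝓝 τ₀, τ ∈ O ∧ Φ τ < Φ τ₀ + 1 := by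
      have h1 := (hΦ.mono hOV).continuousAt (hO.mem_nhds hτ₀)
      exact Filter.Eventually.and (hO.mem_nhds hτ₀) (h1.eventually_lt_const (by linarith))
    obtain ⟨r, hr, hrs⟩ := Metric.eventually_nhds_iff_ball.1 hev
    refine ⟨r, hr, fun m₁ => ζ * (B * (Φ τ₀ + 1)) * (‖evI P m₁‖ * decay β μ m₁),
      hint.const_mul _, fun τ hτ => (hrs τ hτ).1, Eventually.of_forall fun m₁ τ hτ =>
        (hbd ε hε τ (hOV (hrs τ hτ).1) m m₁).trans ?_⟩
    have := decay_pos β μ m₁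
    have := (hrs τ hτ).2.le
    beta_reduce
    gcongr
  · refine differentiableOn_integral_of_dominated (fun ε hε => hmeas ε hε τ hτ m)
      (Eventually.of_forall fun m₁ => ((hCh _).mul_const _).mul (hw.holε τ hτ m₁))
      fun e₀ he₀ => ?_
    obtain ⟨r, hr, hrb⟩ := Metric.isOpen_iff.1 isOpen_ball e₀ he₀
    exact ⟨r, hr, _, hint.const_mul (ζ * (B * Φ τ)), hrb,
      Eventually.of_forall fun m₁ ε hε => hbd ε (hrb hε) τ hτ m m₁⟩

lemma mem_conv_term (h : ContractionData V O Φ β μ ε₀ ζ N s a c₀ b c P n C A M E) (hB : 0 ≤ B)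
    {w : ℂ → ℝ → ℂ → ℂ} (hw : InFamily V O Φ β μ ε₀ B w) {i : ι} (hi : i ∈ s) :
    InFamily V O Φ β μ ε₀ (A i * E i * M i * ζ * B) (fun τ m ε => b i τ m * ε ^ n i *
      conv (P i) (fun m => C i m ε) (fun m => w (c i * τ) m ε) m) := by
  have hwc := mem_dilate h.dom hw (h.c_pos i hi) (h.c_le i hi)
  have hreg := conv_regular (P := P i) (C := C i) h.dom.isOpen h.dom.subset
    (h.dom.cont.comp (f := fun τ : ℂ => (c i : ℂ) * τ) (by fun_prop)
      fun τ hτ => h.dom.dilV _ (h.c_pos i hi) (h.c_le i hi) τ hτ)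
    h.β_nonneg h.lt_μ h.ζ_nonneg (h.deg_le i hi) hB (h.C_cont i hi) (h.C_le i hi) (h.C_hol i hi)
    hwc
  refine ⟨fun ε hε => ((h.b_cont i hi).mul continuousOn_const).mul (hreg.1 ε hε),
    fun ε hε m => ((h.b_hol i hi m).mul_const _).mul (hreg.2.1 ε hε m),
    fun τ hτ m => DifferentiableOn.mul (by fun_prop) (hreg.2.2 τ hτ m), fun ε hε τ hτ m => ?_⟩
  rw [mul_assoc _ B]
  exact h.norm_conv_term_le hε hB hi hτ (hwc.bound ε hε τ hτ) m

lemma mem_dil_term (h : ContractionData V O Φ β μ ε₀ ζ N s a c₀ b c P n C A M E) (hB : 0 ≤ B)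
    {w : ℂ → ℝ → ℂ → ℂ} (hw : InFamily V O Φ β μ ε₀ B w) :
    InFamily V O Φ β μ ε₀ (1 / 4 * B) (fun τ m ε => a τ m * w (c₀ * τ) m ε) :=
  (mem_dilate h.dom hw h.c₀_pos h.c₀_le).mul hB subset_rfl subset_rfl h.a_cont h.a_hol h.a_le

/-- The operator maps families to families and halves the bound. -/
lemma mem_op (h : ContractionData V O Φ β μ ε₀ ζ N s a c₀ b c P n C A M E) (hB : 0 ≤ B)
    {w : ℂ → ℝ → ℂ → ℂ} (hw : InFamily V O Φ β μ ε₀ B w) :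
    InFamily V O Φ β μ ε₀ (B / 2) (fun τ m ε =>
      dilConvOp s a c₀ b c P (fun i => ε ^ n i) (fun i m => C i m ε) (fun τ m => w τ m ε) τ m) := by
  have hd₀ := h.mem_dil_term hB hw
  have hi := fun i (hi : i ∈ s) => h.mem_conv_term hB hw hi
  refine ⟨fun ε hε => ?_, fun ε hε m => ?_, fun τ hτ m => ?_, fun ε hε τ hτ m => ?_⟩
  · exact (hd₀.cont ε hε).add (continuousOn_finsetSum _ fun i his => (hi i his).cont ε hε)
  · exact (hd₀.holτ ε hε m).add (DifferentiableOn.fun_sum fun i his => (hi i his).holτ ε hε m)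
  · exact (hd₀.holε τ hτ m).add (DifferentiableOn.fun_sum fun i his => (hi i his).holε τ hτ m)
  · have := h.contract subset_rfl h.dom.dilV hε hB (v₁ := fun τ m => w τ m ε)
      (v₂ := fun _ _ => 0)
      (fun τ hτ => continuous_slice (v := fun τ m => w τ m ε) (hw.cont ε hε) hτ)
      (fun _ _ => continuous_const)
      (hw.bound ε hε) (B₂ := 0) (by simp) (by simpa using hw.bound ε hε) τ hτ m
    simpa [dilConvOp, conv] using this

/-- Existence of a solution, by successive approximations. -/
theorem exists_fixedPoint (h : ContractionData V O Φ β μ ε₀ ζ N s a c₀ b c P n C A M E)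
    (hB : 0 ≤ B) {g : ℂ → ℝ → ℂ → ℂ} (hg : InFamily V O Φ β μ ε₀ B g) :
    ∃ w : ℂ → ℝ → ℂ → ℂ, InFamily V O Φ β μ ε₀ (2 * B) w ∧
      ∀ ε ∈ ball (0 : ℂ) ε₀, ∀ τ ∈ V, ∀ m, w τ m ε = g τ m ε +
        dilConvOp s a c₀ b c P (fun i => ε ^ n i) (fun i m => C i m ε)
          (fun τ m => w τ m ε) τ m := by
  let T : (ℂ → ℝ → ℂ → ℂ) → ℂ → ℝ → ℂ → ℂ := fun w τ m ε =>
    dilConvOp s a c₀ b c P (fun i => ε ^ n i) (fun i m => C i m ε) (fun τ m => w τ m ε) τ m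
  let S : ℕ → ℂ → ℝ → ℂ → ℂ := fun k =>
    Nat.rec (fun _ _ _ => 0) (fun _ w τ m ε => g τ m ε + T w τ m ε) k
  have hSs : ∀ k, S (k + 1) = fun τ m ε => g τ m ε + T (S k) τ m ε := fun k => rfl
  have hSF : ∀ k, InFamily V O Φ β μ ε₀ (2 * B) (S k) := by
    intro k
    induction k with
    | zero => exact InFamily.zero h.dom (by positivity)
    | succ k ih =>
      have := hg.add (h.mem_op (by positivity) ih)
      rw [hSs]
      convert this using 1
      ring
  have hT : ∀ {u v : ℂ → ℝ → ℂ → ℂ} {B₁ B₂ D : ℝ}, InFamily V O Φ β μ ε₀ B₁ u →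
      InFamily V O Φ β μ ε₀ B₂ v → 0 ≤ D → ∀ ε ∈ ball (0 : ℂ) ε₀,
      (∀ τ ∈ V, ∀ m, ‖u τ m ε - v τ m ε‖ ≤ D * (decay β μ m * Φ τ)) →
      ∀ τ ∈ V, ∀ m, ‖T u τ m ε - T v τ m ε‖ ≤ D / 2 * (decay β μ m * Φ τ) :=
    fun {u v _ _ _} hu hv hD ε hε hd => h.contract subset_rfl h.dom.dilV hε hD
      (v₁ := fun τ m => u τ m ε) (v₂ := fun τ m => v τ m ε)
      (fun τ hτ => continuous_slice (v := fun τ m => u τ m ε) (hu.cont ε hε) hτ)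
      (fun τ hτ => continuous_slice (v := fun τ m => v τ m ε) (hv.cont ε hε) hτ)
      (hu.bound ε hε) (hv.bound ε hε) hd
  -- the geometric series with first term `B` and ratio `1/2` sums to `2 * B`
  have hstep : ∀ k, ∀ ε ∈ ball (0 : ℂ) ε₀, ∀ τ ∈ V, ∀ m,
      ‖S (k + 1) τ m ε - S k τ m ε‖ ≤ B / 2 ^ k * (decay β μ m * Φ τ) := by
    intro k
    induction k with
    | zero =>
      intro ε hε τ hτ m
      have h0 : S 1 τ m ε - S 0 τ m ε = g τ m ε := by
        simp [S, T, dilConvOp, conv]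
      rw [zero_add, h0]; simpa using hg.bound ε hε τ hτ m
    | succ k ih =>
      intro ε hε τ hτ m
      have := hT (hSF (k + 1)) (hSF k) (by positivity) ε hε (ih ε hε) τ hτ m
      rw [hSs (k + 1), hSs k]
      simp only [add_sub_add_left_eq_sub]
      rw [← hSs k, pow_succ, ← div_div]
      exact this
  have hcauchy : ∀ ε ∈ ball (0 : ℂ) ε₀, ∀ τ ∈ V, ∀ m, ∀ k,
      dist (S k τ m ε) (S (k + 1) τ m ε) ≤ (2 * B * (decay β μ m * Φ τ)) / 2 / 2 ^ k := by
    intro ε hε τ hτ m k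
    rw [dist_comm, dist_eq_norm]
    exact (hstep k ε hε τ hτ m).trans (le_of_eq (by ring))
  let w : ℂ → ℝ → ℂ → ℂ := fun τ m ε => limUnder atTop fun k => S k τ m ε
  have hlim : ∀ ε ∈ ball (0 : ℂ) ε₀, ∀ τ ∈ V, ∀ m,
      Tendsto (fun k => S k τ m ε) atTop (𝓝 (w τ m ε)) := fun ε hε τ hτ m =>
    (cauchySeq_of_le_geometric_two (hcauchy ε hε τ hτ m)).tendsto_limUnder
  have htail : ∀ k, ∀ ε ∈ ball (0 : ℂ) ε₀, ∀ τ ∈ V, ∀ m,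
      ‖S k τ m ε - w τ m ε‖ ≤ 2 * B / 2 ^ k * (decay β μ m * Φ τ) := by
    intro k ε hε τ hτ m
    rw [← dist_eq_norm]
    exact (dist_le_of_le_geometric_two_of_tendsto (hcauchy ε hε τ hτ m)
      (hlim ε hε τ hτ m) k).trans (le_of_eq (by ring))
  have hδ : Tendsto (fun k : ℕ => 2 * B / 2 ^ k) atTop (𝓝 0) := by
    have := (tendsto_pow_atTop_nhds_zero_of_lt_one (r := (1 / 2 : ℝ)) (by norm_num)
      (by norm_num)).const_mul (2 * B)
    simpa [div_eq_mul_inv] using this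
  have hδ0 : ∀ k : ℕ, 0 ≤ 2 * B / 2 ^ k := fun k => by positivity
  have hw : InFamily V O Φ β μ ε₀ (2 * B) w := by
    refine ⟨fun ε hε => ?_, fun ε hε m => ?_, fun τ hτ m => ?_, fun ε hε τ hτ m => ?_⟩
    · refine (tendstoLocallyUniformlyOn_of_norm_le (F := fun k (p : ℂ × ℝ) => S k p.1 p.2 ε)
        (b := fun p => decay β μ p.2 * Φ p.1) ?_ hδ hδ0 fun k p hp =>
          htail k ε hε p.1 hp.1 p.2).continuousOn (Frequently.of_forall fun k => (hSF k).cont ε hε)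
      exact ((continuous_decay β μ).comp continuous_snd).continuousOn.mul
        (h.dom.cont.comp continuousOn_fst fun p hp => hp.1)
    · refine (tendstoLocallyUniformlyOn_of_norm_le (F := fun k τ => S k τ m ε)
        (b := fun τ => decay β μ m * Φ τ) ?_ hδ hδ0 fun k τ hτ =>
          htail k ε hε τ (h.dom.subset hτ) m).differentiableOn
            (Eventually.of_forall fun k => (hSF k).holτ ε hε m) h.dom.isOpen
      exact continuousOn_const.mul (h.dom.cont.mono h.dom.subset)
    · exact (tendstoLocallyUniformlyOn_of_norm_le (F := fun k ε => S k τ m ε)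
        (b := fun _ => decay β μ m * Φ τ) continuousOn_const hδ hδ0 fun k ε hε =>
          htail k ε hε τ hτ m).differentiableOn
            (Eventually.of_forall fun k => (hSF k).holε τ hτ m) isOpen_ball
    · simpa [S] using htail 0 ε hε τ hτ m
  refine ⟨w, hw, fun ε hε τ hτ m => ?_⟩
  refine tendsto_nhds_unique ((hlim ε hε τ hτ m).comp (tendsto_add_atTop_nat 1)) ?_
  refine tendsto_iff_norm_sub_tendsto_zero.2 (squeeze_zero (fun _ => norm_nonneg _) (fun k => ?_)
    (g := fun k => 2 * B / 2 ^ k / 2 * (decay β μ m * Φ τ)) ?_)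
  · have := hT (hSF k) hw (hδ0 k) ε hε (htail k ε hε) τ hτ m
    simpa only [Function.comp_apply, hSs, add_sub_add_left_eq_sub] using this
  · simpa using (hδ.div_const 2).mul_const (decay β μ m * Φ τ)

/-- Uniqueness of the bounded solution, on any subset that is stable under the dilations. -/
theorem unique (h : ContractionData V O Φ β μ ε₀ ζ N s a c₀ b c P n C A M E)
    {V' : Set ℂ} (hV' : V' ⊆ V) (hdil : ∀ c : ℝ, 0 < c → c ≤ 1 → ∀ τ ∈ V', (c : ℂ) * τ ∈ V')
    {ε : ℂ} (hε : ε ∈ ball (0 : ℂ) ε₀) {B₁ B₂ : ℝ} {v₁ v₂ g : ℂ → ℝ → ℂ}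
    (c₁ : ∀ τ ∈ V', Continuous (v₁ τ)) (c₂ : ∀ τ ∈ V', Continuous (v₂ τ))
    (b₁ : ∀ τ ∈ V', ∀ m, ‖v₁ τ m‖ ≤ B₁ * (decay β μ m * Φ τ))
    (b₂ : ∀ τ ∈ V', ∀ m, ‖v₂ τ m‖ ≤ B₂ * (decay β μ m * Φ τ))
    (e₁ : ∀ τ ∈ V', ∀ m, v₁ τ m = g τ m +
      dilConvOp s a c₀ b c P (fun i => ε ^ n i) (fun i m => C i m ε) v₁ τ m)
    (e₂ : ∀ τ ∈ V', ∀ m, v₂ τ m = g τ m +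
      dilConvOp s a c₀ b c P (fun i => ε ^ n i) (fun i m => C i m ε) v₂ τ m) :
    ∀ τ ∈ V', ∀ m, v₁ τ m = v₂ τ m := by
  have key : ∀ k : ℕ, ∀ τ ∈ V', ∀ m,
      ‖v₁ τ m - v₂ τ m‖ ≤ (|B₁| + |B₂|) / 2 ^ k * (decay β μ m * Φ τ) := by
    intro k
    induction k with
    | zero =>
      intro τ hτ m
      have := decay_pos β μ m
      have := h.dom.pos τ (hV' hτ)
      rw [pow_zero, div_one, add_mul]
      refine (norm_sub_le _ _).trans (add_le_add ((b₁ τ hτ m).trans ?_) ((b₂ τ hτ m).trans ?_)) <;>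
      · gcongr; exact le_abs_self _
    | succ k ih =>
      intro τ hτ m
      have := h.contract hV' hdil hε (by positivity) c₁ c₂ b₁ b₂ ih τ hτ m
      rw [e₁ τ hτ m, e₂ τ hτ m, add_sub_add_left_eq_sub, pow_succ, ← div_div]
      exact this
  intro τ hτ m
  rw [← sub_eq_zero, ← norm_le_zero_iff]
  refine ge_of_tendsto' (x := atTop) (f := fun k : ℕ =>
    (|B₁| + |B₂|) / 2 ^ k * (decay β μ m * Φ τ)) ?_ fun k => key k τ hτ m
  have := (tendsto_pow_atTop_nhds_zero_of_lt_one (r := (1 / 2 : ℝ)) (by norm_num)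
    (by norm_num)).const_mul (|B₁| + |B₂|)
  simpa [div_eq_mul_inv] using this.mul_const (decay β μ m * Φ τ)

end ContractionData

end

/-! ### Sectors and the slit plane -/

section

open Filter Topology MeasureTheory Metric

/-- The rotated slit plane: the complement of the closed half-line opposite to the direction
`d`. -/
def slit (d : ℝ) : Set ℂ :=
  {T | T * Complex.exp (-(d * Complex.I)) ∈ Complex.slitPlane}

lemma isOpen_slit (d : ℝ) : IsOpen (slit d) :=
  Complex.isOpen_slitPlane.preimage (by fun_prop)

lemma slit_ne_zero {d : ℝ} {T : ℂ} (h : T ∈ slit d) : T ≠ 0 := by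
  rintro rfl
  exact Complex.slitPlane_ne_zero h (zero_mul _)

lemma exp_mul_exp_neg (d : ℝ) :
    Complex.exp (d * Complex.I) * Complex.exp (-(d * Complex.I)) = 1 := by
  rw [← Complex.exp_add, add_neg_cancel, Complex.exp_zero]

lemma norm_exp_I (d : ℝ) : ‖Complex.exp (d * Complex.I)‖ = 1 := Complex.norm_exp_ofReal_mul_I d

lemma norm_exp_neg_I (d : ℝ) : ‖Complex.exp (-(d * Complex.I))‖ = 1 := by
  simpa using Complex.norm_exp_ofReal_mul_I (-d)

lemma isOpen_sector (d θ : ℝ) : IsOpen (sector d θ) := by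
  rcases le_or_gt θ Real.pi with h | h
  · have : sector d θ = (fun T : ℂ => T * Complex.exp (-(d * Complex.I))) ⁻¹'
        (Complex.slitPlane ∩ (fun z => |Complex.arg z|) ⁻¹' Set.Iio θ) := by
      ext T
      simp only [sector, Set.mem_preimage, Set.mem_inter_iff, Set.mem_Iio, Set.mem_ofPred_eq,
        Complex.mem_slitPlane_iff_arg, ne_eq, mul_eq_zero, Complex.exp_ne_zero, or_false]
      refine ⟨fun hT => ⟨⟨fun ha => ?_, hT.1⟩, hT.2⟩, fun hT => ⟨hT.1.2, hT.2⟩⟩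
      have := hT.2
      rw [ha, abs_of_pos Real.pi_pos] at this
      linarith
    rw [this]
    refine IsOpen.preimage (by fun_prop) ?_
    refine ContinuousOn.isOpen_inter_preimage (fun z hz => ?_) Complex.isOpen_slitPlane isOpen_Iio
    exact (Complex.continuousAt_arg hz).abs.continuousWithinAt
  · have : sector d θ = {0}ᶜ := by
      ext T
      simp only [sector, Set.mem_ofPred_eq, Set.mem_compl_iff, Set.mem_singleton_iff, ne_eq,
        and_iff_left_iff_imp]
      exact fun _ => (Complex.abs_arg_le_pi _).trans_lt h
    rw [this]; exact isOpen_compl_singleton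

lemma isOpen_finiteSector (d θ r : ℝ) : IsOpen (finiteSector d θ r) :=
  (isOpen_sector d θ).inter isOpen_ball

lemma ray_mem_sector {d θ r : ℝ} (hθ : 0 < θ) (hr : 0 < r) :
    (r : ℂ) * Complex.exp (d * Complex.I) ∈ sector d θ := by
  refine ⟨mul_ne_zero (by exact_mod_cast hr.ne') (Complex.exp_ne_zero _), ?_⟩
  rw [mul_assoc, exp_mul_exp_neg, mul_one, Complex.arg_ofReal_of_nonneg hr.le, abs_zero]
  exact hθ

lemma mul_mem_sector {d θ c : ℝ} (hc : 0 < c) {T : ℂ} (hT : T ∈ sector d θ) :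
    (c : ℂ) * T ∈ sector d θ := by
  refine ⟨mul_ne_zero (by exact_mod_cast hc.ne') hT.1, ?_⟩
  rw [mul_assoc, Complex.arg_real_mul _ hc]
  exact hT.2

lemma mul_mem_ball {r c : ℝ} (hc : 0 < c) (hc1 : c ≤ 1) {T : ℂ} (hT : T ∈ ball (0 : ℂ) r) :
    (c : ℂ) * T ∈ ball (0 : ℂ) r := by
  rw [mem_ball_zero_iff] at *
  rw [norm_mul, Complex.norm_real, Real.norm_eq_abs, abs_of_pos hc]
  have := norm_nonneg T
  nlinarith

lemma mul_mem_finiteSector {d θ r c : ℝ} (hc : 0 < c) (hc1 : c ≤ 1) {T : ℂ}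
    (hT : T ∈ finiteSector d θ r) : (c : ℂ) * T ∈ finiteSector d θ r :=
  ⟨mul_mem_sector hc hT.1, mul_mem_ball hc hc1 hT.2⟩

lemma mul_mem_closedFiniteSector {d θ r c : ℝ} (hc : 0 < c) (hc1 : c ≤ 1) {T : ℂ}
    (hT : T ∈ closedFiniteSector d θ r) : (c : ℂ) * T ∈ closedFiniteSector d θ r := by
  refine ⟨map_mem_closure (by fun_prop : Continuous fun T : ℂ => (c : ℂ) * T) hT.1
    fun T hT => mul_mem_finiteSector hc hc1 hT, ?_⟩
  exact mul_ne_zero (by exact_mod_cast hc.ne') hT.2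

lemma mul_mem_slit {d c : ℝ} (hc : 0 < c) {T : ℂ} (hT : T ∈ slit d) : (c : ℂ) * T ∈ slit d := by
  unfold slit at *
  simp only [Set.mem_ofPred_eq, mul_assoc, Complex.mem_slitPlane_iff_arg] at *
  rw [Complex.arg_real_mul _ hc]
  exact ⟨hT.1, mul_ne_zero (by exact_mod_cast hc.ne') hT.2⟩

/-- If `T` lies on the half-line opposite to the direction `d`, then `1 + e^{id} r / T` vanishes for
`r = |T|`. -/
lemma lapDomain_subset_slit {d δt : ℝ} (hδ : 0 < δt) : lapDomain d δt ⊆ slit d := by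
  intro T hT
  set z := T * Complex.exp (-(d * Complex.I)) with hz
  have hTz : T = z * Complex.exp (d * Complex.I) := by
    rw [hz, mul_assoc, mul_comm (Complex.exp _), exp_mul_exp_neg, mul_one]
  have hz0 : z ≠ 0 := mul_ne_zero hT.1 (Complex.exp_ne_zero _)
  rw [slit, Set.mem_ofPred_eq, ← hz, Complex.mem_slitPlane_iff_arg]
  refine ⟨fun ha => ?_, hz0⟩
  obtain ⟨h1, h2⟩ := Complex.arg_eq_pi_iff.1 ha
  obtain ⟨t, ht⟩ : ∃ t : ℝ, t = -z.re := ⟨_, rfl⟩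
  have hzr : z = -(t : ℂ) := by apply Complex.ext <;> simp [h2, ht]
  have := hT.2 t (by linarith)
  have hzero : 1 + Complex.exp (d * Complex.I) * (t : ℂ) / T = 0 := by
    have hne : (t : ℂ) ≠ 0 := by exact_mod_cast (by linarith : t ≠ 0)
    have he := Complex.exp_ne_zero (d * Complex.I)
    rw [hTz, hzr]
    field_simp
    ring
  rw [hzero, norm_zero] at this
  linarith

/-- The distance of a point of a sector of half-opening less than `π` to the half-line opposite to
the bisecting direction is comparable to its modulus. -/
lemma sector_norm_sq_le {d θ : ℝ} (hθ' : θ < Real.pi) {T : ℂ}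
    (hT : T ∈ closure (sector d θ)) {r : ℝ} (hr : 0 ≤ r) :
    (1 - |Real.cos θ|) * ‖T‖ ^ 2 ≤ ‖T + r * Complex.exp (d * Complex.I)‖ ^ 2 := by
  have hcl : IsClosed {T : ℂ | (1 - |Real.cos θ|) * ‖T‖ ^ 2 ≤
      ‖T + r * Complex.exp (d * Complex.I)‖ ^ 2} :=
    isClosed_le (by fun_prop) (by fun_prop)
  refine closure_minimal (fun T hT => ?_) hcl hT
  set z := T * Complex.exp (-(d * Complex.I)) with hz
  have hz0 : z ≠ 0 := mul_ne_zero hT.1 (Complex.exp_ne_zero _)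
  have hn1 : ‖T‖ = ‖z‖ := by rw [hz, norm_mul, norm_exp_neg_I, mul_one]
  have hn2 : ‖T + r * Complex.exp (d * Complex.I)‖ = ‖z + r‖ := by
    rw [← mul_one ‖T + _‖, ← norm_exp_neg_I d, ← norm_mul, add_mul, mul_assoc, exp_mul_exp_neg,
      mul_one]
  rw [Set.mem_ofPred_eq, hn1, hn2]
  have hcos : Real.cos θ ≤ Real.cos (Complex.arg z) := by
    rw [← Real.cos_abs (Complex.arg z)]
    exact Real.cos_le_cos_of_nonneg_of_le_pi (abs_nonneg _) hθ'.le hT.2.le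
  rw [Complex.cos_arg hz0, le_div_iff₀ (norm_pos_iff.2 hz0)] at hcos
  have hsq : ‖z + r‖ ^ 2 = ‖z‖ ^ 2 + 2 * r * z.re + r ^ 2 := by
    rw [Complex.sq_norm, Complex.sq_norm, Complex.normSq_apply, Complex.normSq_apply]
    simp; ring
  have hc1 : |Real.cos θ| ≤ 1 := Real.abs_cos_le_one θ
  have hc2 : -|Real.cos θ| ≤ Real.cos θ := neg_abs_le _
  have hn := norm_nonneg z
  rw [hsq]
  have h1 : r * (-|Real.cos θ| * ‖z‖) ≤ r * z.re := by
    refine mul_le_mul_of_nonneg_left ?_ hr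
    nlinarith
  have h0 := abs_nonneg (Real.cos θ)
  nlinarith [mul_nonneg h0 (sq_nonneg (‖z‖ - r)), sq_nonneg r]

lemma closure_sector_subset_lapDomain {d θ : ℝ} (hθ : 0 < θ) (hθ' : θ < Real.pi) :
    ∃ c : ℝ, 0 < c ∧ closure (sector d θ) \ {0} ⊆ lapDomain d c := by
  have hpos : 0 < 1 - |Real.cos θ| := by
    have h1 : Real.cos θ < 1 := by
      have := Real.cos_lt_cos_of_nonneg_of_le_pi le_rfl hθ'.le hθ; rwa [Real.cos_zero] at this
    have h2 : -1 < Real.cos θ := by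
      have := Real.cos_lt_cos_of_nonneg_of_le_pi hθ.le le_rfl hθ'; rwa [Real.cos_pi] at this
    have := abs_lt.2 ⟨h2, h1⟩
    linarith
  refine ⟨Real.sqrt (1 - |Real.cos θ|) / 2, by positivity, fun T hT => ⟨hT.2, fun r hr => ?_⟩⟩
  have hT0 : T ≠ 0 := hT.2
  have hTn : 0 < ‖T‖ := norm_pos_iff.2 hT0
  have h := sector_norm_sq_le hθ' hT.1 hr
  have h2 : Real.sqrt (1 - |Real.cos θ|) * ‖T‖ ≤ ‖T + r * Complex.exp (d * Complex.I)‖ := by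
    refine (sq_le_sq₀ (by positivity) (norm_nonneg _)).1 ?_
    rw [mul_pow, Real.sq_sqrt hpos.le]; exact h
  have h3 : 1 + Complex.exp (d * Complex.I) * r / T =
      (T + r * Complex.exp (d * Complex.I)) / T := by field_simp
  rw [h3, norm_div, lt_div_iff₀ hTn]
  have : 0 < Real.sqrt (1 - |Real.cos θ|) * ‖T‖ := by positivity
  linarith

lemma sector_subset_lapDomain {d θ : ℝ} (hθ : 0 < θ) (hθ' : θ < Real.pi) :
    ∃ c : ℝ, 0 < c ∧ sector d θ ⊆ lapDomain d c := by
  obtain ⟨c, hc, h⟩ := closure_sector_subset_lapDomain (d := d) hθ hθ'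
  exact ⟨c, hc, fun T hT => h ⟨subset_closure hT, hT.1⟩⟩

/-- Every point of the slit plane has a neighbourhood contained in one of the domains
`lapDomain d c`. -/
lemma exists_lapDomain_nhds {d : ℝ} {T : ℂ} (hT : T ∈ slit d) :
    ∃ c : ℝ, 0 < c ∧ lapDomain d c ∈ 𝓝 T := by
  set z := T * Complex.exp (-(d * Complex.I)) with hz
  have hz' : Complex.arg z ≠ Real.pi := (Complex.mem_slitPlane_iff_arg.1 hT).1
  have ha : |Complex.arg z| < Real.pi :=
    abs_lt.2 ⟨Complex.neg_pi_lt_arg z, lt_of_le_of_ne (Complex.arg_le_pi z) hz'⟩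
  have h0 := abs_nonneg (Complex.arg z)
  obtain ⟨c, hc, h⟩ := sector_subset_lapDomain (d := d) (θ := (|Complex.arg z| + Real.pi) / 2)
    (by linarith) (by linarith)
  refine ⟨c, hc, mem_of_superset ((isOpen_sector d _).mem_nhds ⟨slit_ne_zero hT, ?_⟩) h⟩
  rw [← hz]; linarith

/-- For `δt < 1` the domain `lapDomain d δt` contains every thin sector around the direction
`d`. -/
lemma sector_subset_lapDomain_of_lt_one {d θ δt : ℝ} (hθ : θ ≤ Real.pi / 2) (hδ : δt < 1) :
    sector d θ ⊆ lapDomain d δt := by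
  intro T hT
  refine ⟨hT.1, fun r hr => ?_⟩
  have hT0 := hT.1
  set z := T * Complex.exp (-(d * Complex.I)) with hz
  have hz0 : z ≠ 0 := mul_ne_zero hT.1 (Complex.exp_ne_zero _)
  have hre : 0 ≤ z.re := Complex.abs_arg_le_pi_div_two_iff.1 (hT.2.le.trans hθ)
  have hdiv : Complex.exp (d * Complex.I) * r / T = r / z := by
    have := exp_mul_exp_neg d
    have h2 := Complex.exp_ne_zero (-(d * Complex.I))
    rw [hz]; field_simp
    linear_combination r * this
  have hre2 : 0 ≤ ((r : ℂ) / z).re := by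
    rw [Complex.div_re]
    have := Complex.normSq_nonneg z
    simp; positivity
  rw [hdiv]
  calc δt < 1 := hδ
    _ ≤ (1 + (r : ℂ) / z).re := by rw [Complex.add_re, Complex.one_re]; linarith
    _ ≤ _ := Complex.re_le_norm _

end

/-! ### The `q`-Laplace transform -/

section

open Filter Topology MeasureTheory Metric

/-- The majorant, up to a constant, of `1 / (|Θ(u / T)| r)` on the ray `|u| = r`, for
`|T| = t`. -/
def lapKer (q k t r : ℝ) : ℝ := (growth q k (1 / 2) (r / t))⁻¹ / r

lemma lapKer_nonneg (q k t : ℝ) {r : ℝ} (hr : 0 < r) : 0 ≤ lapKer q k t r := by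
  have := growth_pos q k (1 / 2) (r / t)
  unfold lapKer; positivity

lemma lapKer_eq {q k t r : ℝ} (ht : 0 < t) (hr : 0 < r) :
    lapKer q k t r = Real.exp (-(k / (2 * Real.log q) * (Real.log r - Real.log t) ^ 2) -
      (Real.log r - Real.log t) / 2) / r := by
  rw [lapKer, growth, Real.log_div hr.ne' ht.ne', ← Real.exp_neg]
  congr 2; ring

lemma exp_image_univ : Real.exp '' Set.univ = Set.Ioi 0 := by
  rw [Set.image_univ, Real.range_exp]

lemma integrableOn_comp_log_div {h : ℝ → ℝ} (hh : Integrable h) :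
    IntegrableOn (fun r => h (Real.log r) / r) (Set.Ioi 0) := by
  rw [← exp_image_univ, integrableOn_image_iff_integrableOn_abs_deriv_smul MeasurableSet.univ
    (fun x _ => (Real.hasDerivAt_exp x).hasDerivWithinAt) Real.exp_injective.injOn]
  have : (fun x => |Real.exp x| • (h (Real.log (Real.exp x)) / Real.exp x)) = h := by
    ext x
    rw [Real.abs_exp, Real.log_exp, smul_eq_mul, mul_div_cancel₀ _ (Real.exp_pos x).ne']
  rw [this]
  exact hh.integrableOn

lemma integral_comp_log_div (h : ℝ → ℝ) :
    ∫ r in Set.Ioi (0 : ℝ), h (Real.log r) / r = ∫ x, h x := by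
  rw [← exp_image_univ, integral_image_eq_integral_abs_deriv_smul MeasurableSet.univ
    (fun x _ => (Real.hasDerivAt_exp x).hasDerivWithinAt) Real.exp_injective.injOn]
  have : (fun x => |Real.exp x| • (h (Real.log (Real.exp x)) / Real.exp x)) = h := by
    ext x
    rw [Real.abs_exp, Real.log_exp, smul_eq_mul, mul_div_cancel₀ _ (Real.exp_pos x).ne']
  rw [this, setIntegral_univ]

lemma integrable_gaussian_shift {b : ℝ} (hb : 0 < b) (x₀ : ℝ) :
    Integrable fun x : ℝ => Real.exp (-b * (x - x₀) ^ 2) :=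
  (integrable_exp_neg_mul_sq hb).comp_sub_right x₀

lemma integral_gaussian_shift (b x₀ : ℝ) :
    ∫ x : ℝ, Real.exp (-b * (x - x₀) ^ 2) = Real.sqrt (Real.pi / b) := by
  rw [integral_sub_right_eq_self (fun x : ℝ => Real.exp (-b * x ^ 2)) x₀, integral_gaussian]

/-- The Gaussian integral behind the acceleration: the growth of order `k` becomes, after the
`q`-Laplace transform of order `κ`, growth of order `k κ / (κ - k)`. -/
lemma growth_mul_lapKer {q k κ α : ℝ} (hq : 1 < q) (hkκ : k < κ) :
    ∃ C : ℝ, 0 < C ∧ ∀ t : ℝ, 0 < t →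
      IntegrableOn (fun r => growth q k α r * lapKer q κ t r) (Set.Ioi 0) ∧
      ∫ r in Set.Ioi (0 : ℝ), growth q k α r * lapKer q κ t r =
        C * growth q (k * κ / (κ - k)) (κ * (α - 1 / 2) / (κ - k) + 1 / 2) t := by
  have hlq := Real.log_pos hq
  have hd : 0 < κ - k := by linarith
  set b := (κ - k) / (2 * Real.log q) with hb
  have hb0 : 0 < b := by positivity
  refine ⟨Real.exp ((α - 1 / 2) ^ 2 * Real.log q / (2 * (κ - k))) * Real.sqrt (Real.pi / b),
    by positivity, fun t ht => ?_⟩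
  set y := Real.log t with hy
  -- in the variable `log r` the integrand is a Gaussian; `x₀` is its centre
  set x₀ := (κ * y + (α - 1 / 2) * Real.log q) / (κ - k) with hx₀
  set D := Real.exp ((α - 1 / 2) ^ 2 * Real.log q / (2 * (κ - k))) *
    growth q (k * κ / (κ - k)) (κ * (α - 1 / 2) / (κ - k) + 1 / 2) t with hD
  let h : ℝ → ℝ := fun x => D * Real.exp (-b * (x - x₀) ^ 2)
  have hEq : Set.EqOn (fun r => growth q k α r * lapKer q κ t r)
      (fun r => h (Real.log r) / r) (Set.Ioi 0) := by
    intro r hr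
    have hr0 : 0 < r := hr
    simp only [h, hD]
    rw [lapKer_eq ht hr0, growth, growth, ← mul_div_assoc, ← Real.exp_add, ← Real.exp_add,
      ← Real.exp_add]
    congr 2
    rw [hx₀, hb, ← hy]
    field_simp
    ring
  have hInt : Integrable h := (integrable_gaussian_shift hb0 x₀).const_mul D
  refine ⟨(integrableOn_congr_fun hEq measurableSet_Ioi).2 (integrableOn_comp_log_div hInt), ?_⟩
  rw [setIntegral_congr_fun measurableSet_Ioi hEq, integral_comp_log_div h]
  simp only [h]
  rw [integral_const_mul, integral_gaussian_shift, hD]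
  ring

/-- The total mass of the model kernel does not depend on `t`: this is the case `k = 0` of
`growth_mul_lapKer`. -/
lemma lapKer_integral {q κ : ℝ} (hq : 1 < q) (hκ : 0 < κ) :
    ∃ C : ℝ, 0 < C ∧ ∀ t : ℝ, 0 < t →
      IntegrableOn (lapKer q κ t) (Set.Ioi 0) ∧ ∫ r in Set.Ioi (0 : ℝ), lapKer q κ t r = C := by
  obtain ⟨C, hC, h⟩ := growth_mul_lapKer (α := 0) hq hκ
  refine ⟨C, hC, fun t ht => ?_⟩
  obtain ⟨h1, h2⟩ := h t ht
  have e : ∀ r, growth q 0 0 r = 1 := fun r => by simp [growth]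
  have e2 : growth q (0 * κ / (κ - 0)) (κ * (0 - 1 / 2) / (κ - 0) + 1 / 2) t = 1 := by
    rw [growth]; simp; left; field_simp; norm_num
  simp only [e, one_mul] at h1 h2
  rw [e2, mul_one] at h2
  exact ⟨h1, h2⟩

lemma integrable_exp_neg_mul_abs {η : ℝ} (hη : 0 < η) :
    Integrable fun x : ℝ => Real.exp (-(η * |x|)) := by
  set l := min 1 (η / 2) with hl
  have hl0 : 0 < l := by positivity
  refine ((integrable_one_add_abs_rpow (s := 2) (by norm_num)).const_mul (l ^ 2)⁻¹).mono'
    (by fun_prop : Continuous _).aestronglyMeasurable (Eventually.of_forall fun x => ?_)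
  have hx := abs_nonneg x
  have h1 : l * (1 + |x|) ≤ Real.exp (η / 2 * |x|) := by
    have e1 := Real.add_one_le_exp (η / 2 * |x|)
    have e2 : l * |x| ≤ η / 2 * |x| := by gcongr; exact min_le_right _ _
    have e3 : l ≤ 1 := min_le_left _ _
    linarith
  have h2 : l ^ 2 * (1 + |x|) ^ 2 ≤ Real.exp (η * |x|) := by
    calc _ = (l * (1 + |x|)) ^ 2 := by ring
      _ ≤ Real.exp (η / 2 * |x|) ^ 2 := by gcongr
      _ = _ := by rw [← Real.exp_nat_mul]; congr 1; push_cast; ring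
  rw [Real.norm_eq_abs, Real.abs_exp, Real.exp_neg, Real.rpow_neg (by positivity), ← mul_inv]
  refine inv_anti₀ (by positivity) ?_
  exact_mod_cast h2

/-- If `Φ` is bounded near `0` and has growth of order `κ`, equal to the order of the transform,
then its transform is bounded on the disc of radius `q^{(1/2-α)/κ} / 2`. -/
lemma integral_mul_lapKer_le {q κ α K : ℝ} (hq : 1 < q) (hκ : 0 < κ) (hK : 0 ≤ K) {Φ : ℝ → ℝ}
    (hm : AEStronglyMeasurable Φ (volume.restrict (Set.Ioi 0)))
    (h0 : ∀ r, 0 < r → 0 ≤ Φ r) (h1 : ∀ r, 0 < r → r ≤ 1 → Φ r ≤ K)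
    (h2 : ∀ r, 0 < r → Φ r ≤ K * growth q κ α r) :
    ∃ C : ℝ, 0 < C ∧ ∀ t : ℝ, 0 < t → t ≤ q ^ ((1 / 2 - α) / κ) / 2 →
      IntegrableOn (fun r => Φ r * lapKer q κ t r) (Set.Ioi 0) ∧
      ∫ r in Set.Ioi (0 : ℝ), Φ r * lapKer q κ t r ≤ C := by
  have hq0 : 0 < q := by linarith
  have hlq := Real.log_pos hq
  obtain ⟨C₁, hC₁, hker⟩ := lapKer_integral hq hκ
  -- the factor `1/2` in the radius leaves the decay `r ^ (-η)` at infinity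
  set η := κ * Real.log 2 / Real.log q with hη
  have hη0 : 0 < η := by have := Real.log_pos one_lt_two; positivity
  have hexp := integrable_exp_neg_mul_abs hη0
  set C₂ := Real.exp (Real.log q / (8 * κ)) with hC₂
  set I := ∫ x : ℝ, Real.exp (-(η * |x|)) with hI
  have hI0 : 0 ≤ I := integral_nonneg fun x => (Real.exp_pos _).le
  refine ⟨K * (C₁ + C₂ * I) + 1, by positivity, fun t ht htR => ?_⟩
  obtain ⟨hk1, hk2⟩ := hker t ht
  set y := Real.log t with hy
  have hyle : 2 * (κ / (2 * Real.log q)) * y ≤ 1 / 2 - α - η := by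
    have := Real.log_le_log ht htR
    rw [Real.log_div (by positivity) (by norm_num), Real.log_rpow hq0, ← hy] at this
    calc 2 * (κ / (2 * Real.log q)) * y ≤
        2 * (κ / (2 * Real.log q)) * ((1 / 2 - α) / κ * Real.log q - Real.log 2) := by gcongr
      _ = _ := by rw [hη]; field_simp
  have hle : ∀ r ∈ Set.Ioi (0 : ℝ), Φ r * lapKer q κ t r ≤
      K * (lapKer q κ t r + C₂ * (Real.exp (-(η * |Real.log r|)) / r)) := by
    intro r hr
    have hr0 : 0 < r := hr
    have hkn := lapKer_nonneg q κ t hr0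
    rcases le_total r 1 with hr1 | hr1
    · calc _ ≤ K * lapKer q κ t r := by gcongr; exact h1 r hr0 hr1
        _ ≤ _ := by
          gcongr
          have : 0 ≤ C₂ * (Real.exp (-(η * |Real.log r|)) / r) := by positivity
          linarith
    · have hx : 0 ≤ Real.log r := Real.log_nonneg hr1
      have hg : growth q κ α r * lapKer q κ t r ≤ C₂ * (Real.exp (-(η * |Real.log r|)) / r) := by
        rw [lapKer_eq ht hr0, growth, ← mul_div_assoc, ← mul_div_assoc, ← Real.exp_add, hC₂,
          ← Real.exp_add, abs_of_nonneg hx, ← hy]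
        refine div_le_div_of_nonneg_right (Real.exp_le_exp.2 ?_) hr0.le
        have e1 := mul_le_mul_of_nonneg_left hyle hx
        have e2 : -(κ / (2 * Real.log q) * y ^ 2) + y / 2 ≤ Real.log q / (8 * κ) := by
          have : Real.log q / (8 * κ) + κ / (2 * Real.log q) * y ^ 2 - y / 2 =
              (Real.log q - 2 * κ * y) ^ 2 / (8 * κ * Real.log q) := by field_simp; ring
          have : 0 ≤ (Real.log q - 2 * κ * y) ^ 2 / (8 * κ * Real.log q) := by positivity
          linarith
        have e3 : κ * Real.log r ^ 2 / (2 * Real.log q) =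
          κ / (2 * Real.log q) * Real.log r ^ 2 := by ring
        rw [e3]
        nlinarith
      calc _ ≤ K * growth q κ α r * lapKer q κ t r := by gcongr; exact h2 r hr0
        _ = K * (growth q κ α r * lapKer q κ t r) := by ring
        _ ≤ _ := by gcongr; linarith
  have hi2 := integrableOn_comp_log_div hexp
  have hbi : IntegrableOn (fun r => K * (lapKer q κ t r +
      C₂ * (Real.exp (-(η * |Real.log r|)) / r))) (Set.Ioi 0) :=
    (hk1.add (hi2.const_mul C₂)).const_mul K
  have hint : IntegrableOn (fun r => Φ r * lapKer q κ t r) (Set.Ioi 0) := by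
    refine Integrable.mono' hbi (hm.mul hk1.aestronglyMeasurable)
      ((ae_restrict_iff' measurableSet_Ioi).2 (Eventually.of_forall fun r hr => ?_))
    rw [Real.norm_eq_abs, abs_of_nonneg (mul_nonneg (h0 r hr) (lapKer_nonneg q κ t hr))]
    exact hle r hr
  refine ⟨hint, (setIntegral_mono_on hint hbi measurableSet_Ioi hle).trans ?_⟩
  rw [integral_const_mul, integral_add hk1 (hi2.const_mul C₂), integral_const_mul, hk2,
    integral_comp_log_div fun x => Real.exp (-(η * |x|))]
  linarith

/-- Domination of the kernel locally uniformly in `t`: in `log r · log t` the value of `log t` may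
be replaced by that at one of the two end points, depending on the sign of `log r`. -/
lemma lapKer_le_add {q κ t₁ t₂ : ℝ} (hq : 1 < q) (hκ : 0 < κ) (ht₁ : 0 < t₁) :
    ∃ C : ℝ, 0 < C ∧ ∀ t r : ℝ, t₁ ≤ t → t ≤ t₂ → 0 < r →
      lapKer q κ t r ≤ C * (lapKer q κ t₁ r + lapKer q κ t₂ r) := by
  have hlq := Real.log_pos hq
  set a := κ / (2 * Real.log q) with ha
  have ha0 : 0 < a := by positivity
  set y₁ := Real.log t₁ with hy₁
  set y₂ := Real.log t₂ with hy₂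
  refine ⟨Real.exp (a * y₁ ^ 2 + a * y₂ ^ 2 + |y₁| + |y₂|), Real.exp_pos _,
    fun t r h1 h2 hr => ?_⟩
  have ht : 0 < t := ht₁.trans_le h1
  have ht₂ : 0 < t₂ := ht.trans_le h2
  rw [lapKer_eq ht hr, lapKer_eq ht₁ hr, lapKer_eq ht₂ hr, ← add_div, ← mul_div_assoc]
  have hl1 := Real.log_le_log ht₁ h1
  have hl2 := Real.log_le_log ht h2
  set y := Real.log t with hy
  set x := Real.log r
  gcongr
  have n1 := neg_abs_le y₁
  have n2 := neg_abs_le y₂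
  have n3 := le_abs_self y₁
  have n4 := le_abs_self y₂
  have n5 := abs_nonneg y₁
  have n6 := abs_nonneg y₂
  have hy2 : 0 ≤ a * y ^ 2 := by positivity
  have s1 : 0 ≤ a * y₁ ^ 2 := by positivity
  have s2 : 0 ≤ a * y₂ ^ 2 := by positivity
  rw [mul_add, ← Real.exp_add, ← Real.exp_add]
  rcases le_total 0 x with hx | hx
  · have h3 : a * (x * y) ≤ a * (x * y₂) := by gcongr
    refine le_trans ?_ (le_add_of_nonneg_left (Real.exp_pos _).le)
    gcongr
    nlinarith
  · have h3 : a * (x * y) ≤ a * (x * y₁) :=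
      mul_le_mul_of_nonneg_left (mul_le_mul_of_nonpos_left hl1 hx) ha0.le
    refine le_trans ?_ (le_add_of_nonneg_right (Real.exp_pos _).le)
    gcongr
    nlinarith

/-- The kernel `1 / (Θ(r e^{id} / T) r)` of the `q`-Laplace transform. -/
def thetaKer (q k d : ℝ) (T : ℂ) (r : ℝ) : ℂ :=
  (theta q k (r * Complex.exp (d * Complex.I) / T))⁻¹ / r

lemma lapIntegrand_eq (q k d : ℝ) (f : ℂ → ℂ) (T : ℂ) (r : ℝ) :
    lapIntegrand q k d f T r = f (r * Complex.exp (d * Complex.I)) * thetaKer q k d T r := by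
  rw [lapIntegrand, thetaKer]; ring

lemma ray_ne_zero {d r : ℝ} (hr : 0 < r) : (r : ℂ) * Complex.exp (d * Complex.I) ≠ 0 :=
  mul_ne_zero (by exact_mod_cast hr.ne') (Complex.exp_ne_zero _)

lemma norm_ray {d r : ℝ} (hr : 0 < r) : ‖(r : ℂ) * Complex.exp (d * Complex.I)‖ = r := by
  rw [norm_mul, norm_exp_I, mul_one, Complex.norm_real, Real.norm_eq_abs, abs_of_pos hr]

lemma le_norm_one_add_of_mem_lapDomain {d δt r s : ℝ} {T : ℂ} (hT : T ∈ lapDomain d δt)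
    (hr : 0 < r) (hs : 0 ≤ s) :
    δt < ‖1 + s * (r * Complex.exp (d * Complex.I) / T)‖ := by
  have := hT.2 (s * r) (by positivity)
  convert this using 3
  push_cast; ring

/-- The lower bound of the theta function, read as an upper bound of the kernel. -/
lemma norm_thetaKer_le {q κ δt : ℝ} (hq : 1 < q) (hκ : 0 < κ) (hδ : 0 < δt) :
    ∃ c : ℝ, 0 < c ∧ ∀ (d : ℝ) (T : ℂ), T ∈ lapDomain d δt → ∀ r : ℝ, 0 < r →
      ‖thetaKer q κ d T r‖ ≤ c * lapKer q κ ‖T‖ r := by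
  obtain ⟨c, hc, h⟩ := theta_lower_bound hq hκ hδ
  refine ⟨c⁻¹, by positivity, fun d T hT r hr => ?_⟩
  have hg := growth_pos q κ (1 / 2) (r / ‖T‖)
  have := h (r * Complex.exp (d * Complex.I) / T) (div_ne_zero (ray_ne_zero hr) hT.1)
    fun s hs => (le_norm_one_add_of_mem_lapDomain hT hr hs).le
  rw [norm_div, norm_ray hr] at this
  rw [thetaKer, lapKer, norm_div, norm_inv, Complex.norm_real, Real.norm_eq_abs, abs_of_pos hr,
    ← mul_div_assoc, ← mul_inv]
  gcongr

lemma theta_ray_ne_zero {q κ d : ℝ} (hq : 1 < q) (hκ : 0 < κ) {T : ℂ} (hT : T ∈ slit d) {r : ℝ}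
    (hr : 0 < r) : theta q κ (r * Complex.exp (d * Complex.I) / T) ≠ 0 := by
  obtain ⟨c, hc, hn⟩ := exists_lapDomain_nhds hT
  have hTc := mem_of_mem_nhds hn
  refine theta_ne_zero hq hκ (div_ne_zero (ray_ne_zero hr) hTc.1) fun s hs h0 => ?_
  have := le_norm_one_add_of_mem_lapDomain hTc hr hs.le
  rw [h0, norm_zero] at this
  linarith

lemma differentiableOn_thetaKer {q κ d r : ℝ} (hq : 1 < q) (hκ : 0 < κ) (hr : 0 < r) :
    DifferentiableOn ℂ (fun T => thetaKer q κ d T r) (slit d) := by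
  unfold thetaKer
  refine DifferentiableOn.div_const (DifferentiableOn.inv ?_ fun T hT =>
    theta_ray_ne_zero hq hκ hT hr) _
  refine (differentiableOn_theta hq hκ).comp ?_ fun T hT =>
    div_ne_zero (ray_ne_zero hr) (slit_ne_zero hT)
  exact DifferentiableOn.div (differentiableOn_const _) differentiableOn_id
    fun T hT => slit_ne_zero hT

lemma continuousOn_thetaKer {q κ d : ℝ} (hq : 1 < q) (hκ : 0 < κ) {T : ℂ} (hT : T ∈ slit d) :
    ContinuousOn (thetaKer q κ d T) (Set.Ioi 0) := by
  unfold thetaKer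
  refine ContinuousOn.div (ContinuousOn.inv₀ ?_ fun r hr => theta_ray_ne_zero hq hκ hT hr)
    (by fun_prop) fun r hr => by exact_mod_cast (ne_of_gt hr)
  refine (differentiableOn_theta hq hκ).continuousOn.comp (by fun_prop) fun r hr =>
    div_ne_zero (ray_ne_zero hr) (slit_ne_zero hT)

/-- The part of the slit plane with modulus in `J`. -/
def slitPart (d : ℝ) (J : Set ℝ) : Set ℂ := slit d ∩ (fun T => ‖T‖) ⁻¹' J

lemma isOpen_slitPart (d : ℝ) {J : Set ℝ} (hJ : IsOpen J) : IsOpen (slitPart d J) :=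
  (isOpen_slit d).inter (hJ.preimage continuous_norm)

/-- Domination of the kernel locally uniformly in `T`, by the model kernels of two nearby moduli. -/
lemma exists_thetaKer_bound {q κ d : ℝ} (hq : 1 < q) (hκ : 0 < κ) {J : Set ℝ} (hJ : IsOpen J)
    {T₀ : ℂ} (hT₀ : T₀ ∈ slitPart d J) :
    ∃ ρ > 0, ∃ t₁ ∈ J, ∃ t₂ ∈ J, ∃ C : ℝ, 0 < C ∧ ball T₀ ρ ⊆ slitPart d J ∧
      ∀ T ∈ ball T₀ ρ, ∀ r : ℝ, 0 < r →
        ‖thetaKer q κ d T r‖ ≤ C * (lapKer q κ t₁ r + lapKer q κ t₂ r) := by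
  obtain ⟨c, hc, hn⟩ := exists_lapDomain_nhds hT₀.1
  have hT₀n : 0 < ‖T₀‖ := norm_pos_iff.2 (slit_ne_zero hT₀.1)
  obtain ⟨e, he, heJ⟩ := Metric.isOpen_iff.1 hJ ‖T₀‖ hT₀.2
  obtain ⟨e', he', he1, he2⟩ : ∃ e' : ℝ, 0 < e' ∧ e' < e ∧ e' < ‖T₀‖ := by
    refine ⟨min e ‖T₀‖ / 2, by positivity, ?_, ?_⟩
    · have := min_le_left e ‖T₀‖; linarith
    · have := min_le_right e ‖T₀‖; linarith
  obtain ⟨c', hc', hker⟩ := norm_thetaKer_le hq hκ hc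
  obtain ⟨C, hC, hadd⟩ := lapKer_le_add (t₁ := ‖T₀‖ - e') (t₂ := ‖T₀‖ + e') hq hκ (by linarith)
  obtain ⟨ρ, hρ, hball⟩ := Metric.mem_nhds_iff.1
    (inter_mem (inter_mem hn ((isOpen_slitPart d hJ).mem_nhds hT₀)) (ball_mem_nhds T₀ he'))
  refine ⟨ρ, hρ, ‖T₀‖ - e', heJ ?_, ‖T₀‖ + e', heJ ?_, c' * C, by positivity,
    fun T hT => (hball hT).1.2, fun T hT r hr => ?_⟩
  · simpa [Real.dist_eq, abs_of_pos he'] using he1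
  · simpa [Real.dist_eq, abs_of_pos he'] using he1
  · have h1 := (hball hT).2
    rw [mem_ball, dist_eq_norm] at h1
    have h2 := abs_le.1 ((abs_norm_sub_norm_le T T₀).trans h1.le)
    rw [mul_assoc]
    refine (hker d T (hball hT).1.1 r hr).trans ?_
    gcongr
    exact hadd _ r (by linarith) (by linarith) hr

section Laplace

variable {q κ d : ℝ} {V O : Set ℂ} {Φ : ℂ → ℝ} {β μ ε₀ B : ℝ} {w : ℂ → ℝ → ℂ → ℂ}

/-- The transform converges, with the bound given by the transform of the weight. -/
lemma laplace_bound (hq : 1 < q) (hκ : 0 < κ) {δt : ℝ} (hδ : 0 < δt) :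
    ∃ K : ℝ, 0 < K ∧ ∀ (d : ℝ) (V : Set ℂ) (Φ : ℂ → ℝ) (β μ B : ℝ) (v : ℂ → ℝ → ℂ),
      ContinuousOn (fun p : ℂ × ℝ => v p.1 p.2) (V ×ˢ Set.univ) →
      (∀ τ ∈ V, ∀ m, ‖v τ m‖ ≤ B * (decay β μ m * Φ τ)) →
      (∀ r : ℝ, 0 < r → (r : ℂ) * Complex.exp (d * Complex.I) ∈ V) →
      ∀ (m : ℝ), ∀ T ∈ lapDomain d δt,
      IntegrableOn (fun r : ℝ => Φ (r * Complex.exp (d * Complex.I)) * lapKer q κ ‖T‖ r)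
        (Set.Ioi 0) →
      IntegrableOn (lapIntegrand q κ d (fun h => v h m) T) (Set.Ioi 0) ∧
      ‖qLaplace q κ d (fun h => v h m) T‖ ≤ K * (B * decay β μ m *
        ∫ r in Set.Ioi (0 : ℝ), Φ (r * Complex.exp (d * Complex.I)) * lapKer q κ ‖T‖ r) := by
  obtain ⟨c, hc, hker⟩ := norm_thetaKer_le hq hκ hδ
  refine ⟨(‖1 / (piq q κ : ℂ)‖ + 1) * c, by positivity,
    fun d V Φ β μ B v hv hb hray m T hT hI => ?_⟩
  have hle : ∀ r ∈ Set.Ioi (0 : ℝ), ‖lapIntegrand q κ d (fun h => v h m) T r‖ ≤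
      c * (B * decay β μ m) *
        (Φ (r * Complex.exp (d * Complex.I)) * lapKer q κ ‖T‖ r) := by
    intro r hr
    rw [lapIntegrand_eq, norm_mul]
    have h1 := hb _ (hray r hr) m
    have h2 := hker d T hT r hr
    calc _ ≤ (B * (decay β μ m * Φ (r * Complex.exp (d * Complex.I)))) *
          (c * lapKer q κ ‖T‖ r) :=
          mul_le_mul h1 h2 (norm_nonneg _) ((norm_nonneg _).trans h1)
      _ = _ := by ring
  have hmeas : AEStronglyMeasurable (lapIntegrand q κ d (fun h => v h m) T)
      (volume.restrict (Set.Ioi 0)) := by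
    refine ContinuousOn.aestronglyMeasurable ?_ measurableSet_Ioi
    simp_rw [funext (lapIntegrand_eq q κ d (fun h => v h m) T)]
    refine ContinuousOn.mul ?_ (continuousOn_thetaKer hq hκ (lapDomain_subset_slit hδ hT))
    exact hv.comp (f := fun r : ℝ => ((r : ℂ) * Complex.exp (d * Complex.I), m)) (by fun_prop)
      fun r hr => ⟨hray r hr, trivial⟩
  have hbi := hI.const_mul (c * (B * decay β μ m))
  have hae := (ae_restrict_iff' (μ := volume) measurableSet_Ioi).2 (Eventually.of_forall hle)
  refine ⟨Integrable.mono' hbi hmeas hae, ?_⟩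
  rw [qLaplace, norm_mul]
  have hn := norm_integral_le_of_norm_le hbi hae
  rw [integral_const_mul] at hn
  have hn0 := (norm_nonneg _).trans hn
  calc _ ≤ (‖1 / (piq q κ : ℂ)‖ + 1) * (c * (B * decay β μ m) *
        ∫ r in Set.Ioi (0 : ℝ), Φ (r * Complex.exp (d * Complex.I)) * lapKer q κ ‖T‖ r) := by
        refine mul_le_mul (by linarith) hn (norm_nonneg _) (by positivity)
    _ = _ := by ring

/-- Regularity of the transform of a holomorphic family. -/
lemma laplace_regular (hq : 1 < q) (hκ : 0 < κ) {J : Set ℝ} (hJ : IsOpen J) (hμ : 0 ≤ μ)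
    (hβ : 0 ≤ β) (hB : 0 ≤ B) (hw : InFamily V O Φ β μ ε₀ B w) (hΦ : ∀ τ ∈ V, 0 < Φ τ)
    (hrayV : ∀ r : ℝ, 0 < r → (r : ℂ) * Complex.exp (d * Complex.I) ∈ V)
    (hI : ∀ t ∈ J, IntegrableOn
      (fun r : ℝ => Φ (r * Complex.exp (d * Complex.I)) * lapKer q κ t r) (Set.Ioi 0)) :
    (∀ ε ∈ ball (0 : ℂ) ε₀, ContinuousOn
      (fun p : ℂ × ℝ => qLaplace q κ d (fun h => w h p.2 ε) p.1) (slitPart d J ×ˢ Set.univ)) ∧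
    (∀ ε ∈ ball (0 : ℂ) ε₀, ∀ m, DifferentiableOn ℂ
      (fun T => qLaplace q κ d (fun h => w h m ε) T) (slitPart d J)) ∧
    ∀ T ∈ slitPart d J, ∀ m, DifferentiableOn ℂ
      (fun ε => qLaplace q κ d (fun h => w h m ε) T) (ball 0 ε₀) := by
  have hmeas : ∀ ε ∈ ball (0 : ℂ) ε₀, ∀ m, ∀ T ∈ slitPart d J,
      AEStronglyMeasurable (fun r : ℝ =>
        w (r * Complex.exp (d * Complex.I)) m ε * thetaKer q κ d T r)
        (volume.restrict (Set.Ioi 0)) := by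
    intro ε hε m T hT
    refine ContinuousOn.aestronglyMeasurable (ContinuousOn.mul ?_
      (continuousOn_thetaKer hq hκ hT.1)) measurableSet_Ioi
    exact (hw.cont ε hε).comp (f := fun r : ℝ => ((r : ℂ) * Complex.exp (d * Complex.I), m))
      (by fun_prop) fun r hr => ⟨hrayV r hr, trivial⟩
  have hloc : ∀ T₀ ∈ slitPart d J, ∃ ρ > 0, ∃ bound : ℝ → ℝ,
      Integrable bound (volume.restrict (Set.Ioi 0)) ∧ ball T₀ ρ ⊆ slitPart d J ∧
      ∀ r : ℝ, 0 < r → ∀ T ∈ ball T₀ ρ, ∀ ε ∈ ball (0 : ℂ) ε₀, ∀ m,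
        ‖w (r * Complex.exp (d * Complex.I)) m ε * thetaKer q κ d T r‖ ≤ bound r := by
    intro T₀ hT₀
    obtain ⟨ρ, hρ, t₁, ht₁, t₂, ht₂, C, hC, hsub, hle⟩ := exists_thetaKer_bound hq hκ hJ hT₀
    refine ⟨ρ, hρ, fun r => B * C * (Φ (r * Complex.exp (d * Complex.I)) * lapKer q κ t₁ r +
      Φ (r * Complex.exp (d * Complex.I)) * lapKer q κ t₂ r),
      ((hI t₁ ht₁).add (hI t₂ ht₂)).const_mul _, hsub, fun r hr T hT ε hε m => ?_⟩
    have h1 := hw.bound ε hε _ (hrayV r hr) m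
    have h2 := hle T hT r hr
    have h3 := decay_le_one hβ hμ m
    have hΦr := hΦ _ (hrayV r hr)
    have hk1 := lapKer_nonneg q κ t₁ hr
    have hk2 := lapKer_nonneg q κ t₂ hr
    rw [norm_mul]
    calc _ ≤ (B * (decay β μ m * Φ (r * Complex.exp (d * Complex.I)))) *
          (C * (lapKer q κ t₁ r + lapKer q κ t₂ r)) :=
          mul_le_mul h1 h2 (norm_nonneg _) ((norm_nonneg _).trans h1)
      _ ≤ (B * (1 * Φ (r * Complex.exp (d * Complex.I)))) *
          (C * (lapKer q κ t₁ r + lapKer q κ t₂ r)) := by gcongr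
      _ = _ := by ring
  have hpos : ∀ᵐ r ∂(volume.restrict (Set.Ioi (0 : ℝ))), 0 < r :=
    (ae_restrict_iff' measurableSet_Ioi).2 (Eventually.of_forall fun r hr => hr)
  simp only [qLaplace, lapIntegrand_eq]
  refine ⟨fun ε hε => continuousOn_const.mul ?_, fun ε hε m => DifferentiableOn.const_mul ?_ _,
    fun T hT m => DifferentiableOn.const_mul ?_ _⟩
  · rintro ⟨T₀, m₀⟩ ⟨hT₀, -⟩
    obtain ⟨ρ, hρ, bound, hbi, hsub, hle⟩ := hloc T₀ hT₀
    have hev : ∀ᶠ p : ℂ × ℝ in 𝓝[slitPart d J ×ˢ Set.univ] (T₀, m₀), p.1 ∈ ball T₀ ρ :=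
      nhdsWithin_le_nhds (continuous_fst.continuousAt.eventually (ball_mem_nhds T₀ hρ))
    refine continuousWithinAt_of_dominated (bound := bound)
      (hev.mono fun p hp => hmeas ε hε p.2 p.1 (hsub hp))
      (hev.mono fun p hp => hpos.mono fun r hr => hle r hr p.1 hp ε hε p.2) hbi
      (hpos.mono fun r hr => ?_)
    refine ContinuousWithinAt.mul ?_ ?_
    · exact (continuous_slice (v := fun τ m => w τ m ε) (hw.cont ε hε) (hrayV r hr)).comp
        continuous_snd |>.continuousWithinAt
    · exact ((differentiableOn_thetaKer hq hκ hr).continuousOn.mono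
        fun T hT => hT.1).comp continuousOn_fst (fun p hp => hp.1) (T₀, m₀) ⟨hT₀, trivial⟩
  · refine differentiableOn_integral_of_dominated (fun T hT => hmeas ε hε m T hT)
      (hpos.mono fun r hr => ((differentiableOn_thetaKer hq hκ hr).mono
        fun T hT => hT.1).const_mul _) fun T₀ hT₀ => ?_
    obtain ⟨ρ, hρ, bound, hbi, hsub, hle⟩ := hloc T₀ hT₀
    exact ⟨ρ, hρ, bound, hbi, hsub, hpos.mono fun r hr T hT => hle r hr T hT ε hε m⟩
  · refine differentiableOn_integral_of_dominated (fun ε hε => hmeas ε hε m T hT)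
      (hpos.mono fun r hr => (hw.holε _ (hrayV r hr) m).mul_const _) fun e₀ he₀ => ?_
    obtain ⟨ρ, hρ, bound, hbi, hsub, hle⟩ := hloc T hT
    obtain ⟨r₀, hr₀, hrb⟩ := Metric.isOpen_iff.1 isOpen_ball e₀ he₀
    exact ⟨r₀, hr₀, bound, hbi, hrb, hpos.mono fun r hr ε hε =>
      hle r hr T (mem_ball_self hρ) ε (hrb hε) m⟩

/-- The transform commutes with the convolution in the Fourier variable. -/
lemma laplace_conv (hq : 1 < q) (hκ : 0 < κ) {δt ζ : ℝ} (hδ : 0 < δt) {P : ℂ[X]} {N : ℕ}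
    (hP : P.natDegree ≤ N) (hβ : 0 ≤ β) (hμ : (N : ℝ) + 1 < μ) (hζ : 0 ≤ ζ)
    {h₁ : ℝ → ℂ} (c₁ : Continuous h₁) (b₁ : ∀ m, ‖h₁ m‖ ≤ ζ * decay β μ m)
    {v : ℂ → ℝ → ℂ} (hv : ContinuousOn (fun p : ℂ × ℝ => v p.1 p.2) (V ×ˢ Set.univ))
    (hb : ∀ τ ∈ V, ∀ m, ‖v τ m‖ ≤ B * (decay β μ m * Φ τ))
    (hray : ∀ r : ℝ, 0 < r → (r : ℂ) * Complex.exp (d * Complex.I) ∈ V)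
    {T : ℂ} (hT : T ∈ lapDomain d δt)
    (hI : IntegrableOn (fun r : ℝ => Φ (r * Complex.exp (d * Complex.I)) * lapKer q κ ‖T‖ r)
      (Set.Ioi 0)) (m : ℝ) :
    qLaplace q κ d (fun u => conv P h₁ (v u) m) T =
      conv P h₁ (fun m₁ => qLaplace q κ d (fun u => v u m₁) T) m := by
  obtain ⟨c, hc, hker⟩ := norm_thetaKer_le hq hκ hδ
  have hμ0 : 0 ≤ μ := by have : (0 : ℝ) ≤ N := N.cast_nonneg; linarith
  simp only [qLaplace, lapIntegrand_eq]
  let F : ℝ → ℝ → ℂ := fun r m₁ => h₁ (m - m₁) * evI P m₁ *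
    v (r * Complex.exp (d * Complex.I)) m₁ * thetaKer q κ d T r
  have hF : Integrable (Function.uncurry F) ((volume.restrict (Set.Ioi 0)).prod volume) := by
    have hbound := (hI.const_mul c).mul_prod
      ((integrable_evI_mul_decay hP hβ hμ).const_mul (ζ * B))
    refine hbound.mono' ?_ ?_
    · have hres : (volume.restrict (Set.Ioi (0 : ℝ))).prod (volume : Measure ℝ) =
          ((volume : Measure ℝ).prod volume).restrict (Set.Ioi 0 ×ˢ Set.univ) := by
        rw [← Measure.prod_restrict, Measure.restrict_univ]
      rw [hres]
      refine ContinuousOn.aestronglyMeasurable ?_ (measurableSet_Ioi.prod MeasurableSet.univ)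
      have hev := continuous_evI P
      have e1 : Continuous fun p : ℝ × ℝ => h₁ (m - p.2) * evI P p.2 := by fun_prop
      refine (e1.continuousOn.mul ?_).mul ?_
      · exact hv.comp (f := fun p : ℝ × ℝ => ((p.1 : ℂ) * Complex.exp (d * Complex.I), p.2))
          (by fun_prop) fun p hp => ⟨hray p.1 hp.1, trivial⟩
      · exact (continuousOn_thetaKer hq hκ (lapDomain_subset_slit hδ hT)).comp continuousOn_fst
          fun p hp => hp.1
    · have hae : ∀ᵐ p : ℝ × ℝ ∂(volume.restrict (Set.Ioi 0)).prod volume, 0 < p.1 :=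
        Measure.quasiMeasurePreserving_fst.ae
          ((ae_restrict_iff' measurableSet_Ioi).2 (Eventually.of_forall fun r hr => hr))
      filter_upwards [hae] with p hp
      have e1 := norm_conv_integrand_le (P := P) (h₂ := v (p.1 * Complex.exp (d * Complex.I)))
        (B := B * Φ (p.1 * Complex.exp (d * Complex.I))) hβ hμ0 hζ b₁
        (fun m => (hb _ (hray p.1 hp) m).trans (le_of_eq (by ring))) m p.2
      have e2 := hker d T hT p.1 hp
      simp only [Function.uncurry, F]
      rw [norm_mul]
      calc _ ≤ _ := mul_le_mul e1 e2 (norm_nonneg _) ((norm_nonneg _).trans e1)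
        _ = _ := by ring
  have hL : ∫ r in Set.Ioi (0 : ℝ), conv P h₁ (v (r * Complex.exp (d * Complex.I))) m *
      thetaKer q κ d T r = ∫ r in Set.Ioi (0 : ℝ), ∫ m₁ : ℝ, F r m₁ := by
    refine integral_congr_ae (Eventually.of_forall fun r => ?_)
    simp only [conv, F]
    rw [integral_mul_const]
  rw [hL, integral_integral_swap hF, conv]
  refine (integral_const_mul _ _).symm.trans
    (integral_congr_ae (Eventually.of_forall fun m₁ => ?_))
  have hin : ∫ r in Set.Ioi (0 : ℝ), F r m₁ = h₁ (m - m₁) * evI P m₁ *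
      ∫ r in Set.Ioi (0 : ℝ), v (r * Complex.exp (d * Complex.I)) m₁ * thetaKer q κ d T r := by
    refine Eq.trans ?_ (integral_const_mul _ _)
    refine integral_congr_ae (Eventually.of_forall fun r => ?_)
    simp only [F]; ring
  beta_reduce
  rw [hin]
  ring

/-- The transform turns `u^n f(q^γ u)` into `T^n (ℒf)(q^{γ + n/κ} T)`, up to a power of `q`. -/
lemma laplace_shift (hq : 1 < q) (γ : ℝ) (n : ℕ) (f : ℂ → ℂ) {T : ℂ}
    (hT : T ≠ 0) :
    qLaplace q κ d (fun u => u ^ n * f (dil q γ * u)) T =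
      ((q ^ ((n : ℝ) * (n - 1) / (2 * κ)) : ℝ) : ℂ) * T ^ n *
        qLaplace q κ d f (dil q (γ + n / κ) * T) := by
  have hq0 : 0 < q := by linarith
  have hb : 0 < q ^ γ := Real.rpow_pos_of_pos hq0 γ
  let G : ℝ → ℂ := lapIntegrand q κ d f (dil q (γ + n / κ) * T)
  have hpt : ∀ r ∈ Set.Ioi (0 : ℝ), lapIntegrand q κ d (fun u => u ^ n * f (dil q γ * u)) T r =
      (((q ^ ((n : ℝ) * (n - 1) / (2 * κ)) : ℝ) : ℂ) * T ^ n * (q ^ γ : ℝ)) * G (q ^ γ * r) := by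
    intro r hr
    have hr0 : (0 : ℝ) < r := hr
    have hrC : (r : ℂ) ≠ 0 := by exact_mod_cast hr0.ne'
    have hbC : ((q ^ γ : ℝ) : ℂ) ≠ 0 := by exact_mod_cast hb.ne'
    set u : ℂ := r * Complex.exp (d * Complex.I) with hu
    have hu0 : u ≠ 0 := ray_ne_zero hr0
    have harg : (((q ^ γ * r : ℝ) : ℂ)) * Complex.exp (d * Complex.I) = dil q γ * u := by
      rw [dil, hu]; push_cast; ring
    set x : ℂ := dil q γ * u / (dil q (γ + n / κ) * T) with hx
    have hdn : dil q (γ + n / κ) = dil q γ * ((Real.exp (n * (Real.log q / κ)) : ℝ) : ℂ) := by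
      rw [dil, dil, Real.rpow_add hq0, Complex.ofReal_mul]
      congr 2
      rw [Real.rpow_def_of_pos hq0]; congr 1; ring
    have hE : ((Real.exp (n * (Real.log q / κ)) : ℝ) : ℂ) ≠ 0 := by
      exact_mod_cast (Real.exp_pos _).ne'
    have hdγ : dil q γ ≠ 0 := hbC
    have hx0 : x ≠ 0 := by
      rw [hx, hdn]; exact div_ne_zero (mul_ne_zero hdγ hu0) (mul_ne_zero (mul_ne_zero hdγ hE) hT)
    have hux : u / T = ((Real.exp (((n : ℤ) : ℝ) * (Real.log q / κ)) : ℝ) : ℂ) * x := by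
      rw [hx, hdn, Int.cast_natCast]; field_simp
    have htheta := theta_dilate (k := κ) hq hx0 (n : ℤ)
    rw [← hux, zpow_natCast, Int.cast_natCast] at htheta
    have hxn : u ^ n = ((Real.exp (n * (Real.log q / κ)) : ℝ) : ℂ) ^ n * x ^ n * T ^ n := by
      rw [← mul_pow, ← mul_pow]; congr 1
      rw [Int.cast_natCast] at hux
      rw [← hux]; field_simp
    have hpow : ((Real.exp (n * (Real.log q / κ)) : ℝ) : ℂ) ^ n =
        ((q ^ ((n : ℝ) * (n - 1) / (2 * κ)) : ℝ) : ℂ) *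
          ((Real.exp (Real.log q / κ * (n * (n + 1) / 2)) : ℝ) : ℂ) := by
      rw [← Complex.ofReal_pow, ← Complex.ofReal_mul, ← Real.exp_nat_mul,
        Real.rpow_def_of_pos hq0, ← Real.exp_add]
      congr 2
      -- for `κ = 0` both exponents vanish, since division by zero gives zero
      rcases eq_or_ne κ 0 with rfl | hκ
      · simp
      · field_simp; ring
    have hE2 : ((Real.exp (Real.log q / κ * (n * (n + 1) / 2)) : ℝ) : ℂ) ≠ 0 := by
      exact_mod_cast (Real.exp_pos _).ne'
    simp only [G, lapIntegrand]
    rw [harg, ← hu, ← hx, htheta, hxn, hpow, Complex.ofReal_mul]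
    have hxn0 : x ^ n ≠ 0 := pow_ne_zero _ hx0
    rcases eq_or_ne (theta q κ x) 0 with h0 | h0
    · simp [h0]
    · field_simp
  rw [qLaplace, qLaplace, setIntegral_congr_fun measurableSet_Ioi hpt, integral_const_mul,
    integral_comp_mul_left_Ioi G 0 hb, mul_zero]
  have hbC : ((q ^ γ : ℝ) : ℂ) ≠ 0 := by exact_mod_cast hb.ne'
  rw [Complex.real_smul, Complex.ofReal_inv]
  simp only [G]
  field_simp

end Laplace

end

/-! ### The equations in fixed point form -/

section

open Filter Topology MeasureTheory Metric

lemma qfac_eq {q k : ℝ} (hq : 1 < q) (n : ℕ) :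
    qfac q k n = q ^ ((n : ℝ) * ((n : ℝ) - 1) / (2 * k)) := by
  have h0 : (0 : ℝ) ≤ q := by linarith
  have h : ((n * (n - 1) / 2 : ℕ) : ℝ) = (n : ℝ) * ((n : ℝ) - 1) / 2 := by
    rw [Nat.cast_div (Nat.even_mul_pred_self n).two_dvd (by norm_num)]
    rcases n with _ | n <;> simp
  rw [qfac, ← Real.rpow_natCast, ← Real.rpow_mul h0, h]
  congr 1
  rw [div_mul_div_comm, one_mul, mul_comm k]

lemma qfac_pos {q k : ℝ} (hq : 1 < q) (n : ℕ) : 0 < qfac q k n := by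
  rw [qfac_eq hq]; exact Real.rpow_pos_of_pos (by linarith) _

/-- The quotient of the numbers `(q^{1/k})^{j(j-1)/2}` at `j = k` and `j = n + k`. -/
def qratio (q : ℝ) (k n : ℕ) : ℝ := qfac q k k / qfac q k (n + k)

lemma qratio_eq {q : ℝ} {k : ℕ} (hq : 1 < q) (hk : 1 ≤ k) (n : ℕ) :
    qratio q k n = q ^ (-((n : ℝ) * (n - 1) / (2 * k)) - n) := by
  have h0 : (k : ℝ) ≠ 0 := by positivity
  rw [qratio, qfac_eq hq, qfac_eq hq, ← Real.rpow_sub (by linarith)]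
  congr 1
  push_cast
  field_simp
  ring

lemma qratio_pos {q : ℝ} {k : ℕ} (hq : 1 < q) (n : ℕ) : 0 < qratio q k n :=
  div_pos (qfac_pos hq _) (qfac_pos hq _)

namespace Exponents

variable {E : Exponents}

/-- The pairs `(ℓ, j)` with `1 ≤ ℓ ≤ D - 1` and `j` in the index set attached to `ℓ`. -/
def pairs (E : Exponents) : Finset (Σ _ : ℕ, ℕ) := (Finset.Icc 1 (E.D - 1)).sigma E.Idx

/-- The coefficient of the dilated unknown in the equation of order `k`, divided by the
coefficient of the unknown on its left-hand side. -/
def coefA (E : Exponents) (Q RD : ℂ[X]) (k : ℕ) (τ : ℂ) (m : ℝ) : ℂ :=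
  evI RD m / evI Q m * (qratio E.q k E.dD : ℂ) * τ ^ E.dD

/-- The coefficient of the convolution term of index `i` in the equation of order `k`, divided by
the coefficient of the unknown on its left-hand side. -/
def coefB (E : Exponents) (Q : ℂ[X]) (k : ℕ) (i : Σ _ : ℕ, ℕ) (τ : ℂ) (m : ℝ) : ℂ :=
  (evI Q m)⁻¹ * ((qratio E.q k (E.dl i.1 i.2) / Real.sqrt (2 * Real.pi) : ℝ) : ℂ) *
    τ ^ E.dl i.1 i.2

/-- The ratio of the dilation in the convolution term of index `i` of the equation of
order `k`. -/
def ratio (E : Exponents) (k : ℕ) (i : Σ _ : ℕ, ℕ) : ℝ :=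
  E.q ^ ((E.del i.1 : ℝ) - (E.dl i.1 i.2 : ℝ) / k - 1)

/-- The power of the parameter in the convolution term of index `i`. -/
def epsPow (E : Exponents) (i : Σ _ : ℕ, ℕ) : ℕ := E.Dl i.1 i.2 - E.dl i.1 i.2

/-- The linear part of the equation of order `k`, divided by the coefficient of the unknown on its
left-hand side; `c₀` is the ratio of the dilation in its first term. -/
def linPart (E : Exponents) (Q : ℂ[X]) (R : ℕ → ℂ[X]) (C : ℕ → ℕ → ℝ → ℂ) (ε : ℂ) (k : ℕ) (c₀ : ℝ)
    (w : ℂ → ℝ → ℂ) (τ : ℂ) (m : ℝ) : ℂ :=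
  dilConvOp E.pairs (E.coefA Q (R E.D) k) c₀ (E.coefB Q k) (E.ratio k) (fun i => R i.1)
    (fun i => ε ^ E.epsPow i) (fun i => C i.1 i.2) w τ m

/-- `linPart` multiplied by the coefficient of the unknown is the linear part of the equation. -/
lemma linPart_eq {Q : ℂ[X]} {R : ℕ → ℂ[X]} {C : ℕ → ℕ → ℝ → ℂ} {ε : ℂ} {k : ℕ} {c₀ : ℝ}
    {w : ℂ → ℝ → ℂ} {τ : ℂ} {m : ℝ} (hq : 1 < E.q) (hQ : evI Q m ≠ 0) :
    evI Q m * (τ ^ k / (qfac E.q k k : ℂ)) * E.linPart Q R C ε k c₀ w τ m =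
      τ ^ (E.dD + k) / (qfac E.q k (E.dD + k) : ℂ) * evI (R E.D) m * w (c₀ * τ) m
      + ∑ ℓ ∈ Finset.Icc 1 (E.D - 1), ∑ j ∈ E.Idx ℓ,
          ε ^ (E.Dl ℓ j - E.dl ℓ j) * τ ^ (E.dl ℓ j + k) /
            (qfac E.q k (E.dl ℓ j + k) : ℂ) * (1 / (Real.sqrt (2 * Real.pi) : ℂ)) *
            conv (R ℓ) (C ℓ j) (w (dil E.q ((E.del ℓ : ℝ) - (E.dl ℓ j : ℝ) / k - 1) * τ)) m := by
  have h1 : ∀ n, (qfac E.q k n : ℂ) ≠ 0 := fun n =>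
    Complex.ofReal_ne_zero.2 (qfac_pos hq n).ne'
  have h2 : (Real.sqrt (2 * Real.pi) : ℂ) ≠ 0 := Complex.ofReal_ne_zero.2 (by positivity)
  rw [linPart, dilConvOp, mul_add, Finset.mul_sum, pairs, Finset.sum_sigma]
  congr 1
  · rw [coefA, qratio]
    push_cast
    have := h1 k
    have := h1 (E.dD + k)
    field_simp
    ring
  · refine Finset.sum_congr rfl fun ℓ _ => Finset.sum_congr rfl fun j _ => ?_
    rw [coefB, qratio, ratio, epsPow, dil]
    push_cast
    have := h1 k
    have := h1 (E.dl ℓ j + k)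
    field_simp
    ring

lemma mul_mul_inv_mul {a x y : ℂ} (ha : a ≠ 0) : a * x * (a⁻¹ * y) = x * y := by
  field_simp

/-- A solution of the fixed point equation solves the first equation; the converse needs `τ ≠ 0`. -/
lemma eq₁_of_fixed {Q : ℂ[X]} {R : ℕ → ℂ[X]} {C : ℕ → ℕ → ℝ → ℂ} {ψ : ℂ → ℝ → ℂ} {ε : ℂ}
    {V : Set ℂ} {w : ℂ → ℝ → ℂ} (hq : 1 < E.q) (hQ : ∀ m, evI Q m ≠ 0)
    (h : ∀ τ ∈ V, ∀ m, w τ m = (evI Q m)⁻¹ * ψ τ m +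
      E.linPart Q R C ε E.k₁ (E.q ^ (-(E.dD : ℝ) / E.kap)) w τ m) :
    E.Eq₁ Q R C ψ ε V w := by
  intro τ hτ m
  rw [h τ hτ m, mul_add, linPart_eq hq (hQ m), mul_mul_inv_mul (hQ m)]
  exact add_comm _ _

/-- Away from the origin, the first equation is a fixed point equation. -/
lemma fixed_of_eq₁ {Q : ℂ[X]} {R : ℕ → ℂ[X]} {C : ℕ → ℕ → ℝ → ℂ} {ψ : ℂ → ℝ → ℂ} {ε : ℂ}
    {V : Set ℂ} {w : ℂ → ℝ → ℂ} (hq : 1 < E.q) (hQ : ∀ m, evI Q m ≠ 0)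
    (h : E.Eq₁ Q R C ψ ε V w) {τ : ℂ} (hτ : τ ∈ V) (h0 : τ ≠ 0) (m : ℝ) :
    w τ m = (evI Q m)⁻¹ * ψ τ m +
      E.linPart Q R C ε E.k₁ (E.q ^ (-(E.dD : ℝ) / E.kap)) w τ m := by
  have h1 : evI Q m * (τ ^ E.k₁ / (qfac E.q E.k₁ E.k₁ : ℂ)) ≠ 0 :=
    mul_ne_zero (hQ m) (div_ne_zero (pow_ne_zero _ h0)
      (Complex.ofReal_ne_zero.2 (qfac_pos hq _).ne'))
  refine mul_left_cancel₀ h1 ?_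
  rw [h τ hτ m, mul_add, linPart_eq hq (hQ m), mul_mul_inv_mul (hQ m)]
  exact add_comm _ _

/-- Here the fixed point equation is the one in which only the coefficient of the left hand side
has been divided out; it is the form produced by the `q`-Laplace transform. -/
lemma eq₂_of_fixed {Q : ℂ[X]} {R : ℕ → ℂ[X]} {C : ℕ → ℕ → ℝ → ℂ} {ψ : ℂ → ℝ → ℂ} {ε : ℂ}
    {V : Set ℂ} {w : ℂ → ℝ → ℂ} (hq : 1 < E.q) (hQ : ∀ m, evI Q m ≠ 0)
    (h : ∀ τ ∈ V, ∀ m, w τ m = (evI Q m)⁻¹ * ψ τ m + E.linPart Q R C ε E.k₂ 1 w τ m) :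
    E.Eq₂ Q R C ψ ε V w := by
  intro τ hτ m
  have h1 := h τ hτ m
  have h2 := linPart_eq (R := R) (C := C) (ε := ε) (k := E.k₂) (c₀ := 1) (w := w) (τ := τ) hq (hQ m)
  rw [Complex.ofReal_one, one_mul] at h2
  conv_lhs => rw [h1, mul_add, h2, mul_mul_inv_mul (hQ m)]
  ring

/-- The coefficient of the convolution term of index `i` in the second equation, divided by the
total coefficient of the unknown, a multiple of `P_m(τ)`. -/
def coefB₂ (E : Exponents) (Q RD : ℂ[X]) (i : Σ _ : ℕ, ℕ) (τ : ℂ) (m : ℝ) : ℂ :=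
  ((qfac E.q E.k₂ (E.dl i.1 i.2 + E.k₂) * Real.sqrt (2 * Real.pi) : ℝ) : ℂ)⁻¹ *
    (τ ^ E.dl i.1 i.2 / E.P Q RD m τ)

/-- The forcing term of the second equation is divided by this multiple of `P_m(τ)`. -/
def coefG₂ (E : Exponents) (Q RD : ℂ[X]) (τ : ℂ) (m : ℝ) : ℂ :=
  (qfac E.q E.k₂ E.k₂ : ℂ)⁻¹ * (1 / E.P Q RD m τ)

/-- Where `τ P_m(τ) ≠ 0`, the second equation is a fixed point equation. -/
lemma eq₂_iff {Q : ℂ[X]} {R : ℕ → ℂ[X]} {C : ℕ → ℕ → ℝ → ℂ} {ψ : ℂ → ℝ → ℂ} {ε : ℂ}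
    {V : Set ℂ} {w : ℂ → ℝ → ℂ} (hq : 1 < E.q) (hV : ∀ τ ∈ V, τ ≠ 0)
    (hP : ∀ τ ∈ V, ∀ m, E.P Q (R E.D) m τ ≠ 0) :
    E.Eq₂ Q R C ψ ε V w ↔ ∀ τ ∈ V, ∀ m, w τ m = E.coefG₂ Q (R E.D) τ m * ψ τ m +
      dilConvOp E.pairs (fun _ _ => 0) 1 (E.coefB₂ Q (R E.D)) (E.ratio E.k₂) (fun i => R i.1)
        (fun i => ε ^ E.epsPow i) (fun i => C i.1 i.2) w τ m := by
  have h1 : ∀ n, (qfac E.q E.k₂ n : ℂ) ≠ 0 := fun n =>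
    Complex.ofReal_ne_zero.2 (qfac_pos hq n).ne'
  have h2 : (Real.sqrt (2 * Real.pi) : ℂ) ≠ 0 := Complex.ofReal_ne_zero.2 (by positivity)
  refine forall₂_congr fun τ hτ => forall_congr' fun m => ?_
  have h0 : τ ^ E.k₂ ≠ 0 := pow_ne_zero _ (hV τ hτ)
  have hPm := hP τ hτ m
  rw [← mul_right_inj' (b := w τ m) (mul_ne_zero h0 hPm)]
  have hl : τ ^ E.k₂ * E.P Q (R E.D) m τ * w τ m =
      evI Q m * (τ ^ E.k₂ / (qfac E.q E.k₂ E.k₂ : ℂ)) * w τ m -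
      evI (R E.D) m * (τ ^ (E.dD + E.k₂) / (qfac E.q E.k₂ (E.dD + E.k₂) : ℂ)) * w τ m := by
    rw [P, pow_add]; ring
  have hr : τ ^ E.k₂ * E.P Q (R E.D) m τ * (E.coefG₂ Q (R E.D) τ m * ψ τ m +
      dilConvOp E.pairs (fun _ _ => 0) 1 (E.coefB₂ Q (R E.D)) (E.ratio E.k₂) (fun i => R i.1)
        (fun i => ε ^ E.epsPow i) (fun i => C i.1 i.2) w τ m) =
      (∑ ℓ ∈ Finset.Icc 1 (E.D - 1), ∑ j ∈ E.Idx ℓ,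
          ε ^ (E.Dl ℓ j - E.dl ℓ j) * τ ^ (E.dl ℓ j + E.k₂) /
            (qfac E.q E.k₂ (E.dl ℓ j + E.k₂) : ℂ) * (1 / (Real.sqrt (2 * Real.pi) : ℂ)) *
            conv (R ℓ) (C ℓ j)
              (w (dil E.q ((E.del ℓ : ℝ) - (E.dl ℓ j : ℝ) / E.k₂ - 1) * τ)) m)
      + τ ^ E.k₂ / (qfac E.q E.k₂ E.k₂ : ℂ) * ψ τ m := by
    rw [mul_add, add_comm, dilConvOp, zero_mul, zero_add, Finset.mul_sum, pairs, Finset.sum_sigma]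
    congr 1
    · refine Finset.sum_congr rfl fun ℓ _ => Finset.sum_congr rfl fun j _ => ?_
      rw [coefB₂, ratio, epsPow, dil]
      push_cast
      have := h1 (E.dl ℓ j + E.k₂)
      field_simp
      ring
    · rw [coefG₂]
      field_simp
  rw [hl, hr, sub_eq_iff_eq_add, ← add_comm (evI (R E.D) m * _ * _), add_assoc]

namespace Admissible

lemma k₁_pos (hE : E.Admissible) : (0 : ℝ) < E.k₁ := by exact_mod_cast hE.one_le_k₁

lemma k₁_lt (hE : E.Admissible) : (E.k₁ : ℝ) < E.k₂ := by exact_mod_cast hE.k₁_lt_k₂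

lemma k₂_pos (hE : E.Admissible) : (0 : ℝ) < E.k₂ := hE.k₁_pos.trans hE.k₁_lt

lemma kap_eq (hE : E.Admissible) : E.kap = E.k₁ * E.k₂ / (E.k₂ - E.k₁) := by
  have := hE.k₁_pos; have := hE.k₂_pos; have := hE.k₁_lt
  have : (E.k₂ : ℝ) - E.k₁ ≠ 0 := by linarith
  rw [kap]; field_simp

lemma kap_pos (hE : E.Admissible) : 0 < E.kap := by
  rw [hE.kap_eq]
  exact div_pos (mul_pos hE.k₁_pos hE.k₂_pos) (sub_pos.2 hE.k₁_lt)

lemma inv_kap : (E.kap)⁻¹ = 1 / E.k₁ - 1 / E.k₂ := by rw [kap, inv_inv]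

lemma k₁_lt_kap (hE : E.Admissible) : (E.k₁ : ℝ) < E.kap := by
  rw [hE.kap_eq, lt_div_iff₀ (sub_pos.2 hE.k₁_lt)]
  nlinarith [hE.k₁_pos]

/-- The order of growth produced by the `q`-Laplace transform of order `κ` from the order `k₁`. -/
lemma k₁_mul_kap (hE : E.Admissible) : E.k₁ * E.kap / (E.kap - E.k₁) = E.k₂ := by
  have h1 := hE.k₁_pos; have h2 := hE.k₂_pos; have h3 := sub_pos.2 hE.k₁_lt
  have h : E.kap - E.k₁ = E.k₁ * E.k₁ / (E.k₂ - E.k₁) := by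
    rw [hE.kap_eq]; field_simp; ring
  rw [h, hE.kap_eq]
  field_simp

lemma one_le_del (hE : E.Admissible) {ℓ : ℕ} (hℓ : ℓ ∈ Finset.Icc 1 (E.D - 1)) : 1 ≤ E.del ℓ := by
  obtain ⟨h1, h2⟩ := Finset.mem_Icc.1 hℓ
  induction ℓ, h1 using Nat.le_induction with
  | base => exact hE.del_one.ge
  | succ n hn ih =>
    exact (ih (Finset.mem_Icc.2 ⟨hn, by omega⟩) (by omega)).trans (hE.del_lt n hn h2).le

lemma mem_pairs {i : Σ _ : ℕ, ℕ} (hi : i ∈ E.pairs) :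
    i.1 ∈ Finset.Icc 1 (E.D - 1) ∧ i.2 ∈ E.Idx i.1 := Finset.mem_sigma.1 hi

lemma ratio_eq (k : ℕ) (i : Σ _ : ℕ, ℕ) :
    E.ratio k i = E.q ^ (-((E.dl i.1 i.2 : ℝ) / k + 1 - E.del i.1)) := by
  rw [ratio]; congr 1; ring

lemma exponent₂_nonneg (hE : E.Admissible) {i : Σ _ : ℕ, ℕ} (hi : i ∈ E.pairs) :
    0 ≤ (E.dl i.1 i.2 : ℝ) / E.k₂ + 1 - E.del i.1 := by
  obtain ⟨h1, h2⟩ := mem_pairs hi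
  linarith [hE.del_le_dl _ h1 _ h2]

/-- Since `1/κ = 1/k₁ - 1/k₂`, the condition on `δ_ℓ` gives the decay needed in the first
equation. -/
lemma dl_le_exponent₁ (hE : E.Admissible) {i : Σ _ : ℕ, ℕ} (hi : i ∈ E.pairs) :
    (E.dl i.1 i.2 : ℝ) ≤ E.kap * ((E.dl i.1 i.2 : ℝ) / E.k₁ + 1 - E.del i.1) := by
  have h := hE.exponent₂_nonneg hi
  have hk := hE.kap_pos
  have h2 : (E.dl i.1 i.2 : ℝ) / E.k₁ = E.dl i.1 i.2 / E.k₂ + E.dl i.1 i.2 * E.kap⁻¹ := by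
    rw [inv_kap]; ring
  rw [h2]
  have h3 : E.kap * (E.dl i.1 i.2 * E.kap⁻¹) = E.dl i.1 i.2 := by field_simp
  nlinarith

lemma exponent₁_nonneg (hE : E.Admissible) {i : Σ _ : ℕ, ℕ} (hi : i ∈ E.pairs) :
    0 ≤ (E.dl i.1 i.2 : ℝ) / E.k₁ + 1 - E.del i.1 := by
  have h := hE.dl_le_exponent₁ hi
  have h0 : (0 : ℝ) ≤ E.dl i.1 i.2 := Nat.cast_nonneg _
  exact nonneg_of_mul_nonneg_right (h0.trans h) hE.kap_pos

lemma ratio₁_le (hE : E.Admissible) {i : Σ _ : ℕ, ℕ} (hi : i ∈ E.pairs) : E.ratio E.k₁ i ≤ 1 := by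
  rw [ratio_eq]
  exact Real.rpow_le_one_of_one_le_of_nonpos hE.one_lt_q.le
    (neg_nonpos.2 (hE.exponent₁_nonneg hi))

lemma ratio₂_le (hE : E.Admissible) {i : Σ _ : ℕ, ℕ} (hi : i ∈ E.pairs) : E.ratio E.k₂ i ≤ 1 := by
  rw [ratio_eq]
  exact Real.rpow_le_one_of_one_le_of_nonpos hE.one_lt_q.le
    (neg_nonpos.2 (hE.exponent₂_nonneg hi))

lemma ratio_pos (hE : E.Admissible) (k : ℕ) (i : Σ _ : ℕ, ℕ) : 0 < E.ratio k i :=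
  Real.rpow_pos_of_pos (by linarith [hE.one_lt_q]) _

/-- The factor `q ^ (n (n - 1) / (2 κ))` produced by the `q`-Laplace transform turns the
coefficients of the first equation into those of the second. -/
lemma qratio_mul (hE : E.Admissible) (n : ℕ) :
    qratio E.q E.k₁ n * E.q ^ ((n : ℝ) * (n - 1) / (2 * E.kap)) = qratio E.q E.k₂ n := by
  rw [qratio_eq hE.one_lt_q hE.one_le_k₁,
    qratio_eq hE.one_lt_q (hE.one_le_k₁.trans hE.k₁_lt_k₂.le),
    ← Real.rpow_add (by linarith [hE.one_lt_q])]
  congr 1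
  have h : (n : ℝ) * (n - 1) / (2 * E.kap) = n * (n - 1) / 2 * E.kap⁻¹ := by
    have := hE.kap_pos; field_simp
  have := hE.k₁_pos; have := hE.k₂_pos
  rw [h, inv_kap]
  field_simp
  ring

end Admissible

end Exponents

end

/-! ### The contraction property -/

section

open Filter Topology MeasureTheory Metric

/-- A finite sum of multiples of `ζ` is at most `1/4` for small `ζ`, whatever the signs. -/
lemma exists_small_sum {ι : Type*} (s : Finset ι) (a : ι → ℝ) :
    ∃ ζ₀ : ℝ, 0 < ζ₀ ∧ ∀ ζ : ℝ, 0 ≤ ζ → ζ ≤ ζ₀ → ∑ i ∈ s, a i * ζ ≤ 1 / 4 := by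
  have h0 : 0 ≤ ∑ i ∈ s, |a i| := Finset.sum_nonneg fun i _ => abs_nonneg _
  refine ⟨1 / (4 * (1 + ∑ i ∈ s, |a i|)), by positivity, fun ζ hζ hζ' => ?_⟩
  rw [le_div_iff₀ (by positivity)] at hζ'
  have h1 : ∑ i ∈ s, a i * ζ ≤ (∑ i ∈ s, |a i|) * ζ := by
    rw [Finset.sum_mul]
    exact Finset.sum_le_sum fun i _ => mul_le_mul_of_nonneg_right (le_abs_self _) hζ
  nlinarith

namespace Exponents

variable {E : Exponents} {β μ ε₀ : ℝ} {Q : ℂ[X]} {R : ℕ → ℂ[X]} {V O : Set ℂ} {Φ : ℂ → ℝ}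

/-- The operator is a contraction as soon as the norms of the functions `C_{j,ℓ}` are small. -/
lemma exists_contractionData (hE : E.Admissible) (hP : E.PolyOK μ Q R) (hβ : 0 < β)
    (dom : WeightedDomain V O Φ) {a : ℂ → ℝ → ℂ} {c₀ : ℝ} {k : ℕ}
    {b : (Σ _ : ℕ, ℕ) → ℂ → ℝ → ℂ} (hc₀ : 0 < c₀) (hc₀' : c₀ ≤ 1)
    (hk : ∀ i ∈ E.pairs, E.ratio k i ≤ 1)
    (a_cont : ContinuousOn (fun p : ℂ × ℝ => a p.1 p.2) (V ×ˢ Set.univ))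
    (a_hol : ∀ m, DifferentiableOn ℂ (fun τ => a τ m) O)
    (a_le : ∀ τ ∈ V, ∀ m, ‖a τ m‖ * Φ (c₀ * τ) ≤ 1 / 4 * Φ τ)
    (b_cont : ∀ i ∈ E.pairs, ContinuousOn (fun p : ℂ × ℝ => b i p.1 p.2) (V ×ˢ Set.univ))
    (b_hol : ∀ i ∈ E.pairs, ∀ m, DifferentiableOn ℂ (fun τ => b i τ m) O)
    (b_le : ∀ i ∈ E.pairs, ∃ A : ℝ, ∀ τ ∈ V, ∀ m,
      ‖b i τ m‖ * (1 + |m|) ^ (R E.D).natDegree * Φ (E.ratio k i * τ) ≤ A * Φ τ) :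
    ∃ ζ₀ : ℝ, 0 < ζ₀ ∧ ∀ ζ : ℝ, 0 ≤ ζ → ζ ≤ ζ₀ → ∀ C : ℕ → ℕ → ℝ → ℂ → ℂ,
      E.CoeffOK β μ ε₀ (fun _ _ => ζ) C → ∃ A M B : (Σ _ : ℕ, ℕ) → ℝ,
      ContractionData V O Φ β μ ε₀ ζ (R E.D).natDegree E.pairs a c₀ b (E.ratio k)
        (fun i => R i.1) E.epsPow (fun i => C i.1 i.2) A M B := by
  have hdeg : ∀ i ∈ E.pairs, (R i.1).natDegree ≤ (R E.D).natDegree := fun i hi =>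
    hP.deg_R_le _ (Admissible.mem_pairs hi).1
  have hA : ∀ i, ∃ A : ℝ, i ∈ E.pairs → ∀ τ ∈ V, ∀ m,
      ‖b i τ m‖ * (1 + |m|) ^ (R E.D).natDegree * Φ (E.ratio k i * τ) ≤ A * Φ τ := fun i => by
    by_cases hi : i ∈ E.pairs
    · obtain ⟨A, hA⟩ := b_le i hi; exact ⟨A, fun _ => hA⟩
    · exact ⟨0, fun h => absurd h hi⟩
  have hM : ∀ i, ∃ M : ℝ, i ∈ E.pairs → 0 < M ∧ ∀ (ζ B : ℝ) (h₁ h₂ : ℝ → ℂ), 0 ≤ ζ → 0 ≤ B →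
      (∀ m, ‖h₁ m‖ ≤ ζ * decay β μ m) → (∀ m, ‖h₂ m‖ ≤ B * decay β μ m) →
      ∀ m, ‖conv (R i.1) h₁ h₂ m‖ ≤
        M * ζ * B * ((1 + |m|) ^ (R E.D).natDegree * decay β μ m) := fun i => by
    by_cases hi : i ∈ E.pairs
    · obtain ⟨M, hM⟩ := exists_norm_conv_le (R i.1) (hdeg i hi) hβ.le hP.deg_lt_mu
      exact ⟨M, fun _ => hM⟩
    · exact ⟨0, fun h => absurd h hi⟩
  choose A hA using hA
  choose M hM using hM
  obtain ⟨ζ₀, hζ₀, hsmall⟩ := exists_small_sum E.pairs fun i => A i * ε₀ ^ E.epsPow i * M i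
  refine ⟨ζ₀, hζ₀, fun ζ hζ hζ' C hC => ⟨A, M, fun i => ε₀ ^ E.epsPow i, ?_⟩⟩
  have hC' : ∀ i ∈ E.pairs, _ := fun i hi =>
    hC i.1 (Admissible.mem_pairs hi).1 i.2 (Admissible.mem_pairs hi).2
  exact
    { dom, a_cont, a_hol, a_le, b_cont, b_hol
      β_nonneg := hβ.le
      lt_μ := hP.deg_lt_mu
      ζ_nonneg := hζ
      c₀_pos := hc₀
      c₀_le := hc₀'
      c_pos := fun i _ => hE.ratio_pos k i
      c_le := hk
      b_le := hA
      deg_le := hdeg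
      M_nonneg := fun i hi => (hM i hi).1.le
      conv_le := fun i hi => (hM i hi).2
      C_cont := fun i hi ε hε => ((hC' i hi).1 ε hε).1
      C_le := fun i hi ε hε => ((hC' i hi).1 ε hε).2
      C_hol := fun i hi => (hC' i hi).2
      E_le := fun i _ ε hε => by
        rw [norm_pow]
        exact pow_le_pow_left₀ (norm_nonneg _) (mem_ball_zero_iff.1 hε).le _
      small := hsmall ζ hζ hζ' }

/-- The weighted domain of the first equation. -/
lemma weightedDomain₁ {d θ ρ δ q k α c₀ : ℝ} (hρ : 0 < ρ) (hc₀ : 0 < c₀)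
    (h : ∀ τ ∈ sector d θ ∪ ball 0 ρ, c₀ ≤ ‖τ + (δ : ℂ)‖) :
    (∀ τ ∈ sector d θ ∪ closedBall 0 ρ, c₀ ≤ ‖τ + (δ : ℂ)‖) ∧
    WeightedDomain (sector d θ ∪ closedBall 0 ρ) (sector d θ ∪ ball 0 ρ)
      (fun τ => growth q k α ‖τ + (δ : ℂ)‖) := by
  have hcl : ∀ τ ∈ closedBall (0 : ℂ) ρ, c₀ ≤ ‖τ + (δ : ℂ)‖ := by
    have h1 : IsClosed {τ : ℂ | c₀ ≤ ‖τ + (δ : ℂ)‖} :=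
      isClosed_le continuous_const (by fun_prop)
    have h2 := closure_minimal (s := ball (0 : ℂ) ρ) (fun τ hτ => h τ (Or.inr hτ)) h1
    rw [closure_ball _ hρ.ne'] at h2
    exact h2
  have hall : ∀ τ ∈ sector d θ ∪ closedBall 0 ρ, c₀ ≤ ‖τ + (δ : ℂ)‖ :=
    fun τ hτ => hτ.elim (fun hτ => h τ (Or.inl hτ)) (hcl τ)
  refine ⟨hall, (isOpen_sector d θ).union isOpen_ball,
    Set.union_subset_union_right _ ball_subset_closedBall, fun τ _ => growth_pos _ _ _ _, ?_,
    fun c hc hc1 τ hτ => ?_, fun c hc hc1 τ hτ => ?_⟩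
  · refine (continuousOn_growth q k α).comp (f := fun τ : ℂ => ‖τ + (δ : ℂ)‖) (by fun_prop)
      fun τ hτ => ?_
    exact (hc₀.trans_le (hall τ hτ)).ne'
  · refine hτ.imp (mul_mem_sector hc) fun hτ => ?_
    rw [mem_closedBall_zero_iff] at hτ ⊢
    rw [norm_mul, Complex.norm_real, Real.norm_of_nonneg hc.le]
    exact (mul_le_of_le_one_left (norm_nonneg _) hc1).trans hτ
  · exact hτ.imp (mul_mem_sector hc) (mul_mem_ball hc hc1)

/-- The weighted domain of the second equation. -/
lemma weightedDomain₂ {d θS θb ρb q k ν : ℝ} :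
    WeightedDomain (sector d θS ∪ closedFiniteSector d θb ρb)
      (sector d θS ∪ finiteSector d θb ρb) (fun τ => growth q k ν ‖τ‖) := by
  refine ⟨(isOpen_sector _ _).union (isOpen_finiteSector _ _ _),
    Set.union_subset_union_right _ fun τ hτ => ⟨subset_closure hτ, hτ.1.1⟩,
    fun τ _ => growth_pos _ _ _ _, ?_, fun c hc hc1 τ hτ => ?_, fun c hc hc1 τ hτ => ?_⟩
  · refine (continuousOn_growth q k ν).comp (f := fun τ : ℂ => ‖τ‖) (by fun_prop) fun τ hτ => ?_
    rcases hτ with hτ | hτ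
    · exact norm_ne_zero_iff.2 hτ.1
    · exact norm_ne_zero_iff.2 hτ.2
  · exact hτ.imp (mul_mem_sector hc) (mul_mem_closedFiniteSector hc hc1)
  · exact hτ.imp (mul_mem_sector hc) (mul_mem_finiteSector hc hc1)

lemma continuous_coefA (hQ : ∀ m, evI Q m ≠ 0) (RD : ℂ[X]) (k : ℕ) :
    Continuous (fun p : ℂ × ℝ => E.coefA Q RD k p.1 p.2) := by
  have h1 := continuous_evI Q
  have h2 := continuous_evI RD
  unfold coefA
  exact ((((h2.comp continuous_snd).div (h1.comp continuous_snd) fun p => hQ _)).mul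
    continuous_const).mul (continuous_fst.pow _)

lemma continuous_coefB (hQ : ∀ m, evI Q m ≠ 0) (k : ℕ) (i : Σ _ : ℕ, ℕ) :
    Continuous (fun p : ℂ × ℝ => E.coefB Q k i p.1 p.2) := by
  have h1 := continuous_evI Q
  unfold coefB
  exact (((h1.comp continuous_snd).inv₀ fun p => hQ _).mul continuous_const).mul
    (continuous_fst.pow _)

/-- The first equation: the condition on `sup |R_D(im)| / |Q(im)|` makes the dilation term
contracting, the smallness of the `C_{j,ℓ}` takes care of the convolution terms. -/
theorem contraction₁ (hE : E.Admissible) (α : ℝ) {d θ ρ δ c₀ : ℝ} (hρ : 0 < ρ) (hδ : 0 < δ)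
    (hc₀ : 0 < c₀) (hdom : ∀ τ ∈ sector d θ ∪ ball 0 ρ, c₀ ≤ ‖τ + (δ : ℂ)‖) :
    ∃ c : ℝ, 0 < c ∧ ∀ (β μ ε₀ : ℝ) (Q : ℂ[X]) (R : ℕ → ℂ[X]), 0 < β →
      E.PolyOK μ Q R → (∀ m : ℝ, ‖evI (R E.D) m‖ ≤ c * ‖evI Q m‖) →
      ∃ ζ₀ : ℝ, 0 < ζ₀ ∧ ∀ ζ : ℝ, 0 ≤ ζ → ζ ≤ ζ₀ → ∀ C : ℕ → ℕ → ℝ → ℂ → ℂ,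
      E.CoeffOK β μ ε₀ (fun _ _ => ζ) C → ∃ A M B : (Σ _ : ℕ, ℕ) → ℝ,
      ContractionData (sector d θ ∪ closedBall 0 ρ) (sector d θ ∪ ball 0 ρ)
        (fun τ => growth E.q E.kap α ‖τ + (δ : ℂ)‖) β μ ε₀ ζ (R E.D).natDegree E.pairs
        (E.coefA Q (R E.D) E.k₁) (E.q ^ (-(E.dD : ℝ) / E.kap)) (E.coefB Q E.k₁) (E.ratio E.k₁)
        (fun i => R i.1) E.epsPow (fun i => C i.1 i.2) A M B := by
  have hκ := hE.kap_pos
  have hq := hE.one_lt_q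
  obtain ⟨hfar, hW⟩ := weightedDomain₁ (q := E.q) (k := E.kap) (α := α) hρ hc₀ hdom
  have hD0 : 0 ≤ (E.dD : ℝ) / E.kap := div_nonneg (Nat.cast_nonneg _) hκ.le
  obtain ⟨K, hK, hKle⟩ := growth_shift_dilate (a := α) (n := E.dD) hq hκ hD0
    (by rw [mul_div_cancel₀ _ hκ.ne']) hδ.le hc₀
  have hr := qratio_pos (k := E.k₁) hq E.dD
  -- `K` bounds `|τ| ^ d_D` times the dilation by `q ^ (-d_D / κ)`, for which the exponents balance
  -- exactly; hence the operator norm of the dilation term is at most `1/4`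
  refine ⟨1 / (4 * qratio E.q E.k₁ E.dD * K), by positivity,
    fun β μ ε₀ Q R hβ hP hsup => ?_⟩
  have hc1 : 0 < E.q ^ (-(E.dD : ℝ) / E.kap) := Real.rpow_pos_of_pos (by linarith) _
  have hc2 : E.q ^ (-(E.dD : ℝ) / E.kap) ≤ 1 :=
    Real.rpow_le_one_of_one_le_of_nonpos hq.le (by rw [neg_div]; linarith)
  refine exists_contractionData hE hP hβ hW hc1 hc2 (fun i hi => hE.ratio₁_le hi)
    (continuous_coefA hP.Q_ne _ _).continuousOn (fun m => by unfold coefA; fun_prop)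
    (fun τ hτ m => ?_) (fun i _ => (continuous_coefB hP.Q_ne _ _).continuousOn)
    (fun i _ m => by unfold coefB; fun_prop) fun i hi => ?_
  · have h1 := hKle τ (hfar τ hτ)
    rw [← neg_div, dil] at h1
    have h2 := h1 (hfar _ (hW.dilV _ hc1 hc2 τ hτ))
    have h3 : ‖evI (R E.D) m‖ / ‖evI Q m‖ ≤ 1 / (4 * qratio E.q E.k₁ E.dD * K) := by
      rw [div_le_iff₀ (norm_pos_iff.2 (hP.Q_ne m))]; exact hsup m
    have h4 := growth_pos E.q E.kap α
      ‖((E.q ^ (-(E.dD : ℝ) / E.kap) : ℝ) : ℂ) * τ + (δ : ℂ)‖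
    rw [coefA, norm_mul, norm_mul, norm_div, Complex.norm_real, Real.norm_of_nonneg hr.le, norm_pow]
    calc _ = ‖evI (R E.D) m‖ / ‖evI Q m‖ * qratio E.q E.k₁ E.dD * (‖τ‖ ^ E.dD *
          growth E.q E.kap α ‖((E.q ^ (-(E.dD : ℝ) / E.kap) : ℝ) : ℂ) * τ + (δ : ℂ)‖) := by ring
      _ ≤ 1 / (4 * qratio E.q E.k₁ E.dD * K) * qratio E.q E.k₁ E.dD *
          (K * growth E.q E.kap α ‖τ + (δ : ℂ)‖) := by gcongr
      _ = _ := by field_simp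
  · obtain ⟨K', hK', hle⟩ := growth_shift_dilate (a := α) (n := E.dl i.1 i.2) hq hκ
      (hE.exponent₁_nonneg hi) (hE.dl_le_exponent₁ hi) hδ.le hc₀
    obtain ⟨cQ, hcQ, hQle⟩ := exists_le_norm_evI hP.Q_ne
    have hr' : 0 < qratio E.q E.k₁ (E.dl i.1 i.2) / Real.sqrt (2 * Real.pi) :=
      div_pos (qratio_pos hq _) (by positivity)
    refine ⟨cQ⁻¹ * (qratio E.q E.k₁ (E.dl i.1 i.2) / Real.sqrt (2 * Real.pi)) * K',
      fun τ hτ m => ?_⟩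
    have h1 := hle τ (hfar τ hτ)
    rw [dil, ← Admissible.ratio_eq] at h1
    have h2 := h1 (hfar _ (hW.dilV _ (hE.ratio_pos _ _) (hE.ratio₁_le hi) τ hτ))
    have hm : (1 : ℝ) ≤ 1 + |m| := by linarith [abs_nonneg m]
    have h3 : ‖evI Q m‖⁻¹ * (1 + |m|) ^ (R E.D).natDegree ≤ cQ⁻¹ := by
      rw [inv_mul_le_iff₀ (norm_pos_iff.2 (hP.Q_ne m)), ← div_eq_mul_inv, le_div_iff₀ hcQ, mul_comm]
      exact le_trans (mul_le_mul_of_nonneg_left (pow_le_pow_right₀ hm hP.deg_RD_le) hcQ.le)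
        (hQle m)
    have h4 := growth_pos E.q E.kap α ‖((E.ratio E.k₁ i : ℝ) : ℂ) * τ + (δ : ℂ)‖
    rw [coefB, norm_mul, norm_mul, norm_inv, Complex.norm_real, Real.norm_of_nonneg hr'.le,
      norm_pow]
    calc _ = (‖evI Q m‖⁻¹ * (1 + |m|) ^ (R E.D).natDegree) *
          (qratio E.q E.k₁ (E.dl i.1 i.2) / Real.sqrt (2 * Real.pi)) * (‖τ‖ ^ E.dl i.1 i.2 *
          growth E.q E.kap α ‖((E.ratio E.k₁ i : ℝ) : ℂ) * τ + (δ : ℂ)‖) := by ring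
      _ ≤ cQ⁻¹ * (qratio E.q E.k₁ (E.dl i.1 i.2) / Real.sqrt (2 * Real.pi)) *
          (K' * growth E.q E.kap α ‖τ + (δ : ℂ)‖) := by gcongr
      _ = _ := by ring

/-- The distance condition to the roots of `P_m` bounds `|P_m(τ)|` from below. -/
lemma le_norm_P (hE : E.Admissible) (hP : E.PolyOK μ Q R) {M₁ : ℝ} (hM₁ : 0 < M₁) {Y : Set ℂ}
    (h : ∀ m : ℝ, ∀ z : ℂ, E.P Q (R E.D) m z = 0 → ∀ τ ∈ Y, M₁ * (1 + ‖τ‖) ≤ ‖τ - z‖) :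
    ∃ c : ℝ, 0 < c ∧ ∀ τ ∈ Y, ∀ m,
      c * ((1 + |m|) ^ (R E.D).natDegree * (1 + ‖τ‖) ^ E.dD) ≤ ‖E.P Q (R E.D) m τ‖ := by
  obtain ⟨cR, hcR, hRle⟩ := exists_le_norm_evI hP.RD_ne
  have hf := qfac_pos (k := E.k₂) hE.one_lt_q (E.dD + E.k₂)
  refine ⟨cR / qfac E.q E.k₂ (E.dD + E.k₂) * M₁ ^ E.dD, by positivity, fun τ hτ m => ?_⟩
  set b : ℂ := evI (R E.D) m / (qfac E.q E.k₂ (E.dD + E.k₂) : ℂ) with hb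
  set a : ℂ := evI Q m / (qfac E.q E.k₂ E.k₂ : ℂ) with ha
  have hb0 : b ≠ 0 := div_ne_zero (hP.RD_ne m) (Complex.ofReal_ne_zero.2 hf.ne')
  set p : ℂ[X] := Polynomial.C (-b) * X ^ E.dD + Polynomial.C a with hp
  have hev : ∀ z, p.eval z = E.P Q (R E.D) m z := fun z => by
    simp [hp, P, ha, hb]; ring
  have hdD : E.dD ≠ 0 := by have := hE.one_le_dD; omega
  have hnat : p.natDegree = E.dD := by
    rw [hp, natDegree_add_C, natDegree_C_mul_X_pow _ _ (neg_ne_zero.2 hb0)]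
  have hlead : p.leadingCoeff = -b := by
    rw [leadingCoeff, hnat, hp]
    simp [coeff_C, hdD]
  have hp0 : p ≠ 0 := fun h0 => by simp [h0] at hlead; exact hb0 hlead
  have hroots : Multiset.card p.roots = E.dD := by
    rw [← hnat]; exact (IsAlgClosed.splits p).natDegree_eq_card_roots.symm
  have h1 := prod_le_norm_eval p τ (fun _ => M₁ * (1 + ‖τ‖)) fun r hr =>
    ⟨by positivity, h m r (by rw [← hev]; exact (mem_roots hp0).1 hr) τ hτ⟩
  rw [Multiset.map_const', Multiset.prod_replicate, hroots, hlead, hev, norm_neg, hb, norm_div,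
    Complex.norm_real, Real.norm_of_nonneg hf.le, mul_pow] at h1
  refine le_trans ?_ h1
  calc _ = cR * (1 + |m|) ^ (R E.D).natDegree / qfac E.q E.k₂ (E.dD + E.k₂) *
        (M₁ ^ E.dD * (1 + ‖τ‖) ^ E.dD) := by ring
    _ ≤ _ := by gcongr; exact hRle m

/-- The lower bound of `P_m`, read as an upper bound for `1 / P_m`. -/
lemma norm_coefP_le {c : ℝ} {V : Set ℂ} (hc : 0 < c)
    (h : ∀ τ ∈ V, ∀ m, c * ((1 + |m|) ^ (R E.D).natDegree * (1 + ‖τ‖) ^ E.dD) ≤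
      ‖E.P Q (R E.D) m τ‖) {τ : ℂ} (hτ : τ ∈ V) (m : ℝ) :
    E.P Q (R E.D) m τ ≠ 0 ∧
      (1 + |m|) ^ (R E.D).natDegree * (1 + ‖τ‖) ^ E.dD / ‖E.P Q (R E.D) m τ‖ ≤ c⁻¹ := by
  have h1 := h τ hτ m
  have h2 : 0 < ‖E.P Q (R E.D) m τ‖ := lt_of_lt_of_le (by positivity) h1
  refine ⟨norm_pos_iff.1 h2, ?_⟩
  rwa [div_le_iff₀ h2, inv_mul_eq_div, le_div_iff₀ hc, mul_comm]

lemma continuous_P (Q RD : ℂ[X]) : Continuous fun p : ℂ × ℝ => E.P Q RD p.2 p.1 := by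
  have h1 := continuous_evI Q
  have h2 := continuous_evI RD
  unfold P
  exact ((h1.comp continuous_snd).div_const _).sub
    (((h2.comp continuous_snd).div_const _).mul (continuous_fst.pow _))

lemma differentiable_P (Q RD : ℂ[X]) (m : ℝ) : Differentiable ℂ fun τ => E.P Q RD m τ := by
  unfold P; fun_prop

/-- The second equation: the lower bound of `P_m` compensates the powers of `τ`, and there is no
dilation term. -/
theorem contraction₂ (hE : E.Admissible) (ν : ℝ) (hP : E.PolyOK μ Q R) (hβ : 0 < β)
    {d θS θb ρb c : ℝ} (hc : 0 < c)
    (h : ∀ τ ∈ sector d θS ∪ closedFiniteSector d θb ρb, ∀ m,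
      c * ((1 + |m|) ^ (R E.D).natDegree * (1 + ‖τ‖) ^ E.dD) ≤ ‖E.P Q (R E.D) m τ‖) :
    ∃ ζ₀ : ℝ, 0 < ζ₀ ∧ ∀ ζ : ℝ, 0 ≤ ζ → ζ ≤ ζ₀ → ∀ C : ℕ → ℕ → ℝ → ℂ → ℂ,
      E.CoeffOK β μ ε₀ (fun _ _ => ζ) C → ∃ A M B : (Σ _ : ℕ, ℕ) → ℝ,
      ContractionData (sector d θS ∪ closedFiniteSector d θb ρb)
        (sector d θS ∪ finiteSector d θb ρb)
        (fun τ => growth E.q E.k₂ ν ‖τ‖) β μ ε₀ ζ (R E.D).natDegree E.pairs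
        (fun _ _ => 0) 1 (E.coefB₂ Q (R E.D)) (E.ratio E.k₂)
        (fun i => R i.1) E.epsPow (fun i => C i.1 i.2) A M B := by
  have hq := hE.one_lt_q
  have hW := weightedDomain₂ (d := d) (θS := θS) (θb := θb) (ρb := ρb) (q := E.q) (k := E.k₂)
    (ν := ν)
  refine exists_contractionData hE hP hβ hW one_pos le_rfl (fun i hi => hE.ratio₂_le hi)
    continuousOn_const (fun m => differentiableOn_const _) (fun τ hτ m => ?_) (fun i _ => ?_)
    (fun i _ m => ?_) fun i hi => ?_
  · have := hW.pos τ hτ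
    rw [norm_zero, zero_mul]; positivity
  · unfold coefB₂
    exact continuousOn_const.mul ((continuous_fst.pow _).continuousOn.div
      (continuous_P _ _).continuousOn fun p hp => (norm_coefP_le hc h hp.1 p.2).1)
  · unfold coefB₂
    refine DifferentiableOn.const_mul (DifferentiableOn.div (by fun_prop)
      (differentiable_P _ _ _).differentiableOn fun τ hτ =>
        (norm_coefP_le hc h (hW.subset hτ) m).1) _
  · set n := E.dl i.1 i.2 with hn
    set γ := (n : ℝ) / E.k₂ + 1 - E.del i.1 with hγ
    set K := Real.exp (E.k₂ * γ ^ 2 * Real.log E.q / 2 - ν * γ * Real.log E.q) with hK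
    have hf : 0 < qfac E.q E.k₂ (n + E.k₂) * Real.sqrt (2 * Real.pi) :=
      mul_pos (qfac_pos hq _) (by positivity)
    refine ⟨(qfac E.q E.k₂ (n + E.k₂) * Real.sqrt (2 * Real.pi))⁻¹ * K * c⁻¹,
      fun τ hτ m => ?_⟩
    obtain ⟨hP0, hPle⟩ := norm_coefP_le hc h hτ m
    have hτ0 : 0 < ‖τ‖ := by
      rcases hτ with hτ | hτ
      · exact norm_pos_iff.2 hτ.1
      · exact norm_pos_iff.2 hτ.2
    have hgr := hW.pos τ hτ
    have hg := growth_dilate (k := E.k₂) (a := ν) (γ := γ) hq hτ0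
    -- the net power of `|τ|` is `k₂ (δ_ℓ - 1)`, which lies between `0` and `d_D`
    have hk₂ := hE.k₂_pos
    have hpw : ‖τ‖ ^ n * ‖τ‖ ^ (-(E.k₂ * γ)) ≤ (1 + ‖τ‖) ^ E.dD := by
      have h1 : (1 : ℝ) ≤ E.del i.1 := by
        exact_mod_cast hE.one_le_del (Admissible.mem_pairs hi).1
      have h2 := hE.del_le_dD _ (Admissible.mem_pairs hi).1
      have h3 : (n : ℝ) + -(E.k₂ * γ) = E.k₂ * ((E.del i.1 : ℝ) - 1) := by
        rw [hγ]; field_simp; ring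
      have h4 : (n : ℝ) + -(E.k₂ * γ) ≤ E.dD := by
        rw [h3]
        have : ((E.dD : ℝ) - 1) / E.k₂ * E.k₂ = E.dD - 1 := by field_simp
        nlinarith
      have h5 : 0 ≤ (n : ℝ) + -(E.k₂ * γ) := by
        rw [h3]; exact mul_nonneg hk₂.le (by linarith)
      rw [← Real.rpow_natCast ‖τ‖ n, ← Real.rpow_add hτ0, ← Real.rpow_natCast (1 + ‖τ‖)]
      exact (Real.rpow_le_rpow hτ0.le (by linarith) h5).trans
        (Real.rpow_le_rpow_of_exponent_le (by linarith) h4)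
    rw [coefB₂, norm_mul, norm_inv, norm_div, Complex.norm_real, Real.norm_of_nonneg hf.le,
      norm_pow, norm_mul, Complex.norm_real, Real.norm_of_nonneg (hE.ratio_pos _ _).le,
      Admissible.ratio_eq, hg]
    calc _ = (qfac E.q E.k₂ (n + E.k₂) * Real.sqrt (2 * Real.pi))⁻¹ * K *
          ((1 + |m|) ^ (R E.D).natDegree * (‖τ‖ ^ n * ‖τ‖ ^ (-(E.k₂ * γ))) /
            ‖E.P Q (R E.D) m τ‖) * growth E.q E.k₂ ν ‖τ‖ := by ring
      _ ≤ (qfac E.q E.k₂ (n + E.k₂) * Real.sqrt (2 * Real.pi))⁻¹ * K *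
          ((1 + |m|) ^ (R E.D).natDegree * (1 + ‖τ‖) ^ E.dD /
            ‖E.P Q (R E.D) m τ‖) * growth E.q E.k₂ ν ‖τ‖ := by gcongr
      _ ≤ _ := by gcongr

end Exponents

end

/-! ### The acceleration of the first equation -/

section

open Filter Topology MeasureTheory Metric

section Linear

variable {q κ d : ℝ} {T : ℂ} {f g : ℂ → ℂ}

lemma qLaplace_congr (h : ∀ r : ℝ, 0 < r →
    f (r * Complex.exp (d * Complex.I)) = g (r * Complex.exp (d * Complex.I))) :
    qLaplace q κ d f T = qLaplace q κ d g T := by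
  rw [qLaplace, qLaplace]
  congr 1
  refine setIntegral_congr_fun measurableSet_Ioi fun r hr => ?_
  simp only [lapIntegrand, h r hr]

lemma qLaplace_add (hf : IntegrableOn (lapIntegrand q κ d f T) (Set.Ioi 0))
    (hg : IntegrableOn (lapIntegrand q κ d g T) (Set.Ioi 0)) :
    qLaplace q κ d (fun u => f u + g u) T = qLaplace q κ d f T + qLaplace q κ d g T := by
  rw [qLaplace, qLaplace, qLaplace, ← mul_add, ← integral_add hf hg]
  simp only [lapIntegrand, add_div]

lemma qLaplace_sum {ι : Type*} (s : Finset ι) {f : ι → ℂ → ℂ}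
    (hf : ∀ i ∈ s, IntegrableOn (lapIntegrand q κ d (f i) T) (Set.Ioi 0)) :
    IntegrableOn (lapIntegrand q κ d (fun u => ∑ i ∈ s, f i u) T) (Set.Ioi 0) ∧
    qLaplace q κ d (fun u => ∑ i ∈ s, f i u) T = ∑ i ∈ s, qLaplace q κ d (f i) T := by
  have h : lapIntegrand q κ d (fun u => ∑ i ∈ s, f i u) T =
      fun r => ∑ i ∈ s, lapIntegrand q κ d (f i) T r := by
    funext r; simp only [lapIntegrand, Finset.sum_div]
  refine ⟨?_, ?_⟩
  · rw [h]; exact integrable_finsetSum s hf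
  · rw [qLaplace, h, integral_finsetSum s hf, Finset.mul_sum]
    rfl

lemma qLaplace_const_mul (c : ℂ) :
    qLaplace q κ d (fun u => c * f u) T = c * qLaplace q κ d f T := by
  have h : lapIntegrand q κ d (fun u => c * f u) T = fun r => c * lapIntegrand q κ d f T r := by
    funext r; simp only [lapIntegrand]; ring
  rw [qLaplace, qLaplace, h, integral_const_mul, mul_left_comm]

lemma conv_const_mul (P : ℂ[X]) (h : ℝ → ℂ) (c : ℂ) (v : ℝ → ℂ) (m : ℝ) :
    conv P h (fun m => c * v m) m = c * conv P h v m := by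
  rw [conv, conv, ← integral_const_mul]
  congr 1; funext m₁; ring

end Linear

lemma measurable_growth (q k a : ℝ) : Measurable (growth q k a) := by
  unfold growth; fun_prop

lemma measurable_lapKer (q k t : ℝ) : Measurable (lapKer q k t) := by
  unfold lapKer
  exact ((measurable_growth q k _).comp (measurable_id.div_const t)).inv.div measurable_id

/-- The shifted weight of order `k < κ` on the ray: its `q`-Laplace transform has
`q`-exponential growth of order `k κ / (κ - k)`. -/
lemma integral_growth_shift_le {q k κ α δ c₀ d : ℝ} (hq : 1 < q) (hk : 0 < k) (hkκ : k < κ)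
    (hδ : 0 ≤ δ) (hc₀ : 0 < c₀)
    (hfar : ∀ r : ℝ, 0 < r → c₀ ≤ ‖(r : ℂ) * Complex.exp (d * Complex.I) + (δ : ℂ)‖) :
    ∃ C : ℝ, 0 < C ∧ ∀ t : ℝ, 0 < t →
      IntegrableOn (fun r : ℝ =>
        growth q k α ‖(r : ℂ) * Complex.exp (d * Complex.I) + (δ : ℂ)‖ * lapKer q κ t r)
        (Set.Ioi 0) ∧
      ∫ r in Set.Ioi (0 : ℝ),
        growth q k α ‖(r : ℂ) * Complex.exp (d * Complex.I) + (δ : ℂ)‖ * lapKer q κ t r ≤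
        C * growth q (k * κ / (κ - k)) (κ * (α - 1 / 2) / (κ - k) + 1 / 2) t := by
  obtain ⟨K, hK, hKle⟩ := growth_shift_le (a := α) hq hk hδ hc₀
  obtain ⟨C, hC, hCle⟩ := growth_mul_lapKer (α := α) hq hkκ
  refine ⟨K * C, by positivity, fun t ht => ?_⟩
  obtain ⟨hi, he⟩ := hCle t ht
  have hle : ∀ r ∈ Set.Ioi (0 : ℝ),
      growth q k α ‖(r : ℂ) * Complex.exp (d * Complex.I) + (δ : ℂ)‖ * lapKer q κ t r ≤
        K * (growth q k α r * lapKer q κ t r) := fun r hr => by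
    have h1 := (hKle (r * Complex.exp (d * Complex.I)) (by rw [norm_ray hr]; exact hr)
      (hfar r hr)).1
    rw [norm_ray hr] at h1
    rw [← mul_assoc]
    exact mul_le_mul_of_nonneg_right h1 (lapKer_nonneg _ _ _ hr)
  have hint : IntegrableOn (fun r : ℝ =>
      growth q k α ‖(r : ℂ) * Complex.exp (d * Complex.I) + (δ : ℂ)‖ * lapKer q κ t r)
      (Set.Ioi 0) := by
    refine (hi.const_mul K).mono' ?_ ?_
    · refine (Measurable.mul ((measurable_growth q k α).comp ?_)
        (measurable_lapKer q κ t)).aestronglyMeasurable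
      fun_prop
    · refine (ae_restrict_iff' measurableSet_Ioi).2 (Eventually.of_forall fun r hr => ?_)
      rw [Real.norm_of_nonneg (mul_nonneg (growth_pos _ _ _ _).le (lapKer_nonneg _ _ _ hr))]
      exact hle r hr
  refine ⟨hint, (setIntegral_mono_on hint (hi.const_mul K) measurableSet_Ioi hle).trans ?_⟩
  rw [integral_const_mul, he, mul_assoc]

/-- The shifted weight of order `κ` on the ray: its `q`-Laplace transform is bounded on a disc. -/
lemma integral_growth_shift_le_const {q κ α δ c₀ d : ℝ} (hq : 1 < q) (hκ : 0 < κ)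
    (hδ : 0 ≤ δ) (hc₀ : 0 < c₀)
    (hfar : ∀ r : ℝ, 0 < r → c₀ ≤ ‖(r : ℂ) * Complex.exp (d * Complex.I) + (δ : ℂ)‖) :
    ∃ C : ℝ, 0 < C ∧ ∀ t : ℝ, 0 < t → t ≤ q ^ ((1 / 2 - α) / κ) / 2 →
      IntegrableOn (fun r : ℝ =>
        growth q κ α ‖(r : ℂ) * Complex.exp (d * Complex.I) + (δ : ℂ)‖ * lapKer q κ t r)
        (Set.Ioi 0) ∧
      ∫ r in Set.Ioi (0 : ℝ),
        growth q κ α ‖(r : ℂ) * Complex.exp (d * Complex.I) + (δ : ℂ)‖ * lapKer q κ t r ≤ C := by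
  obtain ⟨K, hK, hKle⟩ := growth_shift_le (a := α) hq hκ hδ hc₀
  refine integral_mul_lapKer_le hq hκ hK.le
    (((measurable_growth q κ α).comp (by fun_prop)).aestronglyMeasurable)
    (fun r _ => (growth_pos _ _ _ _).le) (fun r hr hr1 => ?_) (fun r hr => ?_)
  · exact (hKle _ (by rw [norm_ray hr]; exact hr) (hfar r hr)).2 (by rw [norm_ray hr]; exact hr1)
  · have h1 := (hKle _ (by rw [norm_ray hr]; exact hr) (hfar r hr)).1
    rwa [norm_ray hr] at h1

namespace Exponents

variable {E : Exponents} {β μ ε₀ ζ B B' : ℝ} {N : ℕ} {Q : ℂ[X]} {R : ℕ → ℂ[X]} {V O : Set ℂ}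
  {Φ : ℂ → ℝ} {C : ℕ → ℕ → ℝ → ℂ → ℂ} {A M S : (Σ _ : ℕ, ℕ) → ℝ}

/-- The `q`-Laplace transform turns the first equation into the second one: it maps
`τ ^ n • σ_q ^ γ` to `q ^ (n (n - 1) / (2 κ)) τ ^ n • σ_q ^ (γ + n / κ)`, and it commutes with the
convolution in `m`. -/
theorem accel_solves (hE : E.Admissible) (hQ : ∀ m, evI Q m ≠ 0)
    (h : ContractionData V O Φ β μ ε₀ ζ N E.pairs (E.coefA Q (R E.D) E.k₁)
      (E.q ^ (-(E.dD : ℝ) / E.kap)) (E.coefB Q E.k₁) (E.ratio E.k₁) (fun i => R i.1) E.epsPow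
      (fun i => C i.1 i.2) A M S) {d δt : ℝ} (hδt : 0 < δt)
    (hray : ∀ r : ℝ, 0 < r → (r : ℂ) * Complex.exp (d * Complex.I) ∈ V)
    {ψ w : ℂ → ℝ → ℂ → ℂ} (hB : 0 ≤ B)
    (hψ : InFamily V O Φ β μ ε₀ B' (fun τ m ε => (evI Q m)⁻¹ * ψ τ m ε))
    (hw : InFamily V O Φ β μ ε₀ B w) {ε : ℂ} (hε : ε ∈ ball (0 : ℂ) ε₀)
    (heq : ∀ τ ∈ V, ∀ m, w τ m ε = (evI Q m)⁻¹ * ψ τ m ε +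
      E.linPart Q R (fun ℓ j m => C ℓ j m ε) ε E.k₁ (E.q ^ (-(E.dD : ℝ) / E.kap))
        (fun τ m => w τ m ε) τ m)
    {T : ℂ} (hT : T ∈ lapDomain d δt)
    (hI : IntegrableOn (fun r : ℝ => Φ (r * Complex.exp (d * Complex.I)) * lapKer E.q E.kap ‖T‖ r)
      (Set.Ioi 0)) (m : ℝ) :
    E.accel d w T m ε = (evI Q m)⁻¹ * E.accel d ψ T m ε +
      E.linPart Q R (fun ℓ j m => C ℓ j m ε) ε E.k₂ 1 (fun τ m => E.accel d w τ m ε) T m := by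
  have hq := hE.one_lt_q
  have hκ := hE.kap_pos
  have hT0 : T ≠ 0 := hT.1
  have hr : ∀ n, (qratio E.q E.k₁ n : ℂ) * ((E.q ^ ((n : ℝ) * (n - 1) / (2 * E.kap)) : ℝ) : ℂ) =
      (qratio E.q E.k₂ n : ℂ) := fun n => by
    rw [← Complex.ofReal_mul, hE.qratio_mul]
  obtain ⟨_, -, hlap⟩ := laplace_bound hq hκ hδt
  have hint : ∀ {b : ℝ} {u : ℂ → ℝ → ℂ → ℂ}, InFamily V O Φ β μ ε₀ b u →
      IntegrableOn (lapIntegrand E.q E.kap d (fun τ => u τ m ε) T) (Set.Ioi 0) := fun {b u} hu =>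
    (hlap d V Φ β μ b (fun τ m => u τ m ε) (hu.cont ε hε) (hu.bound ε hε) hray m T hT hI).1
  have hdil := h.mem_dil_term hB hw
  have hcv := fun i (hi : i ∈ E.pairs) => h.mem_conv_term hB hw hi
  have hsum := qLaplace_sum E.pairs fun i hi => hint (hcv i hi)
  have hdi := hint hdil
  have hsplit : E.accel d w T m ε = (evI Q m)⁻¹ * E.accel d ψ T m ε +
      (qLaplace E.q E.kap d (fun τ => E.coefA Q (R E.D) E.k₁ τ m *
        w (((E.q ^ (-(E.dD : ℝ) / E.kap) : ℝ) : ℂ) * τ) m ε) T +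
      ∑ i ∈ E.pairs, qLaplace E.q E.kap d (fun τ => E.coefB Q E.k₁ i τ m * ε ^ E.epsPow i *
        conv (R i.1) (fun m => C i.1 i.2 m ε) (fun m => w (E.ratio E.k₁ i * τ) m ε) m) T) := by
    have hs2 : IntegrableOn (lapIntegrand E.q E.kap d (fun τ => E.coefA Q (R E.D) E.k₁ τ m *
        w (((E.q ^ (-(E.dD : ℝ) / E.kap) : ℝ) : ℂ) * τ) m ε + ∑ i ∈ E.pairs,
        E.coefB Q E.k₁ i τ m * ε ^ E.epsPow i *
        conv (R i.1) (fun m => C i.1 i.2 m ε) (fun m => w (E.ratio E.k₁ i * τ) m ε) m) T)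
        (Set.Ioi 0) := by
      have := hdi.add hsum.1
      refine this.congr (Eventually.of_forall fun r => ?_)
      simp only [lapIntegrand, Pi.add_apply, add_div]
    rw [← hsum.2, ← qLaplace_add hdi hsum.1, accel, accel, ← qLaplace_const_mul,
      ← qLaplace_add (hint hψ) hs2]
    exact qLaplace_congr fun r hr => heq _ (hray r hr) m
  rw [hsplit, linPart, dilConvOp]
  congr 2
  · have hf : ∀ τ, E.coefA Q (R E.D) E.k₁ τ m *
        w (((E.q ^ (-(E.dD : ℝ) / E.kap) : ℝ) : ℂ) * τ) m ε =
        (evI (R E.D) m / evI Q m * (qratio E.q E.k₁ E.dD : ℂ)) *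
          (τ ^ E.dD * w (dil E.q (-(E.dD : ℝ) / E.kap) * τ) m ε) := fun τ => by
      rw [coefA, dil]; ring
    simp only [hf]
    rw [qLaplace_const_mul, laplace_shift hq _ _ (fun τ => w τ m ε) hT0, ← add_div, neg_add_cancel,
      zero_div, coefA, ← hr, accel, dil, Real.rpow_zero]
    ring
  · refine Finset.sum_congr rfl fun i hi => ?_
    set n := E.dl i.1 i.2 with hn
    set γ := (E.del i.1 : ℝ) - (n : ℝ) / E.k₁ - 1 with hγ
    have hrat : (E.ratio E.k₁ i : ℂ) = dil E.q γ := rfl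
    have hrat₂ : dil E.q (γ + n / E.kap) = (E.ratio E.k₂ i : ℂ) := by
      rw [dil, ratio, hγ, div_eq_mul_inv _ E.kap, Admissible.inv_kap]
      congr 2; rw [← hn]; ring
    set s : ℂ := ((qratio E.q E.k₁ n / Real.sqrt (2 * Real.pi) : ℝ) : ℂ) with hs
    have hs0 : s ≠ 0 := Complex.ofReal_ne_zero.2
      (div_pos (qratio_pos hq _) (by positivity)).ne'
    have hf : ∀ τ, E.coefB Q E.k₁ i τ m * ε ^ E.epsPow i *
        conv (R i.1) (fun m => C i.1 i.2 m ε) (fun m => w (E.ratio E.k₁ i * τ) m ε) m =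
        ((evI Q m)⁻¹ * s * ε ^ E.epsPow i) * conv (R i.1) (fun m => C i.1 i.2 m ε)
          (fun m => τ ^ n * w (dil E.q γ * τ) m ε) m := fun τ => by
      rw [conv_const_mul, coefB, hrat]; ring
    simp only [hf]
    -- the weight of `τ ^ n w(q ^ γ τ)` is read off from that of the convolution term at `m = 0`
    have hb : InFamily V O Φ β μ ε₀ (‖evI Q 0‖ * ‖s‖⁻¹ * A i * B)
        (fun τ m ε => τ ^ n * w (dil E.q γ * τ) m ε) := by
      refine (ContractionData.mem_dilate h.dom hw (h.c_pos i hi) (h.c_le i hi)).mul hB subset_rfl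
        subset_rfl (a := fun τ _ => τ ^ n) (by fun_prop) (by fun_prop) fun τ hτ _ => ?_
      have h1 := h.b_le i hi τ hτ 0
      have h2 := norm_pos_iff.2 hs0
      have h3 := norm_pos_iff.2 (hQ 0)
      rw [coefB, norm_mul, norm_mul, norm_inv, abs_zero, add_zero, one_pow, mul_one] at h1
      calc _ = ‖evI Q 0‖ * ‖s‖⁻¹ *
            (‖evI Q 0‖⁻¹ * ‖s‖ * ‖τ ^ n‖ * Φ (E.ratio E.k₁ i * τ)) := by field_simp
        _ ≤ ‖evI Q 0‖ * ‖s‖⁻¹ * (A i * Φ τ) := mul_le_mul_of_nonneg_left h1 (by positivity)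
        _ = _ := by ring
    rw [qLaplace_const_mul, laplace_conv hq hκ hδt (h.deg_le i hi) h.β_nonneg h.lt_μ h.ζ_nonneg
      (h.C_cont i hi ε hε) (h.C_le i hi ε hε) (hb.cont ε hε) (hb.bound ε hε) hray hT hI]
    have hsh : ∀ m₁, qLaplace E.q E.kap d (fun u => u ^ n * w (dil E.q γ * u) m₁ ε) T =
        ((E.q ^ ((n : ℝ) * (n - 1) / (2 * E.kap)) : ℝ) : ℂ) * T ^ n *
          E.accel d w (E.ratio E.k₂ i * T) m₁ ε := fun m₁ => by
      rw [laplace_shift hq γ n (fun τ => w τ m₁ ε) hT0, hrat₂, accel]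
    simp only [hsh]
    rw [conv_const_mul, coefB, ← hn, hs]
    push_cast
    rw [← hr n]
    ring

end Exponents

end

/-! ### The accelerated functions -/

section

open Filter Topology MeasureTheory Metric

lemma lapDomain_anti {d δ₁ δ₂ : ℝ} (h : δ₁ ≤ δ₂) : lapDomain d δ₂ ⊆ lapDomain d δ₁ :=
  fun _ hT => ⟨hT.1, fun r hr => h.trans_lt (hT.2 r hr)⟩

/-- The domain of the second equation lies in one of the domains where the `q`-Laplace transform
is estimated uniformly. -/
lemma sectors_subset_lapDomain {d θS θb ρb : ℝ} (hθS : 0 < θS) (hθS' : θS < Real.pi)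
    (hθb : 0 < θb) (hθb' : θb < Real.pi) :
    ∃ c : ℝ, 0 < c ∧ sector d θS ∪ closedFiniteSector d θb ρb ⊆ lapDomain d c := by
  obtain ⟨c₁, h₁, hs₁⟩ := sector_subset_lapDomain (d := d) hθS hθS'
  obtain ⟨c₂, h₂, hs₂⟩ := closure_sector_subset_lapDomain (d := d) hθb hθb'
  refine ⟨min c₁ c₂, lt_min h₁ h₂, Set.union_subset
    (hs₁.trans (lapDomain_anti (min_le_left _ _))) fun τ hτ => ?_⟩
  exact lapDomain_anti (min_le_right _ _)
    (hs₂ ⟨closure_mono Set.inter_subset_left hτ.1, hτ.2⟩)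

/-- The growth factor has a positive lower bound, so that bounded functions belong to the weighted
spaces. -/
lemma exp_neg_le_growth {q k a x : ℝ} (hq : 1 < q) (hk : 0 < k) :
    Real.exp (-(a ^ 2 * Real.log q / (2 * k))) ≤ growth q k a x := by
  have hL := Real.log_pos hq
  refine Real.exp_le_exp.2 ?_
  have h : k * Real.log x ^ 2 / (2 * Real.log q) + a * Real.log x -
      -(a ^ 2 * Real.log q / (2 * k)) =
      k / (2 * Real.log q) * (Real.log x + a * Real.log q / k) ^ 2 := by
    field_simp; ring
  have : 0 ≤ k / (2 * Real.log q) * (Real.log x + a * Real.log q / k) ^ 2 := by positivity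
  linarith

lemma InFamily.mono_bound {V O : Set ℂ} {Φ : ℂ → ℝ} {β μ ε₀ B B' : ℝ} {w : ℂ → ℝ → ℂ → ℂ}
    (hw : InFamily V O Φ β μ ε₀ B w) (hΦ : ∀ τ ∈ V, 0 < Φ τ) (h : B ≤ B') :
    InFamily V O Φ β μ ε₀ B' w :=
  ⟨hw.cont, hw.holτ, hw.holε, fun ε hε τ hτ m => (hw.bound ε hε τ hτ m).trans
    (mul_le_mul_of_nonneg_right h (mul_pos (decay_pos β μ m) (hΦ τ hτ)).le)⟩

namespace Exponents

variable {E : Exponents} {β μ ε₀ ϖ ζψ α d θU θS θb ρb ρ δ c₀ : ℝ} {Q : ℂ[X]} {R : ℕ → ℂ[X]}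
  {F : ℕ → ℝ → ℂ → ℂ} {C : ℕ → ℕ → ℝ → ℂ → ℂ} {ψ w : ℂ → ℝ → ℂ → ℂ}

/-- The exponent `ν` of the growth of the `q`-Laplace transform of order `κ` of a function whose
`q`-exponential growth has order `k₁` and exponent `α`. -/
def nu (E : Exponents) (α : ℝ) : ℝ := E.kap * (α - 1 / 2) / (E.kap - E.k₁) + 1 / 2

lemma ForcingOK.inFamily (hF : E.ForcingOK (sector d θU) ρ δ β μ α ε₀ ζψ F ψ) :
    InFamily (sector d θU ∪ closedBall 0 ρ) (sector d θU ∪ ball 0 ρ)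
      (fun τ => growth E.q E.k₁ α ‖τ + (δ : ℂ)‖) β μ ε₀ ζψ ψ where
  cont ε hε := (hF.psi_mem ε hε).1
  holτ ε hε := (hF.psi_mem ε hε).2.1
  holε := hF.psi_hol
  bound ε hε := (hF.psi_mem ε hε).2.2

/-- The accelerated forcing term is well defined and has growth of order `k₂`. -/
lemma accel_forcing_le (hE : E.Admissible) (hθU : 0 < θU) (hδ : 0 < δ) (hc₀ : 0 < c₀)
    (hfar : ∀ τ ∈ sector d θU ∪ closedBall 0 ρ, c₀ ≤ ‖τ + (δ : ℂ)‖) {δt : ℝ} (hδt : 0 < δt) :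
    ∃ K : ℝ, 0 < K ∧ ∀ (β μ ε₀ ζψ : ℝ) (F : ℕ → ℝ → ℂ → ℂ) (ψ : ℂ → ℝ → ℂ → ℂ), 0 ≤ ζψ →
      E.ForcingOK (sector d θU) ρ δ β μ α ε₀ ζψ F ψ →
      ∀ ε ∈ ball (0 : ℂ) ε₀, ∀ m : ℝ, ∀ τ ∈ lapDomain d δt,
        IntegrableOn (lapIntegrand E.q E.kap d (fun h => ψ h m ε) τ) (Set.Ioi 0) ∧
        ‖E.accel d ψ τ m ε‖ ≤ K * ζψ * (decay β μ m * growth E.q E.k₂ (E.nu α) ‖τ‖) := by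
  have hq := hE.one_lt_q
  have hray : ∀ r : ℝ, 0 < r →
      (r : ℂ) * Complex.exp (d * Complex.I) ∈ sector d θU ∪ closedBall 0 ρ :=
    fun r hr => Or.inl (ray_mem_sector hθU hr)
  obtain ⟨C, hC, hCle⟩ := integral_growth_shift_le (α := α) hq hE.k₁_pos hE.k₁_lt_kap hδ.le hc₀
    fun r hr => hfar _ (hray r hr)
  obtain ⟨K, hK, hKle⟩ := laplace_bound hq hE.kap_pos hδt
  refine ⟨K * C, by positivity, fun β μ ε₀ ζψ F ψ hζ hF ε hε m τ hτ => ?_⟩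
  obtain ⟨h1, h2⟩ := hCle ‖τ‖ (norm_pos_iff.2 hτ.1)
  rw [hE.k₁_mul_kap] at h2
  obtain ⟨h3, h4⟩ := hKle d _ _ β μ ζψ (fun τ m => ψ τ m ε) (hF.inFamily.cont ε hε)
    (hF.inFamily.bound ε hε) hray m τ hτ h1
  have hdec := decay_pos β μ m
  refine ⟨h3, h4.trans ?_⟩
  calc _ ≤ K * (ζψ * decay β μ m * (C * growth E.q E.k₂ (E.nu α) ‖τ‖)) := by gcongr; exact h2
    _ = _ := by ring

/-- The accelerated forcing term is a holomorphic family on every domain inside the slit plane on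
which it satisfies a weighted bound. -/
lemma accel_forcing_inFamily (hE : E.Admissible) (hθU : 0 < θU) (hδ : 0 < δ)
    (hc₀ : 0 < c₀) (hfar : ∀ τ ∈ sector d θU ∪ closedBall 0 ρ, c₀ ≤ ‖τ + (δ : ℂ)‖)
    (hβ : 0 ≤ β) (hμ : 0 ≤ μ) (hζ : 0 ≤ ζψ) (hF : E.ForcingOK (sector d θU) ρ δ β μ α ε₀ ζψ F ψ)
    {V O : Set ℂ} (hV : V ⊆ slit d) (hO : O ⊆ V) {B : ℝ}
    (hB : ∀ ε ∈ ball (0 : ℂ) ε₀, ∀ τ ∈ V, ∀ m,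
      ‖E.accel d ψ τ m ε‖ ≤ B * (decay β μ m * growth E.q E.k₂ (E.nu α) ‖τ‖)) :
    InFamily V O (fun τ => growth E.q E.k₂ (E.nu α) ‖τ‖) β μ ε₀ B (E.accel d ψ) := by
  have hq := hE.one_lt_q
  have hray : ∀ r : ℝ, 0 < r →
      (r : ℂ) * Complex.exp (d * Complex.I) ∈ sector d θU ∪ closedBall 0 ρ :=
    fun r hr => Or.inl (ray_mem_sector hθU hr)
  obtain ⟨C, hC, hCle⟩ := integral_growth_shift_le (α := α) hq hE.k₁_pos hE.k₁_lt_kap hδ.le hc₀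
    fun r hr => hfar _ (hray r hr)
  obtain ⟨h1, h2, h3⟩ := laplace_regular hq hE.kap_pos isOpen_Ioi hμ hβ hζ hF.inFamily
    (fun τ _ => growth_pos _ _ _ _) hray (fun t ht => (hCle t ht).1)
  have hVJ : V ⊆ slitPart d (Set.Ioi 0) := fun τ hτ =>
    ⟨hV hτ, norm_pos_iff.2 (slit_ne_zero (hV hτ))⟩
  exact ⟨fun ε hε => (h1 ε hε).mono (Set.prod_mono hVJ subset_rfl),
    fun ε hε m => (h2 ε hε m).mono (hO.trans hVJ), fun τ hτ => h3 τ (hVJ hτ), hB⟩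

/-- The acceleration of a function of `Exp^d_{(κ,β,μ,α,ρ)}` is bounded on a bounded part of
`ℛ_{d,δ'}`. -/
lemma accel_le (hE : E.Admissible) (hθU : 0 < θU) (hδ : 0 < δ) (hc₀ : 0 < c₀)
    (hfar : ∀ τ ∈ sector d θU ∪ closedBall 0 ρ, c₀ ≤ ‖τ + (δ : ℂ)‖) {δt : ℝ} (hδt : 0 < δt)
    (hϖ : 0 ≤ ϖ) {O : Set ℂ} (hw : InFamily (sector d θU ∪ closedBall 0 ρ) O
      (fun τ => growth E.q E.kap α ‖τ + (δ : ℂ)‖) β μ ε₀ ϖ w) :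
    ∃ B : ℝ, 0 ≤ B ∧ ∀ ε ∈ ball (0 : ℂ) ε₀, ∀ m : ℝ, ∀ τ ∈ lapDomain d δt,
      ‖τ‖ ≤ E.q ^ ((1 / 2 - α) / E.kap) / 2 →
        IntegrableOn (lapIntegrand E.q E.kap d (fun h => w h m ε) τ) (Set.Ioi 0) ∧
        ‖E.accel d w τ m ε‖ ≤ B * decay β μ m := by
  have hq := hE.one_lt_q
  have hray : ∀ r : ℝ, 0 < r →
      (r : ℂ) * Complex.exp (d * Complex.I) ∈ sector d θU ∪ closedBall 0 ρ :=
    fun r hr => Or.inl (ray_mem_sector hθU hr)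
  obtain ⟨C, hC, hCle⟩ := integral_growth_shift_le_const (α := α) hq hE.kap_pos hδ.le hc₀
    fun r hr => hfar _ (hray r hr)
  obtain ⟨K, hK, hKle⟩ := laplace_bound hq hE.kap_pos hδt
  refine ⟨K * (ϖ * C), by positivity, fun ε hε m τ hτ hle => ?_⟩
  obtain ⟨h1, h2⟩ := hCle ‖τ‖ (norm_pos_iff.2 hτ.1) hle
  obtain ⟨h3, h4⟩ := hKle d _ _ β μ ϖ (fun τ m => w τ m ε) (hw.cont ε hε)
    (hw.bound ε hε) hray m τ hτ h1
  have hdec := decay_pos β μ m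
  refine ⟨h3, h4.trans ?_⟩
  calc _ ≤ K * (ϖ * decay β μ m * C) := by gcongr
    _ = _ := by ring

/-- The open set on which the acceleration of `w₁` is first defined. -/
def accelDomain (E : Exponents) (α d : ℝ) : Set ℂ :=
  slitPart d (Set.Ioo 0 (E.q ^ ((1 / 2 - α) / E.kap) / 2))

/-- The acceleration of `w₁` is continuous in `(τ, m)` and holomorphic in `τ` and in `ε`. -/
lemma accel_regular (hE : E.Admissible) (hθU : 0 < θU) (hδ : 0 < δ) (hc₀ : 0 < c₀)
    (hfar : ∀ τ ∈ sector d θU ∪ closedBall 0 ρ, c₀ ≤ ‖τ + (δ : ℂ)‖)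
    (hβ : 0 ≤ β) (hμ : 0 ≤ μ)
    (hϖ : 0 ≤ ϖ) {O : Set ℂ} (hw : InFamily (sector d θU ∪ closedBall 0 ρ) O
      (fun τ => growth E.q E.kap α ‖τ + (δ : ℂ)‖) β μ ε₀ ϖ w) :
    (∀ ε ∈ ball (0 : ℂ) ε₀, ContinuousOn
      (fun p : ℂ × ℝ => E.accel d w p.1 p.2 ε) (E.accelDomain α d ×ˢ Set.univ)) ∧
    (∀ ε ∈ ball (0 : ℂ) ε₀, ∀ m, DifferentiableOn ℂ
      (fun T => E.accel d w T m ε) (E.accelDomain α d)) ∧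
    ∀ T ∈ E.accelDomain α d, ∀ m, DifferentiableOn ℂ
      (fun ε => E.accel d w T m ε) (ball 0 ε₀) := by
  have hray : ∀ r : ℝ, 0 < r →
      (r : ℂ) * Complex.exp (d * Complex.I) ∈ sector d θU ∪ closedBall 0 ρ :=
    fun r hr => Or.inl (ray_mem_sector hθU hr)
  obtain ⟨C, hC, hCle⟩ := integral_growth_shift_le_const (α := α) hE.one_lt_q hE.kap_pos hδ.le hc₀
    fun r hr => hfar _ (hray r hr)
  exact laplace_regular hE.one_lt_q hE.kap_pos isOpen_Ioo hμ hβ hϖ hw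
    (fun _ _ => growth_pos _ _ _ _) hray fun t ht => (hCle t ht.1 ht.2.le).1

lemma subset_accelDomain {δt r₁ : ℝ} (hδt : 0 < δt)
    (hr₁ : r₁ ≤ E.q ^ ((1 / 2 - α) / E.kap) / 2) :
    lapDomain d δt ∩ ball 0 r₁ ⊆ E.accelDomain α d := fun _ hτ =>
  ⟨lapDomain_subset_slit hδt hτ.1, norm_pos_iff.2 hτ.1.1,
    (mem_ball_zero_iff.1 hτ.2).trans_le hr₁⟩

lemma mul_mem_accelDomain {c : ℝ} (hc : 0 < c) (hc1 : c ≤ 1) {τ : ℂ}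
    (hτ : τ ∈ E.accelDomain α d) : (c : ℂ) * τ ∈ E.accelDomain α d := by
  obtain ⟨h1, h2, h3⟩ := hτ
  refine ⟨mul_mem_slit hc h1, ?_⟩
  simp only [Set.mem_preimage, Set.mem_Ioo, norm_mul, Complex.norm_real, Real.norm_of_nonneg hc.le]
  exact ⟨mul_pos hc h2, (mul_le_of_le_one_left h2.le hc1).trans_lt h3⟩

/-- The forcing term of the fixed point form of the first equation. -/
lemma forcing₁_inFamily (hE : E.Admissible) {cQ : ℝ} (hcQ : 0 < cQ) (hQ : ∀ m, cQ ≤ ‖evI Q m‖)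
    (hζ : 0 ≤ ζψ) (hF : E.ForcingOK (sector d θU) ρ δ β μ α ε₀ ζψ F ψ) :
    InFamily (sector d θU ∪ closedBall 0 ρ) (sector d θU ∪ ball 0 ρ)
      (fun τ => growth E.q E.kap α ‖τ + (δ : ℂ)‖) β μ ε₀ (cQ⁻¹ * ζψ)
      (fun τ m ε => (evI Q m)⁻¹ * ψ τ m ε) := by
  have h1 := continuous_evI Q
  refine hF.inFamily.mul hζ subset_rfl subset_rfl (a := fun _ m => (evI Q m)⁻¹)
    ((h1.comp continuous_snd).inv₀ fun p =>
      norm_pos_iff.1 (hcQ.trans_le (hQ _))).continuousOn (fun m => differentiableOn_const _)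
    fun τ _ m => ?_
  have h2 : growth E.q E.k₁ α ‖τ + (δ : ℂ)‖ ≤ growth E.q E.kap α ‖τ + (δ : ℂ)‖ :=
    growth_mono hE.one_lt_q hE.k₁_lt_kap.le
  have h3 := growth_pos E.q E.k₁ α ‖τ + (δ : ℂ)‖
  rw [norm_inv]
  have := inv_anti₀ hcQ (hQ m)
  gcongr

/-- The forcing term of the fixed point form of the second equation. -/
lemma forcing₂_inFamily (hE : E.Admissible) {V O : Set ℂ} {Φ : ℂ → ℝ} {B c : ℝ} {φ : ℂ → ℝ → ℂ → ℂ}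
    (hB : 0 ≤ B) (hφ : InFamily V O Φ β μ ε₀ B φ) (hOV : O ⊆ V) (hΦ : ∀ τ ∈ V, 0 < Φ τ)
    (hc : 0 < c)
    (h : ∀ τ ∈ V, ∀ m, c * ((1 + |m|) ^ (R E.D).natDegree * (1 + ‖τ‖) ^ E.dD) ≤
      ‖E.P Q (R E.D) m τ‖) :
    InFamily V O Φ β μ ε₀ ((qfac E.q E.k₂ E.k₂)⁻¹ * c⁻¹ * B)
      (fun τ m ε => E.coefG₂ Q (R E.D) τ m * φ τ m ε) := by
  have hf := qfac_pos (k := E.k₂) hE.one_lt_q E.k₂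
  refine hφ.mul hB subset_rfl subset_rfl ?_ (fun m => ?_) fun τ hτ m => ?_
  · unfold coefG₂
    exact continuousOn_const.mul (continuousOn_const.div
      (continuous_P _ _).continuousOn fun p hp => (norm_coefP_le hc h hp.1 p.2).1)
  · unfold coefG₂
    refine DifferentiableOn.const_mul (DifferentiableOn.div (differentiableOn_const _)
      (differentiable_P _ _ _).differentiableOn fun τ hτ => (norm_coefP_le hc h (hOV hτ) m).1) _
  · obtain ⟨h0, h1⟩ := norm_coefP_le hc h hτ m
    have h2 : (1 : ℝ) ≤ (1 + |m|) ^ (R E.D).natDegree * (1 + ‖τ‖) ^ E.dD :=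
      one_le_mul_of_one_le_of_one_le
        (one_le_pow₀ (by linarith [abs_nonneg m])) (one_le_pow₀ (by linarith [norm_nonneg τ]))
    have h3 := norm_pos_iff.2 h0
    have h4 : 1 / ‖E.P Q (R E.D) m τ‖ ≤ c⁻¹ :=
      le_trans (div_le_div_of_nonneg_right h2 h3.le) h1
    have := hΦ τ hτ
    rw [coefG₂, norm_mul, norm_inv, Complex.norm_real, Real.norm_of_nonneg hf.le, norm_div,
      norm_one]
    gcongr

end Exponents

end

/-! ### Solutions and analytic continuation -/

section

open Filter Topology MeasureTheory Metric

namespace Exponents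

variable {E : Exponents} {β μ ε₀ ϖ ζ α ν d θU θS θb ρb ρ δ c₀ : ℝ} {Q : ℂ[X]} {R : ℕ → ℂ[X]}
  {C : ℕ → ℕ → ℝ → ℂ → ℂ} {ψ φ w w₁ w₂ : ℂ → ℝ → ℂ → ℂ}
  {A M B A' M' B' : (Σ _ : ℕ, ℕ) → ℝ}

/-- The origin is not isolated in the domain of the first equation. -/
lemma zero_mem_closure_diff (hρ : 0 < ρ) (S : Set ℂ) :
    S ∪ closedBall 0 ρ ⊆ closure ((S ∪ closedBall 0 ρ) \ {0}) := by
  intro τ hτ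
  by_cases h0 : τ = 0
  · rw [h0, Metric.mem_closure_iff]
    intro e he
    have hp : 0 < min (e / 2) ρ := lt_min (by positivity) hρ
    have hn : ‖((min (e / 2) ρ : ℝ) : ℂ)‖ = min (e / 2) ρ := by
      rw [Complex.norm_real, Real.norm_of_nonneg hp.le]
    refine ⟨((min (e / 2) ρ : ℝ) : ℂ), ⟨Or.inr ?_, Complex.ofReal_ne_zero.2 hp.ne'⟩, ?_⟩
    · rw [mem_closedBall_zero_iff, hn]; exact min_le_right _ _
    · rw [dist_zero_left, hn]
      exact (min_le_left _ _).trans_lt (by linarith)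
  · exact subset_closure ⟨hτ, h0⟩

/-- The solution of the first equation. Its uniqueness at `τ = 0`, where the equation is void,
follows by continuity. -/
theorem exists_sol₁ (hE : E.Admissible) (hP : E.PolyOK μ Q R) (hρ : 0 < ρ)
    (h : ContractionData (sector d θU ∪ closedBall 0 ρ) (sector d θU ∪ ball 0 ρ)
      (fun τ => growth E.q E.kap α ‖τ + (δ : ℂ)‖) β μ ε₀ ζ (R E.D).natDegree E.pairs
      (E.coefA Q (R E.D) E.k₁) (E.q ^ (-(E.dD : ℝ) / E.kap)) (E.coefB Q E.k₁) (E.ratio E.k₁)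
      (fun i => R i.1) E.epsPow (fun i => C i.1 i.2) A M B) {b : ℝ} (hb : 0 ≤ b)
    (hψ : InFamily (sector d θU ∪ closedBall 0 ρ) (sector d θU ∪ ball 0 ρ)
      (fun τ => growth E.q E.kap α ‖τ + (δ : ℂ)‖) β μ ε₀ b
      (fun τ m ε => (evI Q m)⁻¹ * ψ τ m ε)) (hbϖ : 2 * b ≤ ϖ) :
    ∃ w : ℂ → ℝ → ℂ → ℂ, InFamily (sector d θU ∪ closedBall 0 ρ) (sector d θU ∪ ball 0 ρ)
      (fun τ => growth E.q E.kap α ‖τ + (δ : ℂ)‖) β μ ε₀ ϖ w ∧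
      (∀ ε ∈ ball (0 : ℂ) ε₀, ∀ τ ∈ sector d θU ∪ closedBall 0 ρ, ∀ m,
        w τ m ε = (evI Q m)⁻¹ * ψ τ m ε +
        E.linPart Q R (fun ℓ j m => C ℓ j m ε) ε E.k₁ (E.q ^ (-(E.dD : ℝ) / E.kap))
          (fun τ m => w τ m ε) τ m) ∧
      E.IsSol₁ Q R C ψ (sector d θU) ρ δ β μ α ε₀ ϖ w := by
  have hq := hE.one_lt_q
  obtain ⟨w, hw, hfix⟩ := h.exists_fixedPoint hb hψ
  have hw := hw.mono_bound h.dom.pos hbϖ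
  refine ⟨w, hw, hfix, fun ε hε => ⟨hw.cont ε hε, hw.holτ ε hε, hw.bound ε hε⟩,
    fun ε hε => eq₁_of_fixed hq hP.Q_ne (hfix ε hε), fun ε hε v hv hveq => ?_, hw.holε⟩
  have hne : ∀ τ ∈ (sector d θU ∪ closedBall 0 ρ) \ {0}, ∀ m, v τ m = w τ m ε := by
    refine h.unique Set.sdiff_subset (fun c hc hc1 τ hτ => ⟨h.dom.dilV c hc hc1 τ hτ.1,
        fun h0 => hτ.2 ((mul_eq_zero.1 h0).resolve_left (Complex.ofReal_ne_zero.2 hc.ne'))⟩) hε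
      (v₁ := v) (v₂ := fun τ m => w τ m ε) (g := fun τ m => (evI Q m)⁻¹ * ψ τ m ε)
      (fun τ hτ => continuous_slice hv.1 hτ.1)
      (fun τ hτ => continuous_slice (v := fun τ m => w τ m ε) (hw.cont ε hε) hτ.1)
      (fun τ hτ => hv.2.2 τ hτ.1) (fun τ hτ => hw.bound ε hε τ hτ.1)
      (fun τ hτ m => fixed_of_eq₁ hq hP.Q_ne hveq hτ.1 hτ.2 m)
      (fun τ hτ m => hfix ε hε τ hτ.1 m)
  intro τ hτ m
  have hc : ∀ {u : ℂ → ℝ → ℂ}, ContinuousOn (fun p : ℂ × ℝ => u p.1 p.2)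
      ((sector d θU ∪ closedBall 0 ρ) ×ˢ Set.univ) →
      ContinuousOn (fun τ => u τ m) (sector d θU ∪ closedBall 0 ρ) := fun {u} hu =>
    hu.comp (f := fun τ : ℂ => (τ, m)) (by fun_prop) fun τ hτ => ⟨hτ, trivial⟩
  exact Set.EqOn.of_subset_closure (fun τ hτ => hne τ hτ m) (hc hv.1)
    (hc (u := fun τ m => w τ m ε) (hw.cont ε hε)) Set.sdiff_subset (zero_mem_closure_diff hρ _) hτ

/-- The solution of the second equation. Since `0` does not belong to its domain, the equation is
equivalent to its fixed point form, and uniqueness holds without a bound on the norm. -/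
theorem exists_sol₂ (hE : E.Admissible)
    (h : ContractionData (sector d θS ∪ closedFiniteSector d θb ρb)
        (sector d θS ∪ finiteSector d θb ρb)
        (fun τ => growth E.q E.k₂ ν ‖τ‖) β μ ε₀ ζ (R E.D).natDegree E.pairs
        (fun _ _ => 0) 1 (E.coefB₂ Q (R E.D)) (E.ratio E.k₂)
        (fun i => R i.1) E.epsPow (fun i => C i.1 i.2) A M B)
    (hP : ∀ τ ∈ sector d θS ∪ closedFiniteSector d θb ρb, ∀ m, E.P Q (R E.D) m τ ≠ 0)
    {b : ℝ} (hb : 0 ≤ b)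
    (hφ : InFamily (sector d θS ∪ closedFiniteSector d θb ρb)
      (sector d θS ∪ finiteSector d θb ρb)
      (fun τ => growth E.q E.k₂ ν ‖τ‖) β μ ε₀ b
      (fun τ m ε => E.coefG₂ Q (R E.D) τ m * φ τ m ε)) (hbϖ : 2 * b ≤ ϖ) :
    ∃ w : ℂ → ℝ → ℂ → ℂ, InFamily (sector d θS ∪ closedFiniteSector d θb ρb)
      (sector d θS ∪ finiteSector d θb ρb) (fun τ => growth E.q E.k₂ ν ‖τ‖) β μ ε₀ ϖ w ∧
      (∀ ε ∈ ball (0 : ℂ) ε₀, ∀ τ ∈ sector d θS ∪ closedFiniteSector d θb ρb, ∀ m,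
        w τ m ε = E.coefG₂ Q (R E.D) τ m * φ τ m ε +
        dilConvOp E.pairs (fun _ _ => 0) 1 (E.coefB₂ Q (R E.D)) (E.ratio E.k₂) (fun i => R i.1)
          (fun i => ε ^ E.epsPow i) (fun i m => C i.1 i.2 m ε) (fun τ m => w τ m ε) τ m) ∧
      E.IsSol₂ Q R C φ (sector d θS) (finiteSector d θb ρb) (closedFiniteSector d θb ρb)
        β μ ν ε₀ ϖ w := by
  have hq := hE.one_lt_q
  have hV0 : ∀ τ ∈ sector d θS ∪ closedFiniteSector d θb ρb, τ ≠ 0 := fun τ hτ =>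
    hτ.elim (fun hτ => hτ.1) fun hτ => hτ.2
  obtain ⟨w, hw, hfix⟩ := h.exists_fixedPoint hb hφ
  have hw := hw.mono_bound h.dom.pos hbϖ
  have hiff : ∀ (ε : ℂ) (v : ℂ → ℝ → ℂ), _ := fun ε v =>
    eq₂_iff (C := fun ℓ j m => C ℓ j m ε) (ψ := fun τ m => φ τ m ε) (ε := ε) (w := v) hq hV0 hP
  refine ⟨w, hw, hfix, ⟨fun ε hε => ⟨hw.cont ε hε, hw.holτ ε hε, hw.bound ε hε⟩,
    fun ε hε => (hiff ε fun τ m => w τ m ε).2 (hfix ε hε), fun ε hε b v hv hveq => ?_,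
    hw.holε⟩⟩
  exact h.unique subset_rfl h.dom.dilV hε
      (v₁ := v) (v₂ := fun τ m => w τ m ε) (g := fun τ m => E.coefG₂ Q (R E.D) τ m * φ τ m ε)
      (fun τ hτ => continuous_slice hv.1 hτ)
      (fun τ hτ => continuous_slice (v := fun τ m => w τ m ε) (hw.cont ε hε) hτ)
      hv.2.2 (hw.bound ε hε) ((hiff ε v).1 hveq) (hfix ε hε)

/-- The acceleration of `w₁` is `w₂`, since both solve the second equation: the uniqueness of
bounded solutions is applied on a domain that is stable under the dilations of ratio at most
one. -/
theorem accel_eq (hE : E.Admissible) (hPQ : E.PolyOK μ Q R) (hθU : 0 < θU) (hδ : 0 < δ)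
    (hc₀ : 0 < c₀) (hfar : ∀ τ ∈ sector d θU ∪ closedBall 0 ρ, c₀ ≤ ‖τ + (δ : ℂ)‖)
    (h₁ : ContractionData (sector d θU ∪ closedBall 0 ρ) (sector d θU ∪ ball 0 ρ)
      (fun τ => growth E.q E.kap α ‖τ + (δ : ℂ)‖) β μ ε₀ ζ (R E.D).natDegree E.pairs
      (E.coefA Q (R E.D) E.k₁) (E.q ^ (-(E.dD : ℝ) / E.kap)) (E.coefB Q E.k₁) (E.ratio E.k₁)
      (fun i => R i.1) E.epsPow (fun i => C i.1 i.2) A M B)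
    (h₂ : ContractionData (sector d θS ∪ closedFiniteSector d θb ρb)
        (sector d θS ∪ finiteSector d θb ρb)
        (fun τ => growth E.q E.k₂ ν ‖τ‖) β μ ε₀ ζ (R E.D).natDegree E.pairs
        (fun _ _ => 0) 1 (E.coefB₂ Q (R E.D)) (E.ratio E.k₂)
        (fun i => R i.1) E.epsPow (fun i => C i.1 i.2) A' M' B')
    (hP : ∀ τ ∈ sector d θS ∪ closedFiniteSector d θb ρb, ∀ m, E.P Q (R E.D) m τ ≠ 0)
    {cS : ℝ} (hcS : 0 < cS) (hS : sector d θS ∪ closedFiniteSector d θb ρb ⊆ lapDomain d cS)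
    {b : ℝ} (hψ : InFamily (sector d θU ∪ closedBall 0 ρ) (sector d θU ∪ ball 0 ρ)
      (fun τ => growth E.q E.kap α ‖τ + (δ : ℂ)‖) β μ ε₀ b
      (fun τ m ε => (evI Q m)⁻¹ * ψ τ m ε)) (hϖ : 0 ≤ ϖ)
    (hw₁ : InFamily (sector d θU ∪ closedBall 0 ρ) (sector d θU ∪ ball 0 ρ)
      (fun τ => growth E.q E.kap α ‖τ + (δ : ℂ)‖) β μ ε₀ ϖ w₁)
    (hfix₁ : ∀ ε ∈ ball (0 : ℂ) ε₀, ∀ τ ∈ sector d θU ∪ closedBall 0 ρ, ∀ m,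
        w₁ τ m ε = (evI Q m)⁻¹ * ψ τ m ε +
        E.linPart Q R (fun ℓ j m => C ℓ j m ε) ε E.k₁ (E.q ^ (-(E.dD : ℝ) / E.kap))
          (fun τ m => w₁ τ m ε) τ m)
    (hw₂ : InFamily (sector d θS ∪ closedFiniteSector d θb ρb)
      (sector d θS ∪ finiteSector d θb ρb) (fun τ => growth E.q E.k₂ ν ‖τ‖) β μ ε₀ ϖ w₂)
    (hfix₂ : ∀ ε ∈ ball (0 : ℂ) ε₀, ∀ τ ∈ sector d θS ∪ closedFiniteSector d θb ρb, ∀ m,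
        w₂ τ m ε = E.coefG₂ Q (R E.D) τ m * E.accel d ψ τ m ε +
        dilConvOp E.pairs (fun _ _ => 0) 1 (E.coefB₂ Q (R E.D)) (E.ratio E.k₂) (fun i => R i.1)
          (fun i => ε ^ E.epsPow i) (fun i m => C i.1 i.2 m ε) (fun τ m => w₂ τ m ε) τ m) :
    ∀ ε ∈ ball (0 : ℂ) ε₀,
      ∀ τ ∈ (sector d θS ∪ finiteSector d θb ρb) ∩ E.accelDomain α d, ∀ m,
      E.accel d w₁ τ m ε = w₂ τ m ε := by
  intro ε hε
  have hq := hE.one_lt_q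
  have hμ : 0 ≤ μ := by
    have := hPQ.deg_lt_mu; have : (0 : ℝ) ≤ (R E.D).natDegree := Nat.cast_nonneg _; linarith
  have hV : (sector d θS ∪ finiteSector d θb ρb) ∩ E.accelDomain α d ⊆
      sector d θS ∪ closedFiniteSector d θb ρb := Set.inter_subset_left.trans h₂.dom.subset
  have hray : ∀ r : ℝ, 0 < r →
      (r : ℂ) * Complex.exp (d * Complex.I) ∈ sector d θU ∪ closedBall 0 ρ :=
    fun r hr => Or.inl (ray_mem_sector hθU hr)
  obtain ⟨K, -, hKle⟩ := integral_growth_shift_le_const (α := α) hq hE.kap_pos hδ.le hc₀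
    fun r hr => hfar _ (hray r hr)
  obtain ⟨D, hD, hDle⟩ := accel_le hE hθU hδ hc₀ hfar hcS hϖ hw₁
  obtain ⟨hcont, -, -⟩ := accel_regular hE hθU hδ hc₀ hfar h₁.β_nonneg hμ hϖ hw₁
  -- `g` is a positive lower bound of the weight of the second equation
  set g := Real.exp (-(ν ^ 2 * Real.log E.q / (2 * E.k₂))) with hg
  refine h₂.unique hV (fun c hc hc1 τ hτ => ⟨h₂.dom.dilO c hc hc1 τ hτ.1,
      mul_mem_accelDomain hc hc1 hτ.2⟩) hε
    (v₁ := fun τ m => E.accel d w₁ τ m ε) (v₂ := fun τ m => w₂ τ m ε)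
    (g := fun τ m => E.coefG₂ Q (R E.D) τ m * E.accel d ψ τ m ε) (B₁ := D * g⁻¹) (B₂ := ϖ)
    (fun τ hτ => continuous_slice (v := fun τ m => E.accel d w₁ τ m ε) (hcont ε hε) hτ.2)
    (fun τ hτ => continuous_slice (v := fun τ m => w₂ τ m ε) (hw₂.cont ε hε) (hV hτ))
    (fun τ hτ m => ?_) (fun τ hτ => hw₂.bound ε hε τ (hV hτ)) ?_
    (fun τ hτ => hfix₂ ε hε τ (hV hτ))
  · have h1 := (hDle ε hε m τ (hS (hV hτ)) hτ.2.2.2.le).2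
    have h2 : g ≤ growth E.q E.k₂ ν ‖τ‖ := exp_neg_le_growth hq hE.k₂_pos
    have hg0 : 0 < g := Real.exp_pos _
    have hdec := decay_pos β μ m
    calc _ ≤ D * decay β μ m * 1 := by rw [mul_one]; exact h1
      _ ≤ D * decay β μ m * (g⁻¹ * growth E.q E.k₂ ν ‖τ‖) := by
          gcongr
          rw [inv_mul_eq_div, le_div_iff₀ hg0, one_mul]; exact h2
      _ = _ := by ring
  · refine (eq₂_iff (ψ := fun τ m => E.accel d ψ τ m ε) (C := fun ℓ j m => C ℓ j m ε) hq
      (fun τ hτ => slit_ne_zero hτ.2.1) fun τ hτ => hP τ (hV hτ)).1 ?_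
    refine eq₂_of_fixed hq hPQ.Q_ne fun τ hτ m => ?_
    exact accel_solves hE hPQ.Q_ne h₁ hcS hray hϖ hψ hw₁ hε (hfix₁ ε hε) (hS (hV hτ))
      (hKle ‖τ‖ hτ.2.2.1 hτ.2.2.2.le).1 m

open Classical in
/-- The function which continues the acceleration of `w₁` by `w₂`. -/
def continuation (E : Exponents) (d : ℝ) (S : Set ℂ) (w₁ w₂ : ℂ → ℝ → ℂ → ℂ) (τ : ℂ) (m : ℝ)
    (ε : ℂ) : ℂ := if τ ∈ S then w₂ τ m ε else E.accel d w₁ τ m ε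

/-- Gluing along the open set `S ∩ accelDomain`. Joint continuity in all the variables follows from
continuity in `(τ, m)`, holomorphy in `ε` and local boundedness. -/
theorem continuation_regular (hE : E.Admissible) (hθU : 0 < θU) (hδ : 0 < δ)
    (hc₀ : 0 < c₀) (hfar : ∀ τ ∈ sector d θU ∪ closedBall 0 ρ, c₀ ≤ ‖τ + (δ : ℂ)‖)
    (hβ : 0 ≤ β) (hμ : 0 ≤ μ) (hϖ : 0 ≤ ϖ) {O V' O' : Set ℂ} {Φ : ℂ → ℝ}
    (hw₁ : InFamily (sector d θU ∪ closedBall 0 ρ) O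
      (fun τ => growth E.q E.kap α ‖τ + (δ : ℂ)‖) β μ ε₀ ϖ w₁)
    (dom : WeightedDomain V' O' Φ) (hw₂ : InFamily V' O' Φ β μ ε₀ ϖ w₂) {S : Set ℂ}
    (hS : IsOpen S) (hSO : S ⊆ O')
    (heq : ∀ ε ∈ ball (0 : ℂ) ε₀, ∀ τ ∈ S ∩ E.accelDomain α d, ∀ m,
      E.accel d w₁ τ m ε = w₂ τ m ε) :
    (∀ ε ∈ ball (0 : ℂ) ε₀, ∀ τ ∈ E.accelDomain α d, ∀ m,
      E.continuation d S w₁ w₂ τ m ε = E.accel d w₁ τ m ε) ∧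
    (∀ ε ∈ ball (0 : ℂ) ε₀, ∀ m, DifferentiableOn ℂ
      (fun τ => E.continuation d S w₁ w₂ τ m ε) (E.accelDomain α d ∪ S)) ∧
    (∀ τ ∈ E.accelDomain α d ∪ S, ∀ m, DifferentiableOn ℂ
      (fun ε => E.continuation d S w₁ w₂ τ m ε) (ball 0 ε₀)) ∧
    ContinuousOn (fun p : ℂ × ℝ × ℂ => E.continuation d S w₁ w₂ p.1 p.2.1 p.2.2)
      ((E.accelDomain α d ∪ S) ×ˢ (Set.univ ×ˢ ball 0 ε₀)) := by
  obtain ⟨h1, h2, h3⟩ := accel_regular hE hθU hδ hc₀ hfar hβ hμ hϖ hw₁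
  have hSV : S ⊆ V' := hSO.trans dom.subset
  have hG : IsOpen (E.accelDomain α d) := isOpen_slitPart d isOpen_Ioo
  have hWS : ∀ τ ∈ S, ∀ m ε, E.continuation d S w₁ w₂ τ m ε = w₂ τ m ε := fun τ hτ m ε =>
    if_pos hτ
  have hWG : ∀ ε ∈ ball (0 : ℂ) ε₀, ∀ τ ∈ E.accelDomain α d, ∀ m,
      E.continuation d S w₁ w₂ τ m ε = E.accel d w₁ τ m ε := fun ε hε τ hτ m => by
    by_cases hτS : τ ∈ S
    · rw [hWS τ hτS, heq ε hε τ ⟨hτS, hτ⟩]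
    · exact if_neg hτS
  have hholτ : ∀ ε ∈ ball (0 : ℂ) ε₀, ∀ m, DifferentiableOn ℂ
      (fun τ => E.continuation d S w₁ w₂ τ m ε) (E.accelDomain α d ∪ S) := fun ε hε m =>
    DifferentiableOn.union_of_isOpen ((h2 ε hε m).congr fun τ hτ => hWG ε hε τ hτ m)
      (((hw₂.holτ ε hε m).mono hSO).congr fun τ hτ => hWS τ hτ m ε) hG hS
  have hholε : ∀ τ ∈ E.accelDomain α d ∪ S, ∀ m, DifferentiableOn ℂ
      (fun ε => E.continuation d S w₁ w₂ τ m ε) (ball 0 ε₀) := by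
    rintro τ (hτ | hτ) m
    · exact (h3 τ hτ m).congr fun ε hε => hWG ε hε τ hτ m
    · exact (hw₂.holε τ (hSV hτ) m).congr fun ε _ => hWS τ hτ m ε
  refine ⟨hWG, hholτ, hholε, ?_⟩
  have hcont : ∀ ε ∈ ball (0 : ℂ) ε₀, ContinuousOn
      (fun p : ℂ × ℝ => E.continuation d S w₁ w₂ p.1 p.2 ε)
      ((E.accelDomain α d ∪ S) ×ˢ Set.univ) := fun ε hε => by
    rw [Set.union_prod]
    refine ContinuousOn.union_of_isOpen ((h1 ε hε).congr fun p hp => hWG ε hε _ hp.1 _)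
      (((hw₂.cont ε hε).mono (Set.prod_mono hSV subset_rfl)).congr fun p hp => hWS _ hp.1 _ _)
      (hG.prod isOpen_univ) (hS.prod isOpen_univ)
  have hloc : ∀ x₀ ∈ (E.accelDomain α d ∪ S) ×ˢ (Set.univ : Set ℝ), ∃ b : ℝ,
      ∀ᶠ x in 𝓝[(E.accelDomain α d ∪ S) ×ˢ Set.univ] x₀, ∀ ε ∈ ball (0 : ℂ) ε₀,
        ‖E.continuation d S w₁ w₂ x.1 x.2 ε‖ ≤ b := by
    rintro ⟨τ₀, m₀⟩ ⟨hτ₀ | hτ₀, -⟩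
    · obtain ⟨c, hc, hnhds⟩ := exists_lapDomain_nhds hτ₀.1
      obtain ⟨b, hb, hle⟩ := accel_le hE hθU hδ hc₀ hfar hc hϖ hw₁
      refine ⟨b, nhdsWithin_le_nhds (continuous_fst.continuousAt.eventually
        (p := fun τ => ∀ m, ∀ ε ∈ ball (0 : ℂ) ε₀, ‖E.continuation d S w₁ w₂ τ m ε‖ ≤ b) ?_
        |>.mono fun x hx => hx x.2)⟩
      filter_upwards [hnhds, hG.mem_nhds hτ₀] with τ hτ hτG m ε hε
      rw [hWG ε hε τ hτG]
      exact (hle ε hε m τ hτ hτG.2.2.le).2.trans (mul_le_of_le_one_right hb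
        (decay_le_one hβ hμ m))
    · refine ⟨ϖ * (Φ τ₀ + 1), nhdsWithin_le_nhds (continuous_fst.continuousAt.eventually
        (p := fun τ => ∀ m, ∀ ε ∈ ball (0 : ℂ) ε₀, ‖E.continuation d S w₁ w₂ τ m ε‖ ≤
          ϖ * (Φ τ₀ + 1)) ?_ |>.mono fun x hx => hx x.2)⟩
      have hΦ := (dom.cont.mono hSV).continuousAt (hS.mem_nhds hτ₀)
      filter_upwards [hΦ.eventually_lt_const (lt_add_one (Φ τ₀)), hS.mem_nhds hτ₀]
        with τ hτ hτS m ε hε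
      rw [hWS τ hτS]
      have hp := dom.pos τ (hSV hτS)
      have hd := decay_pos β μ m
      have hd1 := decay_le_one hβ hμ m
      refine (hw₂.bound ε hε τ (hSV hτS) m).trans (mul_le_mul_of_nonneg_left ?_ hϖ)
      nlinarith
  have hprod := continuousOn_prod_of_differentiableOn
    (f := fun x : ℂ × ℝ => fun ε => E.continuation d S w₁ w₂ x.1 x.2 ε) hcont
    (fun x hx => hholε x.1 hx.1 x.2) hloc
  exact hprod.comp (f := fun p : ℂ × ℝ × ℂ => ((p.1, p.2.1), p.2.2)) (by fun_prop)
    fun p hp => ⟨⟨hp.1, trivial⟩, hp.2.2⟩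

end Exponents

end

end QG

end

theorem proposition638 (E : QG.Exponents) (hE : E.Admissible) (α : ℝ) :
    -- the exponent `ν`
    ∃ ν : ℝ,
    -- the domain `U_d ∪ D̄(0,ρ)` at positive distance of `-δ`
    ∀ (d θU ρ δ : ℝ), 0 < θU → 0 < ρ → 0 < δ →
    (∃ c₀ : ℝ, 0 < c₀ ∧ ∀ τ ∈ QG.sector d θU ∪ Metric.ball 0 ρ, c₀ ≤ ‖τ + (δ : ℂ)‖) →
    -- smallness of `sup |R_D(im)| / |Q(im)|`
    ∃ c : ℝ, 0 < c ∧
    ∀ (β μ ε₀ ϖ : ℝ) (Q : ℂ[X]) (R : ℕ → ℂ[X]), 0 < β → 0 < ε₀ → 0 < ϖ →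
    E.PolyOK μ Q R →
    (∀ m : ℝ, ‖QG.evI (R E.D) m‖ ≤ c * ‖QG.evI Q m‖) →
    -- the sectors `S_d` and `ℛ_d^b`, away from the roots of `P_m`
    ∀ (θS θb ρb ρ₁ M₁ : ℝ), 0 < θS → θS < Real.pi → 0 < θb → θb < Real.pi →
    0 < ρb → ρb ≤ ρ₁ → 0 < M₁ →
    (∀ m : ℝ, ∀ z : ℂ, E.P Q (R E.D) m z = 0 →
      ∀ τ ∈ QG.sector d θS ∪ Metric.closedBall 0 ρ₁, M₁ * (1 + ‖τ‖) ≤ ‖τ - z‖) →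
    -- smallness of the coefficients and of the forcing term
    ∃ (ζ : ℕ → ℕ → ℝ) (ζψ : ℝ), (∀ ℓ j, 0 < ζ ℓ j) ∧ 0 < ζψ ∧
    ∀ (C : ℕ → ℕ → ℝ → ℂ → ℂ) (F : ℕ → ℝ → ℂ → ℂ) (ψ : ℂ → ℝ → ℂ → ℂ),
    E.CoeffOK β μ ε₀ ζ C →
    E.ForcingOK (QG.sector d θU) ρ δ β μ α ε₀ ζψ F ψ →
    -- the accelerated forcing term is well defined, with growth given by `ν`
    (∀ δt : ℝ, 0 < δt → ∃ Cψ : ℝ, 0 < Cψ ∧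
      ∀ ε ∈ Metric.ball (0 : ℂ) ε₀, ∀ m : ℝ, ∀ τ ∈ QG.lapDomain d δt,
        MeasureTheory.IntegrableOn
          (QG.lapIntegrand E.q E.kap d (fun h => ψ h m ε) τ) (Set.Ioi 0) ∧
        ‖E.accel d ψ τ m ε‖ ≤ Cψ * (QG.decay β μ m * QG.growth E.q E.k₂ ν ‖τ‖)) ∧
    -- the solutions of the two equations
    ∃ w₁ w₂ : ℂ → ℝ → ℂ → ℂ,
      E.IsSol₁ Q R C ψ (QG.sector d θU) ρ δ β μ α ε₀ ϖ w₁ ∧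
      E.IsSol₂ Q R C (E.accel d ψ) (QG.sector d θS) (QG.finiteSector d θb ρb)
        (QG.closedFiniteSector d θb ρb) β μ ν ε₀ ϖ w₂ ∧
      ∀ δt r₁ : ℝ, 0 < δt → 0 < r₁ → r₁ ≤ E.q ^ ((1 / 2 - α) / E.kap) / 2 →
        -- the acceleration of `w₁` is well defined, bounded and holomorphic
        (∃ B : ℝ, ∀ ε ∈ Metric.ball (0 : ℂ) ε₀, ∀ m : ℝ,
          DifferentiableOn ℂ (fun τ => E.accel d w₁ τ m ε)
            (QG.lapDomain d δt ∩ Metric.ball 0 r₁) ∧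
          ∀ τ ∈ QG.lapDomain d δt ∩ Metric.ball 0 r₁,
            MeasureTheory.IntegrableOn
              (QG.lapIntegrand E.q E.kap d (fun h => w₁ h m ε) τ) (Set.Ioi 0) ∧
            ‖E.accel d w₁ τ m ε‖ ≤ B * QG.decay β μ m) ∧
        -- it coincides with `w₂` on the common domain, which contains a bounded sector
        (∀ ε ∈ Metric.ball (0 : ℂ) ε₀, ∀ m : ℝ,
          ∀ τ ∈ (QG.sector d θS ∪ QG.finiteSector d θb ρb) ∩
            (QG.lapDomain d δt ∩ Metric.ball 0 r₁),
            E.accel d w₁ τ m ε = w₂ τ m ε) ∧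
        (δt < 1 → ∃ θt ρt : ℝ, 0 < θt ∧ 0 < ρt ∧
          QG.finiteSector d θt ρt ⊆
            QG.sector d θS ∩ (QG.lapDomain d δt ∩ Metric.ball 0 r₁)) ∧
        -- it extends to the infinite sector, with `q`-exponential growth of order `k₂`
        (∃ W : ℂ → ℝ → ℂ → ℂ,
          (∀ ε ∈ Metric.ball (0 : ℂ) ε₀, ∀ m : ℝ,
            (∀ τ ∈ QG.lapDomain d δt ∩ Metric.ball 0 r₁, W τ m ε = E.accel d w₁ τ m ε) ∧
            DifferentiableOn ℂ (fun τ => W τ m ε)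
              (QG.lapDomain d δt ∩ Metric.ball 0 r₁ ∪ QG.sector d θS)) ∧
          (∃ Cw : ℝ, 0 < Cw ∧ ∀ ε ∈ Metric.ball (0 : ℂ) ε₀, ∀ m : ℝ, ∀ τ ∈ QG.sector d θS,
            ‖W τ m ε‖ ≤ Cw * (QG.decay β μ m * QG.growth E.q E.k₂ ν ‖τ‖)) ∧
          ContinuousOn (fun p : ℂ × ℝ × ℂ => W p.1 p.2.1 p.2.2)
            ((QG.lapDomain d δt ∩ Metric.ball 0 r₁ ∪ QG.sector d θS) ×ˢ
              (Set.univ ×ˢ Metric.ball 0 ε₀)) ∧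
          ∀ τ ∈ QG.lapDomain d δt ∩ Metric.ball 0 r₁ ∪ QG.sector d θS, ∀ m : ℝ,
            DifferentiableOn ℂ (fun ε => W τ m ε) (Metric.ball 0 ε₀)) := by
  refine ⟨E.nu α, fun d θU ρ δ hθU hρ hδ ⟨c₀, hc₀, hdom⟩ => ?_⟩
  obtain ⟨c, hc, hcon₁⟩ := QG.Exponents.contraction₁ hE α hρ hδ hc₀ hdom
  refine ⟨c, hc, fun β μ ε₀ ϖ Q R hβ hε₀ hϖ hPoly hsup θS θb ρb ρ₁ M₁ hθS hθS' hθb hθb' hρb hρ₁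
    hM₁ hroots => ?_⟩
  have hfar := (QG.Exponents.weightedDomain₁ (q := E.q) (k := E.kap) (α := α) hρ hc₀ hdom).1
  have hμ : 0 ≤ μ := by
    have := hPoly.deg_lt_mu
    have : (0 : ℝ) ≤ (R E.D).natDegree := Nat.cast_nonneg _
    linarith
  -- lower bounds for `P_m` and `Q`
  obtain ⟨cP, hcP, hPle⟩ := QG.Exponents.le_norm_P hE hPoly hM₁ hroots
  have hsub : QG.sector d θS ∪ QG.closedFiniteSector d θb ρb ⊆
      QG.sector d θS ∪ Metric.closedBall 0 ρ₁ := by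
    refine Set.union_subset_union_right _ fun τ hτ => ?_
    have h1 : QG.closedFiniteSector d θb ρb ⊆ Metric.closedBall 0 ρb := fun τ hτ =>
      closure_minimal (Set.inter_subset_right.trans Metric.ball_subset_closedBall)
        Metric.isClosed_closedBall hτ.1
    exact Metric.closedBall_subset_closedBall hρ₁ (h1 hτ)
  have hPV := fun τ hτ => hPle τ (hsub hτ)
  have hPne : ∀ τ ∈ QG.sector d θS ∪ QG.closedFiniteSector d θb ρb, ∀ m,
      E.P Q (R E.D) m τ ≠ 0 := fun τ hτ m => (QG.Exponents.norm_coefP_le hcP hPV hτ m).1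
  obtain ⟨cQ, hcQ, hQle⟩ := QG.exists_le_norm_evI hPoly.Q_ne
  have hQle' : ∀ m, cQ ≤ ‖QG.evI Q m‖ := fun m =>
    (le_mul_of_one_le_right hcQ.le (one_le_pow₀ (by linarith [abs_nonneg m]))).trans (hQle m)
  -- smallness of the coefficients
  obtain ⟨ζ₁, hζ₁, hcon₁⟩ := hcon₁ β μ ε₀ Q R hβ hPoly hsup
  obtain ⟨ζ₂, hζ₂, hcon₂⟩ := QG.Exponents.contraction₂ (ε₀ := ε₀) hE (E.nu α) hPoly hβ hcP hPV
  -- smallness of the forcing term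
  obtain ⟨cS, hcS, hS⟩ := QG.sectors_subset_lapDomain (d := d) (ρb := ρb) hθS hθS' hθb hθb'
  obtain ⟨K, hK, hKle⟩ := QG.Exponents.accel_forcing_le (α := α) hE hθU hδ hc₀ hfar hcS
  have hf := QG.qfac_pos (k := E.k₂) hE.one_lt_q E.k₂
  obtain ⟨ζψ, hζψ, hζψ₁, hζψ₂⟩ : ∃ ζψ : ℝ, 0 < ζψ ∧ 2 * (cQ⁻¹ * ζψ) ≤ ϖ ∧
      2 * ((QG.qfac E.q E.k₂ E.k₂)⁻¹ * cP⁻¹ * (K * ζψ)) ≤ ϖ := by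
    set a := 2 * cQ⁻¹ with ha
    set b := 2 * ((QG.qfac E.q E.k₂ E.k₂)⁻¹ * cP⁻¹ * K) with hb
    have ha0 : 0 < a := by positivity
    have hb0 : 0 < b := by positivity
    have h0 : 0 < ϖ / (a + b) := by positivity
    have h1 : (a + b) * (ϖ / (a + b)) = ϖ := by field_simp
    refine ⟨ϖ / (a + b), h0, ?_, ?_⟩
    · calc _ = a * (ϖ / (a + b)) := by rw [ha]; ring
        _ ≤ (a + b) * (ϖ / (a + b)) := by gcongr; linarith
        _ = ϖ := h1
    · calc _ = b * (ϖ / (a + b)) := by rw [hb]; ring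
        _ ≤ (a + b) * (ϖ / (a + b)) := by gcongr; linarith
        _ = ϖ := h1
  refine ⟨fun _ _ => min ζ₁ ζ₂, ζψ, fun _ _ => lt_min hζ₁ hζ₂, hζψ, fun C F ψ hC hF => ?_⟩
  obtain ⟨A, M, B, h₁⟩ := hcon₁ _ (lt_min hζ₁ hζ₂).le (min_le_left _ _) C hC
  obtain ⟨A', M', B', h₂⟩ := hcon₂ _ (lt_min hζ₁ hζ₂).le (min_le_right _ _) C hC
  refine ⟨fun δt hδt => ?_, ?_⟩
  · obtain ⟨K', hK', hle⟩ := QG.Exponents.accel_forcing_le (α := α) hE hθU hδ hc₀ hfar hδt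
    exact ⟨K' * ζψ, by positivity, hle β μ ε₀ ζψ F ψ hζψ.le hF⟩
  have hψ₁ := QG.Exponents.forcing₁_inFamily hE hcQ hQle' hζψ.le hF
  have hφ := QG.Exponents.accel_forcing_inFamily hE hθU hδ hc₀ hfar hβ.le hμ hζψ.le hF
    (hS.trans (QG.lapDomain_subset_slit hcS)) h₂.dom.subset fun ε hε τ hτ m =>
      (hKle β μ ε₀ ζψ F ψ hζψ.le hF ε hε m τ (hS hτ)).2
  have hψ₂ := QG.Exponents.forcing₂_inFamily hE (by positivity) hφ h₂.dom.subset h₂.dom.pos hcP hPV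
  obtain ⟨w₁, hw₁, hfix₁, hsol₁⟩ := QG.Exponents.exists_sol₁ hE hPoly hρ h₁ (by positivity) hψ₁
    hζψ₁
  obtain ⟨w₂, hw₂, hfix₂, hsol₂⟩ := QG.Exponents.exists_sol₂ hE h₂ hPne (by positivity) hψ₂ hζψ₂
  have heq := QG.Exponents.accel_eq hE hPoly hθU hδ hc₀ hfar h₁ h₂ hPne hcS hS hψ₁ hϖ.le hw₁ hfix₁
    hw₂ hfix₂
  refine ⟨w₁, w₂, hsol₁, hsol₂, fun δt r₁ hδt hr₁ hr₁' => ?_⟩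
  have hacc : QG.lapDomain d δt ∩ Metric.ball 0 r₁ ⊆ E.accelDomain α d :=
    QG.Exponents.subset_accelDomain hδt hr₁'
  obtain ⟨b, -, hb⟩ := QG.Exponents.accel_le hE hθU hδ hc₀ hfar hδt hϖ.le hw₁
  obtain ⟨-, hhol, -⟩ := QG.Exponents.accel_regular hE hθU hδ hc₀ hfar hβ.le hμ hϖ.le hw₁
  obtain ⟨hW, hWτ, hWε, hWc⟩ := QG.Exponents.continuation_regular hE hθU hδ hc₀ hfar hβ.le hμ
    hϖ.le hw₁ h₂.dom hw₂ (QG.isOpen_sector d θS) Set.subset_union_left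
    fun ε hε τ hτ => heq ε hε τ ⟨Or.inl hτ.1, hτ.2⟩
  have hdomain : QG.lapDomain d δt ∩ Metric.ball 0 r₁ ∪ QG.sector d θS ⊆
      E.accelDomain α d ∪ QG.sector d θS := Set.union_subset_union_left _ hacc
  refine ⟨⟨b, fun ε hε m => ⟨(hhol ε hε m).mono hacc, fun τ hτ =>
      hb ε hε m τ hτ.1 (hacc hτ).2.2.le⟩⟩,
    fun ε hε m τ hτ => heq ε hε τ ⟨hτ.1, hacc hτ.2⟩ m, fun hδt1 => ?_,
    E.continuation d (QG.sector d θS) w₁ w₂,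
    fun ε hε m => ⟨fun τ hτ => hW ε hε τ (hacc hτ) m, (hWτ ε hε m).mono hdomain⟩,
    ⟨ϖ, hϖ, fun ε hε m τ hτ => ?_⟩,
    hWc.mono (Set.prod_mono hdomain subset_rfl),
    fun τ hτ => hWε τ (hdomain hτ)⟩
  · refine ⟨min θS (Real.pi / 2), r₁, lt_min hθS (by positivity), hr₁, fun τ hτ => ?_⟩
    exact ⟨⟨hτ.1.1, hτ.1.2.trans_le (min_le_left _ _)⟩,
      QG.sector_subset_lapDomain_of_lt_one (min_le_right _ _) hδt1 hτ.1, hτ.2⟩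
  · rw [QG.Exponents.continuation, if_pos hτ]
    exact hw₂.bound ε hε τ (Or.inl hτ) m
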